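/- **Theorem (complexity of DSM-FLOW).** Let $\mathcal H=(V,E)$ be a hypergraph with $n=|V|$ vertices and $m=|E|\ge 1$ hyperedges, each hyperedge being a non-empty subset of $V$; let $\bar d_e=\frac1m\sum_{e\in E}|e|$ be the average hyperedge size and let $k,\delta\ge 0$ be integers. An orientation of $\mathcal H$ splits every $e\in E$ into a set $H_e\subseteq e$ of targets and the set $T_e=e\setminus H_e$ of sources; it is a $\delta$-orientation if $|H_e|=\min\{\delta,|e|\}$ for all $e$. The indegree $\vec d_u$ of $u$ is the number of $e$ with $u\in H_e$, and $u$ reaches $w$ if there are $u=u_0,e_0,u_1,\dots,e_{l-1},u_l=w$ with $u_i\in T_{e_i}$, $u_{i+1}\in H_{e_i}$. The algorithm DSM-FLOW does the following. 1. It obtains an arbitrary $\delta$-orientation of $\mathcal H$ and puts $d=k-1$. 2. It builds the re-orientation network on the nodes $V\cup\{v_e: e\in E\}\cup\{s,t\}$: arcs $\langle u,v_e\rangle$ of capacity $1$ for $u\in T_e$, arcs $\langle v_e,u\rangle$ of capacity $1$ for $u\in H_e$, arcs $\langle s,u\rangle$ of capacity $d-\vec d_u$ for $\vec d_u<d$,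 and arcs $\langle u,t\rangle$ of capacity $\vec d_u-d$ for $\vec d_u>d$. (So all arcs that do not touch $s$ or $t$ have capacity one.) 3. It computes a maximum $s$–$t$ flow in this network. 4. It reverses all pairs of arcs $\langle x,v_e\rangle,\langle v_e,y\rangle$ that are both saturated ($x$ becomes a target and $y$ a source of $e$). 5. It outputs $S\cup\{v: v \text{ reaches a vertex of } S\}$, where $S=\{u:\vec d_u\ge k\}$ in the resulting orientation. There is an implementation of DSM-FLOW on a random access machine with unit cost per instruction, and an absolute constant $C$, such that for all $\mathcal H$ (given by listing the vertices of each hyperedge), $k$ and $\delta$, whatever the initial $\delta$-orientation is, the algorithm uses at most $C\,(n+m\bar d_e)$ memory cells, and its running time is at most $C\,m^{1.5}\bar d_e^{1.5}$ if every vertex lies in at least one hyperedge, and at most $C\,(n+m^{1.5}\bar d_e^{1.5})$ in general. -/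

import Mathlib

noncomputable section

namespace DSM

/-! ### Hypergraphs and orientations -/

/-- A hypergraph with vertex set `Fin n` and `m` distinct non-empty hyperedges. -/
structure Hypergraph (n m : ℕ) where
  edge : Fin m → Finset (Fin n)
  nonempty : ∀ e, (edge e).Nonempty
  injective : Function.Injective edge

namespace Hypergraph

variable {n m : ℕ}

/-- The average hyperedge size `(1/m) ∑ |e|`. -/
def avgSize (H : Hypergraph n m) : ℝ := (1 / (m : ℝ)) * ∑ e, ((H.edge e).card : ℝ)

end Hypergraph

/-- An orientation: each hyperedge `e` becomes `(T, H)` with `H = head e` and `T = e \ H`. -/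
structure Orientation {n m : ℕ} (G : Hypergraph n m) where
  head : Fin m → Finset (Fin n)
  head_subset : ∀ e, head e ⊆ G.edge e

namespace Orientation

variable {n m : ℕ} {G : Hypergraph n m}

/-- The source vertices `T` of a directed hyperedge. -/
def tail (O : Orientation G) (e : Fin m) : Finset (Fin n) := G.edge e \ O.head e

/-- The indegree of a vertex. -/
def indeg (O : Orientation G) (u : Fin n) : ℕ := (Finset.univ.filter fun e => u ∈ O.head e).card

/-- `O` is a `δ`-orientation. -/
def IsDelta (O : Orientation G) (δ : ℕ) : Prop :=
  ∀ e, (O.head e).card = min δ (G.edge e).card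

/-- There is a hyperpath from `u` to `w`. -/
def Reaches (O : Orientation G) (u w : Fin n) : Prop :=
  Relation.ReflTransGen (fun x y => ∃ e, x ∈ O.tail e ∧ y ∈ O.head e) u w

/-- `S ∪ {v | v can reach a vertex of S}`, where `S` is the set of vertices of indegree `≥ k`. -/
def denseSet (O : Orientation G) (k : ℕ) : Set (Fin n) :=
  {u | k ≤ O.indeg u} ∪ {v | ∃ u, k ≤ O.indeg u ∧ O.Reaches v u}

end Orientation

/-! ### Networks, flows, and the re-orientation network -/

/-- The nodes of the re-orientation network: vertices, hyperedges, a source and a sink. -/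
inductive Node (n m : ℕ) where
  | vert (u : Fin n)
  | edge (e : Fin m)
  | source
  | sink
  deriving DecidableEq, Fintype

/-- A flow for the capacities `c` (where `c x y = 0` means that there is no arc `⟨x, y⟩`). -/
structure IsFlow {N : Type} [Fintype N] (c : N → N → ℝ) (s t : N) (f : N → N → ℝ) : Prop where
  nonneg : ∀ x y, 0 ≤ f x y
  le_capacity : ∀ x y, f x y ≤ c x y
  conservation : ∀ y, y ≠ s → y ≠ t → ∑ x, f x y = ∑ z, f y z

/-- The value of a flow: what leaves the source minus what enters it. -/
def flowValue {N : Type} [Fintype N] (s : N) (f : N → N → ℝ) : ℝ := ∑ y, f s y - ∑ y, f y s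

/-- A flow of maximum value. -/
def IsMaxFlow {N : Type} [Fintype N] (c : N → N → ℝ) (s t : N) (f : N → N → ℝ) : Prop :=
  IsFlow c s t f ∧ ∀ g, IsFlow c s t g → flowValue s g ≤ flowValue s f

namespace Orientation

variable {n m : ℕ} {G : Hypergraph n m}

/-- The capacities of the re-orientation network of `O` with parameter `d`; the arcs are the pairs
of positive capacity. -/
def capacity (O : Orientation G) (d : ℤ) : Node n m → Node n m → ℝ
  | .vert u, .edge e => if u ∈ O.tail e then 1 else 0
  | .edge e, .vert u => if u ∈ O.head e then 1 else 0
  | .source, .vert u => if (O.indeg u : ℤ) < d then (d : ℝ) - O.indeg u else 0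
  | .vert u, .sink => if d < (O.indeg u : ℤ) then (O.indeg u : ℝ) - d else 0
  | _, _ => 0

/-- The two arcs `⟨x, v_e⟩` and `⟨v_e, y⟩` of the network exist and are both saturated by `f`. -/
def SaturatedPair (O : Orientation G) (d : ℤ) (f : Node n m → Node n m → ℝ)
    (x : Fin n) (e : Fin m) (y : Fin n) : Prop :=
  x ∈ O.tail e ∧ y ∈ O.head e ∧
    f (.vert x) (.edge e) = O.capacity d (.vert x) (.edge e) ∧
    f (.edge e) (.vert y) = O.capacity d (.edge e) (.vert y)

open Classical in
/-- Reverse the arcs `⟨x, v_e⟩`, `⟨v_e, y⟩` of all saturated pairs: `x` becomes a target vertex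
of `e`, and `y` becomes a source vertex of `e`. -/
def reverseSaturated (O : Orientation G) (d : ℤ) (f : Node n m → Node n m → ℝ) :
    Orientation G where
  head e := (G.edge e).filter fun u =>
    (u ∈ O.head e ∧ ¬ ∃ x, O.SaturatedPair d f x e u) ∨ ∃ y, O.SaturatedPair d f u e y
  head_subset _ := Finset.filter_subset _ _

end Orientation

/-! ### The machine model

A random access machine with registers `0, 1, 2, …` (of which a program uses finitely many) and
memory arrays `0, 1, 2, …` (again finitely many per program), all holding natural numbers. Every
instruction and every test costs one step. Numbers grow only by steps of one, so a run of `t` steps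
never holds a number larger than `t` plus the largest number in its input and its program. -/

/-- A machine state; `used` is the set of the memory cells `(array, index)` accessed so far. -/
structure State where
  reg : ℕ → ℕ
  mem : ℕ → ℕ → ℕ
  used : Finset (ℕ × ℕ)

/-- Set register `r` to `v`. -/
def State.setReg (σ : State) (r v : ℕ) : State := { σ with reg := Function.update σ.reg r v }

/-- Record an access to cell `i` of array `a`. -/
def State.touch (σ : State) (a i : ℕ) : State := { σ with used := insert (a, i) σ.used }

/-- Write `v` into cell `i` of array `a`. -/
def State.setMem (σ : State) (a i v : ℕ) : State :=
  { σ with mem := Function.update σ.mem a (Function.update (σ.mem a) i v) }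

/-- Programs. Every argument is a register number, except that `c` is a literal and `a` is
an array number. -/
inductive Prog where
  /-- register `r` := the literal `c` -/
  | const (r c : ℕ)
  /-- register `r` := register `x` -/
  | copy (r x : ℕ)
  /-- register `r` := register `r` + 1 -/
  | inc (r : ℕ)
  /-- register `r` := register `x` - register `y`, truncated at `0` -/
  | sub (r x y : ℕ)
  /-- register `r` := cell of array `a` whose index is in register `x` -/
  | load (r a x : ℕ)
  /-- cell of array `a` whose index is in register `x` := register `r` -/
  | store (a x r : ℕ)
  /-- first `P`, then `Q` -/
  | seq (P Q : Prog)
  /-- if register `x` < register `y` then `P` else `Q` -/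
  | ifLt (x y : ℕ) (P Q : Prog)
  /-- while register `x` < register `y` do `P` -/
  | whileLt (x y : ℕ) (P : Prog)

/-- `Exec P σ t τ`: program `P`, started in state `σ`, halts in state `τ` after `t` steps. -/
inductive Exec : Prog → State → ℕ → State → Prop where
  | const (r c : ℕ) (σ : State) : Exec (.const r c) σ 1 (σ.setReg r c)
  | copy (r x : ℕ) (σ : State) : Exec (.copy r x) σ 1 (σ.setReg r (σ.reg x))
  | inc (r : ℕ) (σ : State) : Exec (.inc r) σ 1 (σ.setReg r (σ.reg r + 1))
  | sub (r x y : ℕ) (σ : State) : Exec (.sub r x y) σ 1 (σ.setReg r (σ.reg x - σ.reg y))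
  | load (r a x : ℕ) (σ : State) :
      Exec (.load r a x) σ 1 ((σ.touch a (σ.reg x)).setReg r (σ.mem a (σ.reg x)))
  | store (a x r : ℕ) (σ : State) :
      Exec (.store a x r) σ 1 ((σ.touch a (σ.reg x)).setMem a (σ.reg x) (σ.reg r))
  | seq {P Q : Prog} {σ τ ρ : State} {t u : ℕ} :
      Exec P σ t τ → Exec Q τ u ρ → Exec (.seq P Q) σ (t + u) ρ
  | ifTrue {x y : ℕ} {P Q : Prog} {σ τ : State} {t : ℕ} :
      σ.reg x < σ.reg y → Exec P σ t τ → Exec (.ifLt x y P Q) σ (t + 1) τ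
  | ifFalse {x y : ℕ} {P Q : Prog} {σ τ : State} {t : ℕ} :
      ¬ σ.reg x < σ.reg y → Exec Q σ t τ → Exec (.ifLt x y P Q) σ (t + 1) τ
  | whileTrue {x y : ℕ} {P : Prog} {σ τ ρ : State} {t u : ℕ} :
      σ.reg x < σ.reg y → Exec P σ t τ → Exec (.whileLt x y P) τ u ρ →
        Exec (.whileLt x y P) σ (t + u + 1) ρ
  | whileFalse {x y : ℕ} {P : Prog} {σ : State} :
      ¬ σ.reg x < σ.reg y → Exec (.whileLt x y P) σ 1 σ

/-! ### How the objects are stored -/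

/-- A listing of the vertices of every hyperedge, in an arbitrary order without repetitions. -/
structure Listing {n m : ℕ} (G : Hypergraph n m) where
  verts : Fin m → List (Fin n)
  nodup : ∀ e, (verts e).Nodup
  toFinset_eq : ∀ e, (verts e).toFinset = G.edge e

namespace Listing

variable {n m : ℕ} {G : Hypergraph n m}

/-- The position at which hyperedge `i` starts when the lists are concatenated. -/
def offset (L : Listing G) (i : ℕ) : ℕ :=
  ∑ e ∈ Finset.univ.filter (fun e : Fin m => (e : ℕ) < i), (L.verts e).length

/-- The concatenation of the lists of all hyperedges. -/
def flat (L : Listing G) : List ℕ := (List.ofFn L.verts).flatten.map Fin.val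

/-- The initial state: `n`, `m`, `k`, `δ` in the registers `0`, `1`, `2`, `3`, the offsets of the
hyperedges in array `0`, their concatenated lists in array `1`, and `0` everywhere else. -/
def input (L : Listing G) (k δ : ℕ) : State where
  reg r := if r = 0 then n else if r = 1 then m else if r = 2 then k else if r = 3 then δ else 0
  mem a i := if a = 0 then (if i ≤ m then L.offset i else 0)
    else if a = 1 then L.flat.getD i 0 else 0
  used := ∅

/-- Array `2` marks, at each position of the concatenated list, whether the vertex listed there is
a target vertex (`1`) or a source vertex (`0`) of its hyperedge. -/
def HoldsOrientation (L : Listing G) (O : Orientation G) (σ : State) : Prop :=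
  ∀ (e : Fin m) (i : ℕ) (hi : i < (L.verts e).length),
    σ.mem 2 (L.offset e + i) = if (L.verts e)[i] ∈ O.head e then 1 else 0

end Listing

/-- The number by which a node of the network is represented. -/
def Node.code {n m : ℕ} : Node n m → ℕ
  | .vert u => u
  | .edge e => n + e
  | .source => n + m
  | .sink => n + m + 1

/-- The network with capacities `c` is stored as a list of all its arcs, without repetitions:
register `4` holds their number, and the arrays `3`, `4`, `5` hold start node, end node and
capacity of each arc. -/
def HoldsNetwork {n m : ℕ} (c : Node n m → Node n m → ℝ) (σ : State) : Prop :=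
  (∀ x y, 0 < c x y → ∃! i, i < σ.reg 4 ∧ σ.mem 3 i = x.code ∧ σ.mem 4 i = y.code) ∧
  ∀ i < σ.reg 4, ∃ x y, 0 < c x y ∧
    σ.mem 3 i = x.code ∧ σ.mem 4 i = y.code ∧ (σ.mem 5 i : ℝ) = c x y

/-- Array `6` holds the value of `f` on each of the arcs listed in the arrays `3` and `4`. -/
def HoldsFlow {n m : ℕ} (f : Node n m → Node n m → ℝ) (σ : State) : Prop :=
  ∀ i < σ.reg 4, ∀ x y : Node n m, σ.mem 3 i = x.code → σ.mem 4 i = y.code →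
    (σ.mem 6 i : ℝ) = f x y

/-- Array `7` holds the indicator function of the vertex set `D`. -/
def HoldsSet {n : ℕ} (D : Set (Fin n)) (σ : State) : Prop :=
  ∀ u : Fin n, σ.mem 7 u = D.indicator (fun _ => 1) u

/-! ### The algorithm DSM-FLOW -/

/-- The five consecutive parts of a program for DSM-FLOW. -/
structure FlowProgram where
  orient : Prog
  network : Prog
  maxFlow : Prog
  reverse : Prog
  extract : Prog

/-- On input `(G, k, δ)`, listed as `L`, the program executes DSM-FLOW in `t` steps and accesses `s`
memory cells:
* `orient` obtains a `δ`-orientation `O`; its target vertices are the first ones listed, and as the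
  listing is arbitrary, so is `O`;
* `network` constructs the re-orientation network of `O` with parameter `d = k - 1`;
* `maxFlow` computes a maximum flow `f` of this network;
* `reverse` reverses the saturated pairs of arcs in `O`;
* `extract` computes, for the resulting orientation, the vertices of indegree at least `k` and
  those that can reach one of them. -/
def FlowProgram.Runs (A : FlowProgram) {n m : ℕ} {G : Hypergraph n m} (L : Listing G)
    (k δ t s : ℕ) : Prop :=
  ∃ (t₁ t₂ t₃ t₄ t₅ : ℕ) (σ₁ σ₂ σ₃ σ₄ σ₅ : State)
    (O : Orientation G) (f : Node n m → Node n m → ℝ),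
    let d : ℤ := (k : ℤ) - 1
    let O' := O.reverseSaturated d f
    (Exec A.orient (L.input k δ) t₁ σ₁ ∧
      O.IsDelta δ ∧ (∀ e, O.head e = ((L.verts e).take δ).toFinset) ∧ L.HoldsOrientation O σ₁) ∧
    (Exec A.network σ₁ t₂ σ₂ ∧ HoldsNetwork (O.capacity d) σ₂) ∧
    (Exec A.maxFlow σ₂ t₃ σ₃ ∧ IsMaxFlow (O.capacity d) .source .sink f ∧
      HoldsNetwork (O.capacity d) σ₃ ∧ HoldsFlow f σ₃) ∧
    (Exec A.reverse σ₃ t₄ σ₄ ∧ L.HoldsOrientation O' σ₄) ∧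
    (Exec A.extract σ₄ t₅ σ₅ ∧ HoldsSet (O'.denseSet k) σ₅) ∧
    t = t₁ + t₂ + t₃ + t₄ + t₅ ∧
    s = σ₅.used.card

end DSM

end

/-! The flow is computed by Dinic's algorithm. Let `M` be the number of incidences, so that `M` is
`m` times the average hyperedge size. The unit arcs of the network are held as a symmetric digraph
with `K = 2 * M` arcs: each incidence gives an arc from its vertex to its hyperedge and the reverse
arc, and exactly one of these two is residual. The arcs at the source and the sink are not part of
this digraph. They become supplies `sup` and demands `dem` of the vertices, and no node has both.
Thus a residual state is the same thing as an orientation: the arc from `u` to `e` is residual if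
`u` is a source of `e`, and the arc from `e` to `u` if `u` is a target.

A phase finds levels by breadth-first search from the supplies and then a blocking flow along
level-increasing residual arcs, by a depth-first search with a current-arc pointer at each node.
Both take time linear in `K`, by potential arguments (`scanLoop_spec`, `blockLoop_spec`).

The number of phases is bounded in two regimes (`PhaseBound.decrease`). Each phase raises the
distance from supplies to demands by at least one (`IsBlocking.levelBound`). Once the distance is at
least `D`, some level cut has at most `K / D` residual arcs (`LevelBound.cutBound`). From then on
every phase delivers at least one unit (`IsBlocking.exists_gain`) and so lowers the residual
capacity of a cut (`IsBlocking.cutBound`). Hence there are at most `D + K / D` phases, and taking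
`D` close to the square root of `K` gives the exponent `3 / 2`.

When no demand can be reached any more, the residual state is an orientation `O'`. Its difference
from the initial orientation `O` is a flow (`IsChange.isFlow`), which is maximum because the visited
nodes form a saturated cut (`IsChange.isMaxFlow`). Reversing the saturated pairs gives exactly `O'`,
since every hyperedge gains as many targets as it loses (`IsChange.reverseSaturated_eq`). The output
then comes from one more breadth-first search in the reversed residual digraph (`mem_denseSet_iff`).

All remaining work is linear in `n + M`, and `n ≤ M` if every vertex lies in a hyperedge. Time and
memory are accounted for by a total-correctness calculus `wp`, in which each loop has an invariant
and a potential that pays for its steps. -/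

namespace DSM

/-! ### Weakest preconditions with time and a bound on the accessed cells -/

infixr:60 " ;; " => Prog.seq

@[simp] theorem State.reg_setReg (σ : State) (r v s : ℕ) :
    (σ.setReg r v).reg s = if s = r then v else σ.reg s := by
  simp [State.setReg, Function.update_apply]

@[simp] theorem State.mem_setReg (σ : State) (r v : ℕ) : (σ.setReg r v).mem = σ.mem := rfl

@[simp] theorem State.reg_touch (σ : State) (a i : ℕ) : (σ.touch a i).reg = σ.reg := rfl

@[simp] theorem State.mem_touch (σ : State) (a i : ℕ) : (σ.touch a i).mem = σ.mem := rfl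

@[simp] theorem State.reg_setMem (σ : State) (a i v : ℕ) : (σ.setMem a i v).reg = σ.reg := rfl

@[simp] theorem State.mem_setMem (σ : State) (a i v b : ℕ) :
    (σ.setMem a i v).mem b = if b = a then Function.update (σ.mem a) i v else σ.mem b := by
  simp [State.setMem, Function.update_apply]

/-- The number of arrays at the disposal of a program. -/
def numArrays : ℕ := 32

/-- The cells with index less than `B`. -/
def cells (B : ℕ) : Finset (ℕ × ℕ) := Finset.range numArrays ×ˢ Finset.range B

/-- `P`, started in `σ`, halts in some state `τ` after `t` steps such that `Q τ t`, and all cells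
that it accesses have an index less than `B`. -/
def wp (B : ℕ) (P : Prog) (Q : State → ℕ → Prop) (σ : State) : Prop :=
  ∃ t τ, Exec P σ t τ ∧ τ.used ⊆ σ.used ∪ cells B ∧ Q τ t

/-- The registers that a program may change. -/
def Prog.setsReg : Prog → ℕ → Bool
  | .const r _, s => s == r
  | .copy r _, s => s == r
  | .inc r, s => s == r
  | .sub r _ _, s => s == r
  | .load r _ _, s => s == r
  | .store _ _ _, _ => false
  | .seq P Q, s => P.setsReg s || Q.setsReg s
  | .ifLt _ _ P Q, s => P.setsReg s || Q.setsReg s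
  | .whileLt _ _ P, s => P.setsReg s

/-- The arrays that a program may change. -/
def Prog.setsMem : Prog → ℕ → Bool
  | .store a _ _, b => b == a
  | .seq P Q, b => P.setsMem b || Q.setsMem b
  | .ifLt _ _ P Q, b => P.setsMem b || Q.setsMem b
  | .whileLt _ _ P, b => P.setsMem b
  | _, _ => false

/-- `σ` and `τ` differ only where `P` may make changes. -/
structure Frame (P : Prog) (σ τ : State) : Prop where
  reg : ∀ r, P.setsReg r = false → τ.reg r = σ.reg r
  mem : ∀ a, P.setsMem a = false → τ.mem a = σ.mem a

theorem Frame.refl (P : Prog) (σ : State) : Frame P σ σ := ⟨fun _ _ => rfl, fun _ _ => rfl⟩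

theorem Frame.trans {P : Prog} {σ τ ρ : State} (h₁ : Frame P σ τ) (h₂ : Frame P τ ρ) :
    Frame P σ ρ :=
  ⟨fun r h => (h₂.reg r h).trans (h₁.reg r h), fun a h => (h₂.mem a h).trans (h₁.mem a h)⟩

/-- The sets of registers and arrays that may be written are Boolean functions of the program text.
For a concrete program the side conditions of a frame are therefore closed by `rfl`. -/
theorem Exec.frame {P : Prog} {σ τ : State} {t : ℕ} (h : Exec P σ t τ) : Frame P σ τ := by
  induction h with
  | whileTrue _ _ _ ih₁ ih₂ =>
    exact ⟨fun r h => (ih₂.reg r h).trans (ih₁.reg r h),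
      fun a h => (ih₂.mem a h).trans (ih₁.mem a h)⟩
  | seq _ _ ih₁ ih₂ =>
    constructor
    · intro r h
      simp only [Prog.setsReg, Bool.or_eq_false_iff] at h
      exact (ih₂.reg r h.2).trans (ih₁.reg r h.1)
    · intro a h
      simp only [Prog.setsMem, Bool.or_eq_false_iff] at h
      exact (ih₂.mem a h.2).trans (ih₁.mem a h.1)
  | ifTrue _ _ ih =>
    constructor
    · intro r h
      simp only [Prog.setsReg, Bool.or_eq_false_iff] at h
      exact ih.reg r h.1
    · intro a h
      simp only [Prog.setsMem, Bool.or_eq_false_iff] at h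
      exact ih.mem a h.1
  | ifFalse _ _ ih =>
    constructor
    · intro r h
      simp only [Prog.setsReg, Bool.or_eq_false_iff] at h
      exact ih.reg r h.2
    · intro a h
      simp only [Prog.setsMem, Bool.or_eq_false_iff] at h
      exact ih.mem a h.2
  | whileFalse _ => exact Frame.refl _ _
  | _ =>
    constructor
    · intro r h
      simp_all [Prog.setsReg]
    · intro a h
      simp_all [Prog.setsMem]

/-- The rule of consequence also supplies the frame of the run, so postconditions need only mention
what the program changes. -/
theorem wp.mono {B : ℕ} {P : Prog} {Q R : State → ℕ → Prop} {σ : State} (h : wp B P Q σ)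
    (hQR : ∀ τ t, Frame P σ τ → Q τ t → R τ t) : wp B P R σ := by
  obtain ⟨t, τ, he, hu, hq⟩ := h
  exact ⟨t, τ, he, hu, hQR τ t he.frame hq⟩

theorem wp.seq {B : ℕ} {P P' : Prog} {Q : State → ℕ → Prop} {σ : State}
    (h : wp B P (fun τ t => wp B P' (fun ρ u => Q ρ (t + u)) τ) σ) : wp B (P ;; P') Q σ := by
  obtain ⟨t, τ, he, hu, u, ρ, he', hu', hq⟩ := h
  refine ⟨t + u, ρ, he.seq he', hu'.trans ?_, hq⟩
  exact Finset.union_subset hu Finset.subset_union_right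

/-- The rule for a loop with invariant `I` and potential `Φ`. -/
theorem wp.while {B x y : ℕ} {P : Prog} (I : State → Prop) (Φ : State → ℕ) {σ : State}
    (hI : I σ)
    (step : ∀ τ, Frame P σ τ → I τ → τ.reg x < τ.reg y →
      wp B P (fun ρ t => I ρ ∧ t + 1 + Φ ρ ≤ Φ τ) τ) :
    wp B (.whileLt x y P) (fun τ t => I τ ∧ ¬ τ.reg x < τ.reg y ∧ t + Φ τ ≤ Φ σ + 1) σ := by
  -- Strong induction on the potential. The frame since the loop entry is carried along for use in
  -- `step`. The `+ 1` in the cost of a round pays for its successful test, the `+ 1` in the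
  -- conclusion for the final failing one.
  suffices H : ∀ N τ, Φ τ = N → Frame P σ τ → I τ →
      wp B (.whileLt x y P) (fun ρ t => I ρ ∧ ¬ ρ.reg x < ρ.reg y ∧ t + Φ ρ ≤ Φ τ + 1) τ from
    H _ σ rfl (Frame.refl _ _) hI
  intro N
  induction N using Nat.strong_induction_on with
  | _ N ih =>
    intro τ hN hF hI
    by_cases hlt : τ.reg x < τ.reg y
    · obtain ⟨t, ρ, he, hu, hIρ, ht⟩ := step τ hF hI hlt
      obtain ⟨u, π, he', hu', hIπ, hlt', ht'⟩ :=
        ih (Φ ρ) (by omega) ρ rfl (hF.trans he.frame) hIρ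
      refine ⟨t + u + 1, π, .whileTrue hlt he he', hu'.trans ?_, hIπ, hlt', by omega⟩
      exact Finset.union_subset hu Finset.subset_union_right
    · exact ⟨1, τ, .whileFalse hlt, Finset.subset_union_left, hI, hlt, by omega⟩

/-- Verification condition of a program without loops, started at time `t`. -/
def vc (B : ℕ) : Prog → (State → ℕ → Prop) → State → ℕ → Prop
  | .const r c, Q, σ, t => Q (σ.setReg r c) (t + 1)
  | .copy r x, Q, σ, t => Q (σ.setReg r (σ.reg x)) (t + 1)
  | .inc r, Q, σ, t => Q (σ.setReg r (σ.reg r + 1)) (t + 1)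
  | .sub r x y, Q, σ, t => Q (σ.setReg r (σ.reg x - σ.reg y)) (t + 1)
  | .load r a x, Q, σ, t => a < numArrays ∧ σ.reg x < B ∧
      Q ((σ.touch a (σ.reg x)).setReg r (σ.mem a (σ.reg x))) (t + 1)
  | .store a x r, Q, σ, t => a < numArrays ∧ σ.reg x < B ∧
      Q ((σ.touch a (σ.reg x)).setMem a (σ.reg x) (σ.reg r)) (t + 1)
  | .seq P P', Q, σ, t => vc B P (fun τ u => vc B P' Q τ u) σ t
  | .ifLt x y P P', Q, σ, t =>
      (σ.reg x < σ.reg y → vc B P Q σ (t + 1)) ∧ (σ.reg y ≤ σ.reg x → vc B P' Q σ (t + 1))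
  | .whileLt _ _ _, _, _, _ => False

theorem touch_used_subset {B a i : ℕ} {σ : State} (ha : a < numArrays) (hi : i < B) :
    insert (a, i) σ.used ⊆ σ.used ∪ cells B := by
  intro z hz
  rcases Finset.mem_insert.1 hz with rfl | hz
  · simp [cells, ha, hi]
  · exact Finset.mem_union_left _ hz

theorem exec_of_vc {B : ℕ} {P : Prog} : ∀ {Q : State → ℕ → Prop} {σ : State} {t : ℕ},
    vc B P Q σ t → ∃ u τ, Exec P σ u τ ∧ τ.used ⊆ σ.used ∪ cells B ∧ Q τ (t + u) := by
  induction P with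
  | const r c => exact fun h => ⟨1, _, .const .., Finset.subset_union_left, h⟩
  | copy r x => exact fun h => ⟨1, _, .copy .., Finset.subset_union_left, h⟩
  | inc r => exact fun h => ⟨1, _, .inc .., Finset.subset_union_left, h⟩
  | sub r x y => exact fun h => ⟨1, _, .sub .., Finset.subset_union_left, h⟩
  | load r a x => exact fun h => ⟨1, _, .load .., touch_used_subset h.1 h.2.1, h.2.2⟩
  | store a x r => exact fun h => ⟨1, _, .store .., touch_used_subset h.1 h.2.1, h.2.2⟩
  | seq P P' ih ih' =>
    intro Q σ t h
    obtain ⟨u, τ, he, hu, h⟩ := ih h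
    obtain ⟨v, ρ, he', hu', h⟩ := ih' h
    refine ⟨u + v, ρ, he.seq he', hu'.trans ?_, by rwa [← add_assoc]⟩
    exact Finset.union_subset hu Finset.subset_union_right
  | ifLt x y P P' ih ih' =>
    intro Q σ t h
    by_cases hlt : σ.reg x < σ.reg y
    · obtain ⟨u, τ, he, hu, h⟩ := ih (h.1 hlt)
      exact ⟨u + 1, τ, .ifTrue hlt he, hu, by rwa [add_comm u, ← add_assoc]⟩
    · obtain ⟨u, τ, he, hu, h⟩ := ih' (h.2 (not_lt.1 hlt))
      exact ⟨u + 1, τ, .ifFalse hlt he, hu, by rwa [add_comm u, ← add_assoc]⟩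
  | whileLt => exact fun h => h.elim

theorem wp.of_vc {B : ℕ} {P : Prog} {Q : State → ℕ → Prop} {σ : State} (h : vc B P Q σ 0) :
    wp B P Q σ := by
  obtain ⟨u, τ, he, hu, h⟩ := exec_of_vc h
  exact ⟨u, τ, he, hu, by rwa [zero_add] at h⟩

theorem wp.vc_seq {B : ℕ} {P P' : Prog} {Q : State → ℕ → Prop} {σ : State}
    (h : vc B P (fun τ t => wp B P' (fun ρ u => Q ρ (t + u)) τ) σ 0) : wp B (P ;; P') Q σ :=
  (wp.of_vc h).seq

/-- A skip, as a program that copies a register to itself. -/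
def skip : Prog := .copy 31 31

end DSM

/-! ### Dinic's algorithm on an abstract arc list -/

namespace DSM

open Finset Function

/-! ### Arc lists -/

/-- The arcs `0, …, K - 1` of a symmetric digraph: `own h` is the start node of `h`, `tw h` is the
reverse arc, and the arcs with start node `x` form a list with first element `head x` and successor
function `nxt`; in the list, `h` is represented by `h + 1`, and `0` is its end. -/
structure ArcList (K : ℕ) (own tw nxt head : ℕ → ℕ) : Prop where
  tw_lt : ∀ h < K, tw h < K
  tw_tw : ∀ h < K, tw (tw h) = h
  nxt_le : ∀ h < K, nxt h ≤ h
  nxt_own : ∀ h < K, nxt h ≠ 0 → own (nxt h - 1) = own h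
  nxt_gap : ∀ h < K, ∀ g, nxt h ≤ g → g < h → own g ≠ own h
  head_le : ∀ h < K, head (own h) ≤ K
  head_own : ∀ h < K, own (head (own h) - 1) = own h
  lt_head : ∀ h < K, h < head (own h)

/-- The pointers `cur` point into the lists. -/
def CurOK (K : ℕ) (own cur : ℕ → ℕ) : Prop :=
  ∀ h < K, cur (own h) ≠ 0 → cur (own h) ≤ K ∧ own (cur (own h) - 1) = own h

/-- The number of arcs that the pointers `cur` have not yet passed. -/
def pending (K : ℕ) (own cur : ℕ → ℕ) : ℕ := #{h ∈ range K | h < cur (own h)}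

theorem pending_le (K : ℕ) (own cur : ℕ → ℕ) : pending K own cur ≤ K := by
  simpa [pending] using card_filter_le (range K) (fun h => h < cur (own h))

section

variable {K : ℕ} {own tw nxt head : ℕ → ℕ}

/-- Each list runs through its arcs in decreasing order, so an arc `h` has been passed exactly if
`cur (own h) ≤ h`. By `nxt_gap` no arc of the same node lies between `nxt g` and `g`, hence moving
the pointer from `g + 1` to `nxt g` passes `g` and nothing else. -/
theorem passed_update (A : ArcList K own tw nxt head) {cur : ℕ → ℕ} {g : ℕ} (hg : g < K) (hc : cur (own g) = g + 1) (h : ℕ) :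
    update cur (own g) (nxt g) (own h) ≤ h ↔ cur (own h) ≤ h ∨ h = g := by
  by_cases e : own h = own g
  · rw [e, update_self, hc]
    constructor
    · intro hn
      by_contra! hh
      exact A.nxt_gap g hg h hn (by omega) e
    · have := A.nxt_le g hg
      omega
  · rw [update_of_ne e]
    constructor
    · exact Or.inl
    · rintro (h' | rfl)
      · exact h'
      · exact absurd rfl e

theorem curOK_update (A : ArcList K own tw nxt head) {cur : ℕ → ℕ} (hcur : CurOK K own cur) {g : ℕ} (hg : g < K) :
    CurOK K own (update cur (own g) (nxt g)) := by
  intro h hh hne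
  by_cases e : own h = own g
  · rw [e, update_self] at hne ⊢
    have := A.nxt_le g hg
    exact ⟨by omega, A.nxt_own g hg hne⟩
  · rw [update_of_ne e] at hne ⊢
    exact hcur h hh hne

theorem pending_update (A : ArcList K own tw nxt head) {cur : ℕ → ℕ} {g : ℕ} (hg : g < K) (hc : cur (own g) = g + 1) :
    pending K own (update cur (own g) (nxt g)) + 1 ≤ pending K own cur := by
  unfold pending
  have hmem : g ∈ {h ∈ range K | h < cur (own h)} := by simp [hg, hc]
  rw [← card_erase_add_one hmem]
  gcongr
  intro h
  simp only [mem_filter, mem_erase, mem_range]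
  intro ⟨h1, h2⟩
  have := (passed_update A hg hc h).not.1 (by omega)
  push Not at this
  exact ⟨this.2, h1, this.1⟩

theorem curOK_head (A : ArcList K own tw nxt head) : CurOK K own head :=
  fun h hh _ => ⟨A.head_le h hh, A.head_own h hh⟩

/-! ### Breadth-first search -/

/-- What breadth-first search computes: `lev x` is one plus the distance of `x` from the nodes with
`0 < sup`, or `0` if `x` cannot be reached from them. -/
structure IsLevel (K : ℕ) (own tw sup res lev : ℕ → ℕ) : Prop where
  seed : ∀ h < K, 0 < sup (own h) → lev (own h) = 1
  step : ∀ h < K, res h = 1 → 0 < lev (own h) →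
    0 < lev (own (tw h)) ∧ lev (own (tw h)) ≤ lev (own h) + 1
  reason : ∀ h < K, 0 < lev (own h) → (lev (own h) = 1 ∧ 0 < sup (own h)) ∨
    ∃ g < K, res g = 1 ∧ own (tw g) = own h ∧ lev (own h) = lev (own g) + 1 ∧ 0 < lev (own g)
  le : ∀ h < K, lev (own h) ≤ K

/-- The number of arcs whose start node has not been visited. -/
def unvisited (K : ℕ) (own lev : ℕ → ℕ) : ℕ := #{h ∈ range K | lev (own h) = 0}

/-- The invariant of breadth-first search. -/
structure BfsInv (K : ℕ) (own tw sup res lev cur q : ℕ → ℕ) (qh qt s : ℕ) : Prop where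
  cur_ok : CurOK K own cur
  qh_le : qh ≤ qt
  q_own : ∀ i < qt, ∃ h < K, own h = q i
  q_lev : ∀ i < qt, 0 < lev (q i) ∧ lev (q i) ≤ i + 1
  lev_q : ∀ h < K, 0 < lev (own h) → ∃ i < qt, q i = own h
  done : ∀ i < qh, cur (q i) = 0
  passed : ∀ h < K, cur (own h) ≤ h → res h = 1 →
    0 < lev (own (tw h)) ∧ lev (own (tw h)) ≤ lev (own h) + 1
  mono : ∀ i j, i ≤ j → j < qt → lev (q i) ≤ lev (q j)
  span : qh < qt → ∀ j < qt, lev (q j) ≤ lev (q qh) + 1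
  seed : ∀ h < K, h < s → 0 < sup (own h) → lev (own h) = 1
  fresh : ∀ h < K, lev (own h) = 0 → h < cur (own h)
  reason : ∀ h < K, 0 < lev (own h) → (lev (own h) = 1 ∧ 0 < sup (own h)) ∨
    ∃ g < K, res g = 1 ∧ own (tw g) = own h ∧ lev (own h) = lev (own g) + 1 ∧ 0 < lev (own g)
  count : qt + unvisited K own lev ≤ K

variable {sup res lev cur q : ℕ → ℕ} {qh qt s : ℕ}

/-- With an empty queue every visited node has been dequeued, so its pointer is `0` and all its arcs
have been passed. The bound by `K` holds because the level of the `i`-th queue entry is at most `i +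
1` and the queue has at most `K` entries. -/
theorem BfsInv.isLevel (I : BfsInv K own tw sup res lev cur q qh qt K) (hq : ¬ qh < qt) :
    IsLevel K own tw sup res lev where
  seed h hh := I.seed h hh hh
  step h hh hr hl := by
    obtain ⟨i, hi, e⟩ := I.lev_q h hh hl
    have := I.done i (by omega)
    exact I.passed h hh (by rw [← e, this]; omega) hr
  reason := I.reason
  le h hh := by
    rcases Nat.eq_zero_or_pos (lev (own h)) with h0 | h0
    · omega
    obtain ⟨i, hi, e⟩ := I.lev_q h hh h0
    have := I.q_lev i hi
    have := I.count
    rw [e] at *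
    omega

theorem BfsInv.dequeue (I : BfsInv K own tw sup res lev cur q qh qt s) (hq : qh < qt)
    (hc : cur (q qh) = 0) : BfsInv K own tw sup res lev cur q (qh + 1) qt s :=
  { I with
    qh_le := hq
    done := fun i hi => by
      rcases Nat.lt_succ_iff_lt_or_eq.1 hi with h | rfl
      · exact I.done i h
      · exact hc
    span := fun hlt j hj => (I.span hq j hj).trans
      (Nat.add_le_add_right (I.mono _ _ (Nat.le_succ _) hlt) 1) }

theorem done_update {cur : ℕ → ℕ} {g : ℕ} (hc : cur (own g) = g + 1) {x : ℕ} (hx : cur x = 0) :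
    update cur (own g) (nxt g) x = 0 := by
  rw [update_of_ne, hx]
  rintro rfl
  omega

/-- The end node of a residual arc that is skipped is already in the queue, and by `span` no queue
entry lies more than one level above the current head. -/
theorem BfsInv.skip (A : ArcList K own tw nxt head) (I : BfsInv K own tw sup res lev cur q qh qt s) (hq : qh < qt)
    {g : ℕ} (hg : g < K) (hown : own g = q qh) (hc : cur (q qh) = g + 1)
    (hs : res g = 1 → 0 < lev (own (tw g))) :
    BfsInv K own tw sup res lev (update cur (q qh) (nxt g)) q qh qt s := by
  rw [← hown] at hc ⊢
  exact
  { I with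
    cur_ok := curOK_update A I.cur_ok hg
    done := fun i hi => done_update hc (I.done i hi)
    fresh := fun h hh hl => by
      rw [update_of_ne]
      · exact I.fresh h hh hl
      · intro e
        have := (I.q_lev qh hq).1
        rw [← hown, ← e] at this
        omega
    passed := fun h hh hp hr => by
      rcases (passed_update A hg hc h).1 hp with hp | rfl
      · exact I.passed h hh hp hr
      · refine ⟨hs hr, ?_⟩
        obtain ⟨i, hi, e⟩ := I.lev_q (tw h) (A.tw_lt h hh) (hs hr)
        rw [← e, hown]
        exact I.span hq i hi }

theorem BfsInv.seed_succ (I : BfsInv K own tw sup res lev cur q qh qt s)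
    (h : s < K → 0 < sup (own s) → lev (own s) = 1) :
    BfsInv K own tw sup res lev cur q qh qt (s + 1) :=
  { I with
    seed := fun g hg hgs hs => by
      rcases Nat.lt_succ_iff_lt_or_eq.1 hgs with h' | rfl
      · exact I.seed g hg h' hs
      · exact h hg hs }

theorem unvisited_update {y l : ℕ} (hy : ∃ h < K, own h = y) (h0 : lev y = 0) (hl : 0 < l) :
    unvisited K own (update lev y l) + 1 ≤ unvisited K own lev := by
  obtain ⟨g, hg, rfl⟩ := hy
  unfold unvisited
  have hmem : g ∈ {h ∈ range K | lev (own h) = 0} := by simp [hg, h0]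
  rw [← card_erase_add_one hmem]
  gcongr
  intro h
  simp only [mem_filter, mem_erase, mem_range]
  intro ⟨h1, h2⟩
  have hne : own h ≠ own g := by
    intro e
    rw [e, update_self] at h2
    omega
  rw [update_of_ne hne] at h2
  exact ⟨fun e => hne (by rw [e]), h1, h2⟩

/-- A node that is visited for the first time is appended to the queue. -/
theorem BfsInv.enqueue (I : BfsInv K own tw sup res lev cur q qh qt s) {y l : ℕ}
    (hy : ∃ h < K, own h = y) (h0 : lev y = 0) (hl : 0 < l) (hlq : l ≤ qt + 1)
    (hmono : ∀ i < qt, lev (q i) ≤ l) (hspan : qh < qt → l ≤ lev (q qh) + 1)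
    (hreason : (l = 1 ∧ 0 < sup y) ∨
      ∃ g < K, res g = 1 ∧ own (tw g) = y ∧ l = lev (own g) + 1 ∧ 0 < lev (own g))
    (hseed : 0 < sup y → l = 1) :
    BfsInv K own tw sup res (update lev y l) cur (update q qt y) qh (qt + 1) s := by
  have hq : ∀ i < qt, update q qt y i = q i := fun i hi => update_of_ne (by omega) _ _
  have hlev : ∀ x, 0 < lev x → update lev y l x = lev x := fun x hx =>
    update_of_ne (by rintro rfl; omega) _ _
  have hqlev : ∀ i < qt, update lev y l (update q qt y i) = lev (q i) := fun i hi => by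
    rw [hq i hi, hlev _ (I.q_lev i hi).1]
  have hqlev' : update lev y l (update q qt y qt) = l := by simp
  refine ⟨I.cur_ok, I.qh_le.trans (Nat.le_succ _), ?_, ?_, ?_, ?_, ?_, ?_, ?_, ?_, ?_, ?_, ?_⟩
  · intro i hi
    rcases Nat.lt_succ_iff_lt_or_eq.1 hi with h | rfl
    · rw [hq i h]; exact I.q_own i h
    · simpa using hy
  · intro i hi
    rcases Nat.lt_succ_iff_lt_or_eq.1 hi with h | rfl
    · rw [hqlev i h]; exact I.q_lev i h
    · rw [hqlev']; exact ⟨hl, hlq⟩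
  · intro h hh hp
    by_cases e : own h = y
    · exact ⟨qt, Nat.lt_succ_self _, by simp [e]⟩
    · rw [update_of_ne e] at hp
      obtain ⟨i, hi, e'⟩ := I.lev_q h hh hp
      exact ⟨i, by omega, by rw [hq i hi, e']⟩
  · intro i hi
    rw [hq i (lt_of_lt_of_le hi I.qh_le)]
    exact I.done i hi
  · intro h hh hp hr
    have := I.passed h hh hp hr
    rw [hlev _ this.1]
    -- The pointer of an unvisited node has not passed any of its arcs (`fresh`), so giving `y` a
    -- level cannot affect a passed arc that starts there.
    by_cases e : own h = y
    · have := I.fresh h hh (by rw [e, h0])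
      omega
    · rw [update_of_ne e]
      exact this
  · intro i j hij hj
    rcases Nat.lt_succ_iff_lt_or_eq.1 hj with h | rfl
    · rw [hqlev i (by omega), hqlev j h]; exact I.mono i j hij h
    · rw [hqlev']
      rcases hij.lt_or_eq with h | rfl
      · rw [hqlev i h]; exact hmono i h
      · rw [hqlev']
  · intro hlt j hj
    rcases I.qh_le.lt_or_eq with h' | h'
    · rw [hqlev qh h']
      rcases Nat.lt_succ_iff_lt_or_eq.1 hj with h | rfl
      · rw [hqlev j h]; exact I.span h' j h
      · rw [hqlev']; exact hspan h'
    · subst h'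
      rw [hqlev']
      rcases Nat.lt_succ_iff_lt_or_eq.1 hj with h | rfl
      · rw [hqlev j h]; exact (hmono j h).trans (Nat.le_succ _)
      · rw [hqlev']; omega
  · intro h hh hhs hs
    by_cases e : own h = y
    · rw [e, update_self]; exact hseed (e ▸ hs)
    · rw [update_of_ne e]; exact I.seed h hh hhs hs
  · intro h hh hl'
    by_cases e : own h = y
    · rw [e, update_self] at hl'; omega
    · rw [update_of_ne e] at hl'; exact I.fresh h hh hl'
  · intro h hh hp
    by_cases e : own h = y
    · rw [e, update_self]
      rcases hreason with h1 | ⟨g, hg, h1, h2, h3, h4⟩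
      · exact Or.inl h1
      · exact Or.inr ⟨g, hg, h1, h2, by rw [hlev _ h4, h3], by rwa [hlev _ h4]⟩
    · rw [update_of_ne e] at hp ⊢
      rcases I.reason h hh hp with h1 | ⟨g, hg, h1, h2, h3, h4⟩
      · exact Or.inl h1
      · exact Or.inr ⟨g, hg, h1, h2, by rw [hlev _ h4, h3], by rwa [hlev _ h4]⟩
  -- The new queue entry is paid for by an arc that starts at `y` and is unvisited no longer.
  · have := unvisited_update hy h0 hl
    have := I.count
    omega

end

end DSM

namespace DSM

open Finset Function

section

variable {K : ℕ} {own tw nxt head : ℕ → ℕ} {sup res lev cur q : ℕ → ℕ} {qh qt s : ℕ}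

theorem BfsInv.init (A : ArcList K own tw nxt head) (hlev : ∀ h < K, lev (own h) = 0)
    (hcur : ∀ h < K, cur (own h) = head (own h)) :
    BfsInv K own tw sup res lev cur q 0 0 0 where
  cur_ok h hh := by
    rw [hcur h hh]
    exact curOK_head A h hh
  qh_le := le_rfl
  q_own i hi := by omega
  q_lev i hi := by omega
  lev_q h hh hl := by
    have := hlev h hh
    omega
  done i hi := by omega
  passed h hh hp := by
    have := A.lt_head h hh
    rw [hcur h hh] at hp
    omega
  mono i j _ hj := by omega
  span h := by omega
  seed h _ hs := by omega
  fresh h hh _ := by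
    rw [hcur h hh]
    exact A.lt_head h hh
  reason h hh hl := by
    have := hlev h hh
    omega
  count := by
    simpa [unvisited] using card_filter_le (range K) (fun h => lev (own h) = 0)

/-- The new node is first enqueued one level above the head of the queue. After that its arc leads
to a visited node and may be skipped. -/
theorem BfsInv.visit (A : ArcList K own tw nxt head)
    (I : BfsInv K own tw sup res lev cur q qh qt K) (hq : qh < qt)
    {g : ℕ} (hg : g < K) (hown : own g = q qh) (hc : cur (q qh) = g + 1)
    (hr : res g = 1) (h0 : lev (own (tw g)) = 0) :
    BfsInv K own tw sup res (update lev (own (tw g)) (lev (q qh) + 1)) (update cur (q qh) (nxt g))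
      (update q qt (own (tw g))) qh (qt + 1) K := by
  have hl := I.q_lev qh hq
  have I' := I.enqueue (y := own (tw g)) (l := lev (q qh) + 1) ⟨tw g, A.tw_lt g hg, rfl⟩ h0
    (Nat.succ_pos _) (by omega) (I.span hq) (fun _ => le_rfl)
    (Or.inr ⟨g, hg, hr, rfl, by rw [hown], by rw [hown]; exact hl.1⟩)
    (fun hs => by have := I.seed _ (A.tw_lt g hg) (A.tw_lt g hg) hs; omega)
  have hqq : update q qt (own (tw g)) qh = q qh := update_of_ne (by omega) _ _
  have := I'.skip A (g := g) (by omega) hg (by rw [hqq, hown]) (by rw [hqq, hc])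
    (fun _ => by simp)
  rwa [hqq] at this

/-- A breadth-first search level is a lower bound for every potential that grows by at most one
along each arc. -/
theorem IsLevel.le_of_potential (L : IsLevel K own tw sup res lev) {φ : ℕ → ℕ}
    (hφ : ∀ h < K, res h = 1 → φ (own (tw h)) ≤ φ (own h) + 1)
    (hs : ∀ h < K, 0 < sup (own h) → φ (own h) = 0) :
    ∀ h < K, 0 < lev (own h) → φ (own h) + 1 ≤ lev (own h) := by
  suffices H : ∀ l, ∀ h < K, lev (own h) = l → 0 < l → φ (own h) + 1 ≤ l from
    fun h hh hl => H _ h hh rfl hl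
  intro l
  induction l with
  | zero => intro _ _ _ h; omega
  | succ l ih =>
    intro h hh hl _
    rcases L.reason h hh (by omega) with ⟨h1, h2⟩ | ⟨g, hg, h1, h2, h3, h4⟩
    · have := hs h hh h2
      omega
    · have h5 := ih g hg (by omega) (by omega)
      have h6 := hφ g hg h1
      rw [h2] at h6
      omega

/-! ### Reversing arcs -/

/-- The number of residual arcs that leave `v`. -/
def outdeg (K : ℕ) (own res : ℕ → ℕ) (v : ℕ) : ℕ := ∑ h ∈ range K, if own h = v then res h else 0

/-- Replace the arc `b` by the arc `a`. -/
def turn (res : ℕ → ℕ) (a b : ℕ) : ℕ → ℕ := update (update res a 1) b 0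

theorem turn_apply (res : ℕ → ℕ) (a b h : ℕ) :
    turn res a b h = if h = b then 0 else if h = a then 1 else res h := by
  simp [turn, update_apply]

theorem turn_add {a b : ℕ} (hab : a ≠ b) (ha : res a = 0) (hb : res b = 1) (h : ℕ) :
    turn res a b h + (if h = b then 1 else 0) = res h + if h = a then 1 else 0 := by
  rw [turn_apply]
  split_ifs <;> simp_all

/-- If `a` is the reverse of `b`, this says that sending a unit along `b` moves one outgoing
residual arc from its start to its end. All such identities are stated without subtraction, because
subtraction on `ℕ` truncates. -/
theorem outdeg_turn {a b : ℕ} (haK : a < K) (hbK : b < K) (hab : a ≠ b) (ha : res a = 0)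
    (hb : res b = 1) (v : ℕ) :
    outdeg K own (turn res a b) v + (if own b = v then 1 else 0) =
      outdeg K own res v + if own a = v then 1 else 0 := by
  have key : ∀ c < K, (if own c = v then 1 else 0) =
      ∑ h ∈ range K, if own h = v then (if h = c then 1 else 0) else 0 := by
    intro c hc
    rw [Finset.sum_eq_single c]
    · simp
    · intro h _ hne
      simp [hne]
    · intro h
      simp [hc] at h
  rw [key a haK, key b hbK]
  unfold outdeg
  rw [← sum_add_distrib, ← sum_add_distrib]
  refine sum_congr rfl fun h _ => ?_
  split_ifs <;> first | rfl | (have := turn_add hab ha hb h; simp_all)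

/-! ### A blocking flow for the levels of breadth-first search -/

/-- The arc `h` leads to the next level. -/
def Tight (own tw lev : ℕ → ℕ) (h : ℕ) : Prop := lev (own (tw h)) = lev (own h) + 1

instance (own tw lev : ℕ → ℕ) : DecidablePred (Tight own tw lev) :=
  fun _ => inferInstanceAs (Decidable (_ = _))

/-- The invariant of the search for a blocking flow. One unit of flow is on its way along the path
`stk 0, …, stk (sp - 1)` from `own h₀` to `x`. The residual arcs, supplies and demands were `res₀`,
`sup₀`, `dem₀` initially. -/
structure BlockInv (K : ℕ) (own tw lev res₀ sup₀ dem₀ res cur sup dem stk : ℕ → ℕ)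
    (h₀ x sp : ℕ) : Prop where
  cur_ok : CurOK K own cur
  res_tw : ∀ h < K, res h + res (tw h) = 1
  lev_step : ∀ h < K, res h = 1 → 0 < lev (own h) →
    0 < lev (own (tw h)) ∧ lev (own (tw h)) ≤ lev (own h) + 1
  lev_sup : ∀ h < K, 0 < sup (own h) → lev (own h) = 1
  dead : ∀ h < K, cur (own h) ≤ h → res h = 1 → 0 < lev (own h) → Tight own tw lev h →
    cur (own (tw h)) = 0
  dead_dem : ∀ h < K, cur (own h) = 0 → dem (own h) = 0
  excl : ∀ v, sup v = 0 ∨ dem v = 0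
  start : sp = 0 → x = own h₀
  path : 0 < sp → h₀ < K ∧ 0 < sup (own h₀) ∧ own (stk 0) = own h₀ ∧ own (tw (stk (sp - 1))) = x
  chain : ∀ i, i + 1 < sp → own (tw (stk i)) = own (stk (i + 1))
  stk_lt : ∀ i < sp, stk i < K
  stk_lev : ∀ i < sp, lev (own (stk i)) = i + 1
  stk_tight : ∀ i < sp, Tight own tw lev (stk i)
  stk_res : ∀ i < sp, res (stk i) = 0
  stk_cur : ∀ i < sp, cur (own (stk i)) = stk i + 1
  stk_dem : ∀ i < sp, dem (own (stk i)) = 0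
  past : ∀ h < h₀, h < K → sup (own h) = 0 ∨ cur (own h) = 0
  gain : (∃ h < K, sup (own h) < sup₀ (own h)) ∨ (dem = dem₀ ∧
    (∀ h < K, res h = 1 → res₀ h = 0 → ∃ i < sp, h = tw (stk i)) ∧ ∀ i < sp, res₀ (stk i) = 1)
  sup_le : ∀ v, sup v ≤ sup₀ v
  dem_le : ∀ v, dem v ≤ dem₀ v
  balance : ∀ v, outdeg K own res v + sup₀ v + dem v + (if own h₀ = v then 1 else 0) =
    outdeg K own res₀ v + sup v + dem₀ v + if x = v then 1 else 0
  h₀_le : h₀ ≤ K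

/-- The number of residual arcs that lead to the next level. -/
def tightCount (K : ℕ) (own tw lev res : ℕ → ℕ) : ℕ :=
  #{h ∈ range K | res h = 1 ∧ Tight own tw lev h}

variable {res₀ sup₀ dem₀ dem stk : ℕ → ℕ} {h₀ x sp : ℕ}

theorem BlockInv.x_own (I : BlockInv K own tw lev res₀ sup₀ dem₀ res cur sup dem stk h₀ x sp)
    (A : ArcList K own tw nxt head) (hh : h₀ < K) : ∃ h < K, own h = x := by
  rcases Nat.eq_zero_or_pos sp with h | h
  · exact ⟨h₀, hh, (I.start h).symm⟩
  · exact ⟨_, A.tw_lt _ (I.stk_lt (sp - 1) (by omega)), (I.path h).2.2.2⟩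

/-- The path starts on level one and climbs one level with each arc. Besides bounding the stack,
this shows that the current node is not the start of any arc on the path. -/
theorem BlockInv.lev_x (I : BlockInv K own tw lev res₀ sup₀ dem₀ res cur sup dem stk h₀ x sp)
    (hh : h₀ < K) (hs : 0 < sup (own h₀)) : lev x = sp + 1 := by
  rcases Nat.eq_zero_or_pos sp with h | h
  · rw [I.start h, I.lev_sup h₀ hh hs, h]
  · have h1 := I.stk_tight (sp - 1) (by omega)
    have h2 := I.stk_lev (sp - 1) (by omega)
    rw [Tight, (I.path h).2.2.2] at h1
    omega

/-- The next start node is taken. -/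
theorem BlockInv.next (I : BlockInv K own tw lev res₀ sup₀ dem₀ res cur sup dem stk h₀ x sp)
    (hh : h₀ < K) (hsp : sp = 0) (hd : sup (own h₀) = 0 ∨ cur (own h₀) = 0) :
    BlockInv K own tw lev res₀ sup₀ dem₀ res cur sup dem stk (h₀ + 1) (own (h₀ + 1)) 0 := by
  have hx := I.start hsp
  subst hsp
  exact
  { I with
    start := fun _ => rfl
    path := fun h => by omega
    past := fun h hlt hK => by
      rcases Nat.lt_succ_iff_lt_or_eq.1 hlt with h' | rfl
      · exact I.past h h' hK
      · exact hd
    balance := fun v => by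
      have := I.balance v
      rw [hx] at this
      split_ifs at this ⊢ <;> omega
    h₀_le := hh }

/-- The unit of flow has reached a node with positive demand. -/
theorem BlockInv.deliver (I : BlockInv K own tw lev res₀ sup₀ dem₀ res cur sup dem stk h₀ x sp)
    (hh : h₀ < K) (hs : 0 < sup (own h₀)) (hd : 0 < dem x) :
    0 < sp ∧ BlockInv K own tw lev res₀ sup₀ dem₀ res cur (update sup (own h₀) (sup (own h₀) - 1))
      (update dem x (dem x - 1)) stk h₀ (own h₀) 0 := by
  -- An empty path would end at its start `own h₀`, which has positive supply and therefore no
  -- demand.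
  have hsp : 0 < sp := by
    by_contra h
    rw [I.start (by omega)] at hd
    rcases I.excl (own h₀) with h | h <;> omega
  have hle : ∀ v, update sup (own h₀) (sup (own h₀) - 1) v ≤ sup v := fun v => by
    rw [update_apply]
    split_ifs with h
    · rw [h]; omega
    · exact le_rfl
  have hle' : ∀ v, update dem x (dem x - 1) v ≤ dem v := fun v => by
    rw [update_apply]
    split_ifs with h
    · rw [h]; omega
    · exact le_rfl
  refine ⟨hsp, ?_⟩
  exact
  { I with
    lev_sup := fun h hK hp => I.lev_sup h hK (lt_of_lt_of_le hp (hle _))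
    dead_dem := fun h hK hc => Nat.le_zero.1 ((hle' _).trans (I.dead_dem h hK hc).le)
    excl := fun v => by
      rcases I.excl v with h | h
      · exact Or.inl (Nat.le_zero.1 ((hle _).trans h.le))
      · exact Or.inr (Nat.le_zero.1 ((hle' _).trans h.le))
    -- The arcs of the path have been reversed while the unit moved along them, and they stay
    -- reversed. It is enough to forget the stack and begin again at the start node.
    start := fun _ => rfl
    path := fun h => by omega
    chain := fun i h => by omega
    stk_lt := fun i h => by omega
    stk_lev := fun i h => by omega
    stk_tight := fun i h => by omega
    stk_res := fun i h => by omega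
    stk_cur := fun i h => by omega
    stk_dem := fun i h => by omega
    past := fun h hlt hK => (I.past h hlt hK).imp (fun h' => Nat.le_zero.1 ((hle _).trans h'.le)) id
    gain := Or.inl ⟨h₀, hh, by
      have := I.sup_le (own h₀)
      rw [update_self]
      omega⟩
    sup_le := fun v => (hle v).trans (I.sup_le v)
    dem_le := fun v => (hle' v).trans (I.dem_le v)
    balance := fun v => by
      have := I.balance v
      simp only [update_apply]
      by_cases h1 : own h₀ = v
      · subst h1
        by_cases h2 : x = own h₀
        · subst h2
          simp at this ⊢
          omega
        · rw [if_neg h2] at this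
          simp [Ne.symm h2] at this ⊢
          omega
      · by_cases h2 : x = v
        · subst h2
          simp [h1, Ne.symm h1] at this ⊢
          omega
        · simp [h1, h2, Ne.symm h1, Ne.symm h2] at this ⊢
          omega }

/-- The arc that becomes residual is the reverse of a tight arc. It leads one level down, so it is
not tight itself. -/
theorem tightCount_turn_up (A : ArcList K own tw nxt head) {h : ℕ} (hK : h < K) (hr : res h = 1)
    (ht : Tight own tw lev h) :
    tightCount K own tw lev (turn res (tw h) h) + 1 ≤ tightCount K own tw lev res := by
  unfold tightCount
  have hmem : h ∈ {h ∈ range K | res h = 1 ∧ Tight own tw lev h} := by simp [hK, hr, ht]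
  rw [← card_erase_add_one hmem]
  gcongr
  intro g
  simp only [mem_filter, mem_erase, mem_range, turn_apply]
  rintro ⟨h1, h2, h3⟩
  split_ifs at h2 with h4 h5
  · refine absurd h3 ?_
    subst h5
    unfold Tight at ht ⊢
    rw [A.tw_tw h hK]
    omega
  · exact ⟨h4, h1, h2, h3⟩

theorem tightCount_turn_down {g b : ℕ} :
    tightCount K own tw lev (turn res g b) ≤ tightCount K own tw lev res + 1 := by
  unfold tightCount
  refine le_trans (card_le_card ?_)
    (card_insert_le g {h ∈ range K | res h = 1 ∧ Tight own tw lev h})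
  intro h
  simp only [mem_filter, mem_insert, mem_range, turn_apply]
  rintro ⟨h1, h2, h3⟩
  split_ifs at h2 with h4 h5
  · exact Or.inl h5
  · exact Or.inr ⟨h1, h2, h3⟩

/-- The pointer moves past an arc that cannot be used. -/
theorem BlockInv.advance (I : BlockInv K own tw lev res₀ sup₀ dem₀ res cur sup dem stk h₀ x sp)
    (A : ArcList K own tw nxt head) (hh : h₀ < K) (hs : 0 < sup (own h₀)) (hd : dem x = 0)
    {g : ℕ} (hg : g < K) (hown : own g = x) (hc : cur x = g + 1)
    (hn : ¬ (res g = 1 ∧ Tight own tw lev g)) :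
    BlockInv K own tw lev res₀ sup₀ dem₀ res (update cur x (nxt g)) sup dem stk h₀ x sp := by
  have hlx := I.lev_x hh hs
  have hc' : cur (own g) = g + 1 := by rw [hown, hc]
  rw [← hown]
  refine
  { I with
    cur_ok := curOK_update A I.cur_ok hg
    dead := fun h hK hp hr hl ht => ?_
    dead_dem := fun h hK hz => ?_
    stk_cur := fun i hi => ?_
    past := fun h hlt hK => (I.past h hlt hK).imp id (done_update hc')
    start := by rw [hown]; exact I.start
    path := by rw [hown]; exact I.path
    balance := by rw [hown]; exact I.balance }
  · rcases (passed_update A hg hc' h).1 hp with hp | rfl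
    · exact done_update hc' (I.dead h hK hp hr hl ht)
    · exact absurd ⟨hr, ht⟩ hn
  · by_cases e : own h = own g
    · rw [e, hown, hd]
    · rw [update_of_ne e] at hz
      exact I.dead_dem h hK hz
  -- The pointer that moves belongs to `x`, on level `sp + 1`, whereas the arcs of the path start on
  -- levels at most `sp`.
  · rw [update_of_ne]
    · exact I.stk_cur i hi
    · intro e
      have := I.stk_lev i hi
      rw [e, hown] at this
      omega

theorem turn_tw (A : ArcList K own tw nxt head) {b : ℕ} (hb : b < K)
    (hrt : ∀ h < K, res h + res (tw h) = 1) (h : ℕ) (hK : h < K) :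
    turn res (tw b) b h + turn res (tw b) b (tw h) = 1 := by
  have hne : ∀ h < K, tw h ≠ h := fun h hh e => by
    have := hrt h hh
    rw [e] at this
    omega
  rw [turn_apply, turn_apply]
  by_cases h1 : h = b
  · subst h1
    simp [hne h hK]
  · by_cases h2 : h = tw b
    · subst h2
      simp [h1, A.tw_tw b hb]
    · have h3 : tw h ≠ b := fun e => h2 (by rw [← e, A.tw_tw h hK])
      have h4 : tw h ≠ tw b := fun e => h1 (by rw [← A.tw_tw h hK, e, A.tw_tw b hb])
      simp [h1, h2, h3, h4, hrt h hK]

end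

end DSM

namespace DSM

open Finset Function

section

variable {K : ℕ} {own tw nxt head : ℕ → ℕ} {sup res lev cur q : ℕ → ℕ}
variable {res₀ sup₀ dem₀ dem stk : ℕ → ℕ} {h₀ x sp : ℕ}

/-- The unit of flow moves along an arc to the next level. -/
theorem BlockInv.push (I : BlockInv K own tw lev res₀ sup₀ dem₀ res cur sup dem stk h₀ x sp)
    (A : ArcList K own tw nxt head) (hh : h₀ < K) (hs : 0 < sup (own h₀)) (hd : dem x = 0)
    {g : ℕ} (hg : g < K) (hown : own g = x) (hc : cur x = g + 1)
    (hr : res g = 1) (ht : Tight own tw lev g) (hres₀ : ∀ h < K, res₀ h + res₀ (tw h) = 1) :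
    BlockInv K own tw lev res₀ sup₀ dem₀ (turn res (tw g) g) cur sup dem (update stk sp g)
      h₀ (own (tw g)) (sp + 1) := by
  have hlx := I.lev_x hh hs
  have hly : lev (own (tw g)) = sp + 2 := by unfold Tight at ht; rw [ht, hown, hlx]
  have hgt : tw g < K := A.tw_lt g hg
  have hr' : res (tw g) = 0 := by have := I.res_tw g hg; omega
  have hne : tw g ≠ g := fun e => by rw [e] at hr'; omega
  have hlt : ∀ i < sp, update stk sp g i = stk i := fun i hi => update_of_ne (by omega) _ _
  have hsp : update stk sp g sp = g := update_self _ _ _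
  have hall : ∀ P : ℕ → ℕ → Prop, (∀ i < sp, P i (stk i)) → P sp g →
      ∀ i < sp + 1, P i (update stk sp g i) := by
    intro P h1 h2 i hi
    rcases Nat.lt_succ_iff_lt_or_eq.1 hi with h | rfl
    · rw [hlt i h]; exact h1 i h
    · rw [hsp]; exact h2
  -- The residual arc created by the push leads one level down. Hence it creates no new obligation
  -- in `dead` and does not violate `lev_step`.
  have hnotight : ¬ Tight own tw lev (tw g) := by
    unfold Tight
    rw [A.tw_tw g hg, hown]
    omega
  -- The arcs `g` and `tw g` start on the levels `sp + 1` and `sp + 2`, above the start of every arc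
  -- of the path.
  have hstk : ∀ i < sp, stk i ≠ g ∧ stk i ≠ tw g := fun i hi => by
    have h1 := I.stk_lev i hi
    constructor
    · intro e
      rw [e, hown] at h1
      omega
    · intro e
      rw [e] at h1
      omega
  refine
  { I with
    res_tw := turn_tw A hg I.res_tw
    lev_step := fun h hK hr hl => ?_
    dead := fun h hK hp hr hl ht => ?_
    start := fun h => by omega
    path := fun _ => ⟨hh, hs, ?_, by simp⟩
    chain := fun i hi => ?_
    stk_lt := hall (fun i h => h < K) I.stk_lt hg
    stk_lev := hall (fun i h => lev (own h) = i + 1) I.stk_lev (by rw [hown, hlx])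
    stk_tight := hall (fun i h => Tight own tw lev h) I.stk_tight ht
    stk_res := hall (fun i h => turn res (tw g) g h = 0) (fun i hi => ?_) (by simp [turn_apply])
    stk_cur := hall (fun i h => cur (own h) = h + 1) I.stk_cur (by rw [hown, hc])
    stk_dem := hall (fun i h => dem (own h) = 0) I.stk_dem (by rw [hown, hd])
    gain := ?_
    balance := fun v => ?_ }
  · rw [turn_apply] at hr
    split_ifs at hr with h1 h2
    · subst h2
      rw [A.tw_tw g hg, hown]
      omega
    · exact I.lev_step h hK hr hl
  · rw [turn_apply] at hr
    split_ifs at hr with h1 h2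
    · subst h2
      exact absurd ht hnotight
    · exact I.dead h hK hp hr hl ht
  · rcases Nat.eq_zero_or_pos sp with h | h
    · subst h
      rw [hsp, hown, I.start rfl]
    · rw [hlt 0 h]
      exact (I.path h).2.2.1
  · rw [hlt i (by omega)]
    rcases Nat.lt_succ_iff_lt_or_eq.1 hi with h | rfl
    · rw [hlt _ h]
      exact I.chain i h
    · rw [hsp, hown]
      exact (I.path (Nat.succ_pos _)).2.2.2
  · rw [turn_apply, if_neg (hstk i hi).1, if_neg (hstk i hi).2]
    exact I.stk_res i hi
  · rcases I.gain with h | ⟨h1, h2, h3⟩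
    · exact Or.inl h
    · refine Or.inr ⟨h1, ?_, hall (fun i h => res₀ h = 1) h3 ?_⟩
      · intro h hK hr hr0
        rw [turn_apply] at hr
        split_ifs at hr with h4 h5
        · exact ⟨sp, Nat.lt_succ_self _, by rw [hsp, h5]⟩
        · obtain ⟨i, hi, e⟩ := h2 h hK hr hr0
          exact ⟨i, by omega, by rw [hlt i hi, e]⟩
      -- As long as nothing has been delivered, only reverses of arcs of the path are newly
      -- residual. These lead downwards, while `g` leads upwards, so `g` was residual from the
      -- beginning.
      · by_contra hr0
        have h4 := hres₀ g hg
        obtain ⟨i, hi, e⟩ := h2 g hg hr (by omega)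
        have h5 := I.stk_tight i hi
        have h6 := I.stk_lev i hi
        unfold Tight at h5
        rw [← e, hown] at h5
        rw [e, A.tw_tw _ (I.stk_lt i hi)] at hly
        omega
  · have h1 := I.balance v
    have h2 := outdeg_turn (own := own) hgt hg hne hr' hr v
    rw [hown] at h2
    omega

/-- The unit of flow moves back from a dead end. -/
theorem BlockInv.retreat (I : BlockInv K own tw lev res₀ sup₀ dem₀ res cur sup dem stk h₀ x sp)
    (A : ArcList K own tw nxt head) (hsp : 0 < sp)
    (hc : cur x = 0) {g : ℕ} (hgs : stk (sp - 1) = g) :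
    BlockInv K own tw lev res₀ sup₀ dem₀ (turn res g (tw g)) (update cur (own g) (nxt g)) sup dem
      stk h₀ (own g) (sp - 1) := by
  obtain ⟨hh, hs, h0, hx⟩ := I.path hsp
  rw [hgs] at hx
  have hg : g < K := hgs ▸ I.stk_lt (sp - 1) (by omega)
  have hr : res g = 0 := hgs ▸ I.stk_res (sp - 1) (by omega)
  have hcg : cur (own g) = g + 1 := hgs ▸ I.stk_cur (sp - 1) (by omega)
  have htg : Tight own tw lev g := hgs ▸ I.stk_tight (sp - 1) (by omega)
  have hlg : lev (own g) = sp := by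
    have := I.stk_lev (sp - 1) (by omega)
    rw [hgs] at this
    omega
  have hdem : dem (own g) = 0 := hgs ▸ I.stk_dem (sp - 1) (by omega)
  have hgt : tw g < K := A.tw_lt g hg
  have hr' : res (tw g) = 1 := by have := I.res_tw g hg; omega
  have hne : g ≠ tw g := fun e => by rw [← e] at hr'; omega
  have hnotight : ¬ Tight own tw lev (tw g) := by
    unfold Tight at htg ⊢
    rw [A.tw_tw g hg]
    omega
  have hlx : lev x = sp + 1 := I.lev_x hh hs
  have hstk : ∀ i < sp - 1, stk i ≠ g ∧ stk i ≠ tw g := fun i hi => by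
    have h1 := I.stk_lev i (by omega)
    constructor
    · intro e
      rw [e] at h1
      omega
    · intro e
      rw [e, hx] at h1
      omega
  have htt := turn_tw A hgt I.res_tw
  rw [A.tw_tw g hg] at htt
  refine
  { I with
    cur_ok := curOK_update A I.cur_ok hg
    res_tw := htt
    lev_step := fun h hK hr hl => ?_
    dead := fun h hK hp hr hl ht => ?_
    dead_dem := fun h hK hz => ?_
    start := fun h => ?_
    path := fun h => ⟨hh, hs, h0, ?_⟩
    chain := fun i hi => I.chain i (by omega)
    stk_lt := fun i hi => I.stk_lt i (by omega)
    stk_lev := fun i hi => I.stk_lev i (by omega)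
    stk_tight := fun i hi => I.stk_tight i (by omega)
    stk_dem := fun i hi => I.stk_dem i (by omega)
    stk_res := fun i hi => ?_
    stk_cur := fun i hi => ?_
    past := fun h hlt hK => (I.past h hlt hK).imp id (done_update hcg)
    gain := ?_
    balance := fun v => ?_ }
  · rw [turn_apply] at hr
    split_ifs at hr with h1 h2
    · subst h2
      rw [hx]
      omega
    · exact I.lev_step h hK hr hl
  -- The restored arc `g` is residual, tight and now passed. It satisfies `dead` because its end `x`
  -- is exhausted, which is the reason for retreating.
  · rw [turn_apply] at hr
    split_ifs at hr with h1 h2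
    · subst h2
      rw [hx]
      exact done_update hcg hc
    · rcases (passed_update A hg hcg h).1 hp with hp | rfl
      · exact done_update hcg (I.dead h hK hp hr hl ht)
      · exact absurd rfl h2
  · by_cases e : own h = own g
    · rw [e, hdem]
    · rw [update_of_ne e] at hz
      exact I.dead_dem h hK hz
  · rw [← h0, ← hgs, h]
  · rw [← hgs]
    have := I.chain (sp - 1 - 1) (by omega)
    rw [this]
    congr 2
    omega
  · rw [turn_apply, if_neg (hstk i hi).2, if_neg (hstk i hi).1]
    exact I.stk_res i (by omega)
  · rw [update_of_ne]
    · exact I.stk_cur i (by omega)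
    · intro e
      have := I.stk_lev i (by omega)
      rw [e] at this
      omega
  · rcases I.gain with h | ⟨h1, h2, h3⟩
    · exact Or.inl h
    · refine Or.inr ⟨h1, ?_, fun i hi => h3 i (by omega)⟩
      intro h hK hr hr0
      rw [turn_apply] at hr
      split_ifs at hr with h4 h5
      -- The restored arc lay on the path, so before any delivery it was residual initially and does
      -- not count as new.
      · have := h3 (sp - 1) (by omega)
        rw [hgs, ← h5] at this
        omega
      · obtain ⟨i, hi, e⟩ := h2 h hK hr hr0
        refine ⟨i, ?_, e⟩
        by_contra hi'
        have : i = sp - 1 := by omega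
        rw [this, hgs] at e
        exact h4 e
  · have h1 := I.balance v
    have h2 := outdeg_turn (own := own) hg hgt hne hr hr' v
    rw [hx] at h2
    omega

/-! ### Progress of a phase -/

/-- What the search for a blocking flow achieves. -/
structure IsBlocking (K : ℕ) (own tw lev res₀ sup₀ dem₀ res cur sup dem : ℕ → ℕ) : Prop where
  res_tw : ∀ h < K, res h + res (tw h) = 1
  lev_step : ∀ h < K, res h = 1 → 0 < lev (own h) →
    0 < lev (own (tw h)) ∧ lev (own (tw h)) ≤ lev (own h) + 1
  dead : ∀ h < K, cur (own h) = 0 → res h = 1 → 0 < lev (own h) → Tight own tw lev h →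
    cur (own (tw h)) = 0
  dead_dem : ∀ h < K, cur (own h) = 0 → dem (own h) = 0
  excl : ∀ v, sup v = 0 ∨ dem v = 0
  past : ∀ h < K, sup (own h) = 0 ∨ cur (own h) = 0
  gain : (∃ h < K, sup (own h) < sup₀ (own h)) ∨
    (dem = dem₀ ∧ ∀ h < K, res h = 1 → res₀ h = 1)
  sup_le : ∀ v, sup v ≤ sup₀ v
  dem_le : ∀ v, dem v ≤ dem₀ v
  balance : ∀ v, outdeg K own res v + sup₀ v + dem v = outdeg K own res₀ v + sup v + dem₀ v

theorem BlockInv.isBlocking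
    (I : BlockInv K own tw lev res₀ sup₀ dem₀ res cur sup dem stk h₀ x sp) (hh : ¬ h₀ < K)
    (hres₀ : ∀ h < K, res₀ h + res₀ (tw h) = 1) :
    IsBlocking K own tw lev res₀ sup₀ dem₀ res cur sup dem := by
  have hsp : sp = 0 := by
    by_contra h
    exact hh (I.path (by omega)).1
  have hx := I.start hsp
  refine ⟨I.res_tw, I.lev_step, fun h hK hc => I.dead h hK (by omega), I.dead_dem, I.excl,
    fun h hK => I.past h (by omega) hK, I.gain.imp id ?_, I.sup_le, I.dem_le, fun v => ?_⟩
  · rintro ⟨h1, h2, -⟩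
    refine ⟨h1, fun h hK hr => ?_⟩
    by_contra hr0
    have := hres₀ h hK
    obtain ⟨i, hi, -⟩ := h2 h hK hr (by omega)
    omega
  · have := I.balance v
    rw [hx] at this
    omega

/-- If no supply was used, then by `gain` the residual digraph and the demands are the initial ones.
All nodes with supply are exhausted, and `dead` carries exhaustion up the levels to every visited
node. A visited node with demand would then be exhausted, contradicting `dead_dem`. -/
theorem IsBlocking.exists_gain (A : ArcList K own tw nxt head)
    (J : IsBlocking K own tw lev res₀ sup₀ dem₀ res cur sup dem)
    (L : IsLevel K own tw sup₀ res₀ lev) (hres₀ : ∀ h < K, res₀ h + res₀ (tw h) = 1)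
    {h : ℕ} (hK : h < K) (hl : 0 < lev (own h)) (hd : 0 < dem₀ (own h)) :
    ∃ h < K, sup (own h) < sup₀ (own h) := by
  rcases J.gain with h1 | ⟨h1, h2⟩
  · exact h1
  by_contra! hno
  -- An arc that ceased to be residual would make its reverse newly residual, which has been
  -- excluded.
  have hres : ∀ h < K, res₀ h = 1 → res h = 1 := fun h hK hr => by
    by_contra hr'
    have h3 := J.res_tw h hK
    have h4 := hres₀ h hK
    have h5 := h2 (tw h) (A.tw_lt h hK) (by omega)
    omega
  have key : ∀ l, ∀ h < K, lev (own h) = l → 0 < l → cur (own h) = 0 := by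
    intro l
    induction l with
    | zero => intro _ _ _ h; omega
    | succ l ih =>
      intro h hK hl _
      rcases L.reason h hK (by omega) with ⟨h3, h4⟩ | ⟨g, hg, h3, h4, h5, h6⟩
      · rcases J.past h hK with h5 | h5
        · have := hno h hK
          omega
        · exact h5
      · rw [← h4]
        exact J.dead g hg (ih g hg (by omega) (by omega)) (hres g hg h3) h6 (by rw [Tight, h4, h5])
  have := J.dead_dem h hK (key _ h hK rfl hl)
  rw [h1] at this
  omega

/-- Every augmenting path has at least `j` arcs, as a potential shows. -/
def LevelBound (K : ℕ) (own tw res sup dem : ℕ → ℕ) (j : ℕ) : Prop :=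
  ∃ φ : ℕ → ℕ, (∀ h < K, res h = 1 → φ (own (tw h)) ≤ φ (own h) + 1) ∧
    (∀ h < K, 0 < sup (own h) → φ (own h) = 0) ∧ ∀ h < K, 0 < dem (own h) → j ≤ φ (own h)

/-- This is the growth of distances in Dinic's algorithm. The levels count from one, and exhausted
nodes are placed at `lev v - 1`, the others at `lev v`. Nodes with remaining supply are exhausted
and get the value `0`. Nodes with remaining demand are not exhausted, and this yields the additional
unit. A tight residual arc from an exhausted node leads to an exhausted one, so no arc climbs by
more than one. -/
theorem IsBlocking.levelBound (J : IsBlocking K own tw lev res₀ sup₀ dem₀ res cur sup dem)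
    (L : IsLevel K own tw sup₀ res₀ lev) {j : ℕ} (hj : LevelBound K own tw res₀ sup₀ dem₀ j) :
    LevelBound K own tw res sup dem (j + 1) := by
  obtain ⟨φ, h1, h2, h3⟩ := hj
  have hle := L.le_of_potential h1 h2
  -- Unvisited nodes get the largest value `j + 1`, and all other values are capped there. A visited
  -- node has no residual arc to an unvisited one.
  refine ⟨fun v => if lev v = 0 then j + 1 else
    min (j + 1) (if cur v = 0 then lev v - 1 else lev v), ?_, ?_, ?_⟩
  · intro h hK hr
    dsimp only
    by_cases hl : lev (own h) = 0
    · rw [if_pos hl]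
      split_ifs <;> omega
    · rw [if_neg hl]
      have h4 := J.lev_step h hK hr (by omega)
      rw [if_neg (by omega)]
      by_cases hc : cur (own h) = 0
      · rw [if_pos hc]
        by_cases ht : Tight own tw lev h
        · rw [if_pos (J.dead h hK hc hr (by omega) ht)]
          omega
        · unfold Tight at ht
          split_ifs <;> omega
      · rw [if_neg hc]
        split_ifs <;> omega
  · intro h hK hs
    have h4 := L.seed h hK (lt_of_lt_of_le hs (J.sup_le _))
    have h5 := (J.past h hK).resolve_left (by omega)
    simp [h4, h5]
  · intro h hK hd
    dsimp only
    have h4 : cur (own h) ≠ 0 := fun e => by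
      have := J.dead_dem h hK e
      omega
    have h5 := h3 h hK (lt_of_lt_of_le hd (J.dem_le _))
    rw [if_neg h4]
    split_ifs with h6
    · exact le_rfl
    · have := hle h hK (by omega)
      omega

/-- The number of residual arcs that leave `R`. -/
def crossing (K : ℕ) (own tw res : ℕ → ℕ) (R : Finset ℕ) : ℕ :=
  #{h ∈ range K | res h = 1 ∧ own h ∈ R ∧ own (tw h) ∉ R}

/-- There is a cut with residual capacity at most `r`. -/
def CutBound (K : ℕ) (own tw res sup dem : ℕ → ℕ) (r : ℕ) : Prop :=
  ∃ R : Finset ℕ, (∀ h < K, 0 < sup (own h) → own h ∈ R) ∧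
    (∀ h < K, 0 < dem (own h) → own h ∉ R) ∧ crossing K own tw res R ≤ r

/-- Of two opposite arcs inside `R` exactly one is residual, so these arcs contribute an amount that
depends only on `R`. The outdegree sum and the number of crossing arcs therefore change equally. The
factor `2` avoids halving the number of inner arcs. -/
theorem sum_outdeg (A : ArcList K own tw nxt head) (hres : ∀ h < K, res h + res (tw h) = 1)
    (R : Finset ℕ) :
    2 * ∑ v ∈ R, outdeg K own res v =
      2 * crossing K own tw res R + #{h ∈ range K | own h ∈ R ∧ own (tw h) ∈ R} := by
  have h1 : ∑ v ∈ R, outdeg K own res v = ∑ h ∈ range K, if own h ∈ R then res h else 0 := by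
    unfold outdeg
    rw [sum_comm]
    refine sum_congr rfl fun h _ => ?_
    rw [Finset.sum_ite_eq]
  have h2 : crossing K own tw res R =
      ∑ h ∈ range K, if own h ∈ R ∧ own (tw h) ∉ R then res h else 0 := by
    unfold crossing
    rw [card_filter]
    refine sum_congr rfl fun h hh => ?_
    have := hres h (mem_range.1 hh)
    have h3 : res h = 0 ∨ res h = 1 := by omega
    rcases h3 with h3 | h3 <;> simp [h3]
  have h3 : ∑ h ∈ range K, (if own h ∈ R ∧ own (tw h) ∈ R then res h else 0) =
      ∑ h ∈ range K, if own h ∈ R ∧ own (tw h) ∈ R then res (tw h) else 0 := by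
    refine sum_nbij' tw tw (fun h hh => ?_) (fun h hh => ?_) (fun h hh => ?_) (fun h hh => ?_)
      (fun h hh => ?_)
    · exact mem_range.2 (A.tw_lt h (mem_range.1 hh))
    · exact mem_range.2 (A.tw_lt h (mem_range.1 hh))
    · exact A.tw_tw h (mem_range.1 hh)
    · exact A.tw_tw h (mem_range.1 hh)
    · rw [A.tw_tw h (mem_range.1 hh)]
      simp only [and_comm]
  have h4 : ∑ h ∈ range K, (if own h ∈ R ∧ own (tw h) ∈ R then res h else 0) +
      ∑ h ∈ range K, (if own h ∈ R ∧ own (tw h) ∈ R then res (tw h) else 0) =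
      #{h ∈ range K | own h ∈ R ∧ own (tw h) ∈ R} := by
    rw [card_filter, ← sum_add_distrib]
    refine sum_congr rfl fun h hh => ?_
    have := hres h (mem_range.1 hh)
    split_ifs <;> omega
  have h5 : ∑ h ∈ range K, (if own h ∈ R then res h else 0) =
      ∑ h ∈ range K, (if own h ∈ R ∧ own (tw h) ∉ R then res h else 0) +
      ∑ h ∈ range K, if own h ∈ R ∧ own (tw h) ∈ R then res h else 0 := by
    rw [← sum_add_distrib]
    refine sum_congr rfl fun h _ => ?_
    by_cases h6 : own h ∈ R <;> by_cases h7 : own (tw h) ∈ R <;> simp [h6, h7]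
  omega

/-- There is no demand in `R`, so by `balance` the outdegree of a node of `R` falls by the supply it
has used. Some supply was used, and all nodes with supply lie in `R`. By `sum_outdeg` the same cut
then has smaller residual capacity. -/
theorem IsBlocking.cutBound (A : ArcList K own tw nxt head)
    (J : IsBlocking K own tw lev res₀ sup₀ dem₀ res cur sup dem)
    (hres₀ : ∀ h < K, res₀ h + res₀ (tw h) = 1)
    (hgain : ∃ h < K, sup (own h) < sup₀ (own h)) {r : ℕ}
    (hr : CutBound K own tw res₀ sup₀ dem₀ r) :
    ∃ r' < r, CutBound K own tw res sup dem r' := by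
  obtain ⟨R, h1, h2, h3⟩ := hr
  refine ⟨crossing K own tw res R, ?_, R, fun h hK hs => h1 h hK (lt_of_lt_of_le hs (J.sup_le _)),
    fun h hK hd => h2 h hK (lt_of_lt_of_le hd (J.dem_le _)), le_rfl⟩
  suffices H : ∑ v ∈ R, outdeg K own res v < ∑ v ∈ R, outdeg K own res₀ v by
    have h4 := sum_outdeg A J.res_tw R
    have h5 := sum_outdeg A hres₀ R
    omega
  have hle : ∀ v ∈ R, (∃ h < K, own h = v) →
      outdeg K own res v + (sup₀ v - sup v) = outdeg K own res₀ v := by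
    rintro _ hv ⟨h, hK, rfl⟩
    have h4 := J.balance (own h)
    have h5 := J.dem_le (own h)
    have h6 := J.sup_le (own h)
    have h7 : dem₀ (own h) = 0 := by
      by_contra h8
      exact h2 h hK (by omega) hv
    omega
  apply sum_lt_sum
  · intro v hv
    by_cases ho : ∃ h < K, own h = v
    · have := hle v hv ho
      omega
    · push Not at ho
      have : ∀ f : ℕ → ℕ, outdeg K own f v = 0 := fun f => by
        unfold outdeg
        refine sum_eq_zero fun h hh => ?_
        rw [if_neg (ho h (mem_range.1 hh))]
      rw [this, this]
  · obtain ⟨h, hK, hs⟩ := hgain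
    have hmem := h1 h hK (by omega)
    have := hle _ hmem ⟨h, hK, rfl⟩
    exact ⟨_, hmem, by omega⟩

/-- Of the `D` cuts between consecutive levels one has residual capacity at most `K / D`. -/
theorem LevelBound.cutBound (A : ArcList K own tw nxt head) {D : ℕ} (hD : 0 < D)
    (h : LevelBound K own tw res sup dem D) :
    CutBound K own tw res sup dem (K / D) := by
  obtain ⟨φ, h1, h2, h3⟩ := h
  set R : ℕ → Finset ℕ := fun j => {v ∈ (range K).image own | φ v ≤ j} with hR
  have hmem : ∀ j, ∀ h < K, (own h ∈ R j ↔ φ (own h) ≤ j) := by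
    intro j h hK
    rw [hR]
    simp only [mem_filter, mem_image, mem_range, and_iff_right_iff_imp]
    exact fun _ => ⟨h, hK, rfl⟩
  -- Pigeonhole principle: if every `j < D` were the potential of the start node of more than `K /
  -- D` arcs, there would be more than `K` arcs.
  obtain ⟨j, hj, hlt⟩ := exists_card_fiber_lt_of_card_lt_mul (s := range K) (t := range D)
    (f := fun h => φ (own h)) (n := K / D + 1)
    (by rw [card_range, card_range]; exact Nat.lt_mul_div_succ K hD)
  rw [mem_range] at hj
  refine ⟨R j, fun h hK hs => ?_, fun h hK hd => ?_, ?_⟩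
  · rw [hmem j h hK, h2 h hK hs]
    exact Nat.zero_le _
  · rw [hmem j h hK]
    have := h3 h hK hd
    omega
  -- A residual arc climbs by at most one, so one that leaves the set where the potential is at most
  -- `j` starts at potential exactly `j`.
  · refine le_trans (card_le_card ?_) (Nat.lt_succ_iff.1 hlt)
    intro h
    simp only [mem_filter, mem_range]
    rintro ⟨hK, hr, h4, h5⟩
    have hA := A.tw_lt h hK
    rw [hmem j h hK] at h4
    rw [hmem j _ hA] at h5
    have := h1 h hK hr
    exact ⟨hK, by omega⟩

end

end DSM

/-! ### Machine programs for the phases, and the number of phases -/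

namespace DSM

open Finset Function

/-! ### The program for breadth-first search -/

/-- The state represents the arc list in the arrays `10`, …, `13`. -/
structure Rep (K B : ℕ) (σ : State) : Prop where
  zero : σ.reg 5 = 0
  size : σ.reg 6 = K
  arcs : ArcList K (σ.mem 10) (σ.mem 11) (σ.mem 12) (σ.mem 13)
  own_lt : ∀ h < K, σ.mem 10 h < B
  lt : K < B

theorem Rep.of_eq {K B : ℕ} {σ τ : State} (R : Rep K B σ) (h5 : τ.reg 5 = σ.reg 5)
    (h6 : τ.reg 6 = σ.reg 6) (h10 : τ.mem 10 = σ.mem 10) (h11 : τ.mem 11 = σ.mem 11)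
    (h12 : τ.mem 12 = σ.mem 12) (h13 : τ.mem 13 = σ.mem 13) : Rep K B τ where
  zero := by rw [h5, R.zero]
  size := by rw [h6, R.size]
  arcs := by rw [h10, h11, h12, h13]; exact R.arcs
  own_lt := by rw [h10]; exact R.own_lt
  lt := R.lt

theorem Rep.frame {K B : ℕ} {σ τ : State} {P : Prog} (R : Rep K B σ) (hF : Frame P σ τ)
    (h : (P.setsReg 5 || P.setsReg 6 || P.setsMem 10 || P.setsMem 11 || P.setsMem 12 ||
      P.setsMem 13) = false) : Rep K B τ := by
  simp only [Bool.or_eq_false_iff] at h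
  obtain ⟨⟨⟨⟨⟨h5, h6⟩, h10⟩, h11⟩, h12⟩, h13⟩ := h
  exact R.of_eq (hF.reg 5 h5) (hF.reg 6 h6) (hF.mem 10 h10) (hF.mem 11 h11) (hF.mem 12 h12)
    (hF.mem 13 h13)

/-- Clear the levels and reset the list pointers. -/
def resetLoop : Prog :=
  .whileLt 10 6 (.load 11 10 10 ;; .store 15 11 5 ;; .load 12 13 11 ;; .store 16 11 12 ;; .inc 10)

/-- Put the nodes of positive supply into the queue. -/
def seedLoop : Prog :=
  .whileLt 10 6 (.load 11 10 10 ;; .load 12 18 11 ;;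
    .ifLt 5 12
      (.load 12 15 11 ;; .ifLt 12 15 (.store 15 11 15 ;; .store 17 14 11 ;; .inc 14) skip)
      skip ;;
    .inc 10)

/-- Scan the arcs that leave the nodes in the queue. -/
def scanLoop : Prog :=
  .whileLt 13 14 (.load 11 17 13 ;; .load 12 16 11 ;;
    .ifLt 5 12
      (.sub 16 12 15 ;; .load 17 12 16 ;; .store 16 11 17 ;; .load 17 14 16 ;;
        .ifLt 5 17
          (.load 17 11 16 ;; .load 17 10 17 ;; .load 18 15 17 ;;
            .ifLt 5 18 skip
              (.load 18 15 11 ;; .inc 18 ;; .store 15 17 18 ;; .store 17 14 17 ;; .inc 14))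
          skip)
      (.inc 13))

/-- Breadth-first search from the nodes of positive supply. -/
def bfs : Prog :=
  .const 10 0 ;; resetLoop ;; .const 10 0 ;; .const 13 0 ;; .const 14 0 ;; .const 15 1 ;;
    seedLoop ;; scanLoop

variable {K B : ℕ}

/-- Memory layout of the phases: the arrays `10` to `13` hold `own`, `tw`, `nxt` and `head`, the
arrays `14` to `17` the residual bits, the levels, the list pointers and the queue, and the arrays
`18`, `19`, `20` the supplies, the demands and the stack. Registers `5`, `6` and `15` hold `0`, `K`
and `1`. Loops over nodes run over all arcs and act on their start nodes. -/
theorem resetLoop_spec {σ : State} (R : Rep K B σ) (h0 : σ.reg 10 = 0) :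
    wp B resetLoop (fun τ t => (∀ h < K, τ.mem 15 (τ.mem 10 h) = 0) ∧
      (∀ h < K, τ.mem 16 (τ.mem 10 h) = τ.mem 13 (τ.mem 10 h)) ∧ t ≤ 6 * K + 1) σ := by
  refine (wp.while (I := fun τ => τ.reg 10 ≤ K ∧ (∀ h < τ.reg 10, τ.mem 15 (τ.mem 10 h) = 0) ∧
    (∀ h < τ.reg 10, τ.mem 16 (τ.mem 10 h) = τ.mem 13 (τ.mem 10 h)))
    (Φ := fun τ => 6 * (K - τ.reg 10)) ?_ ?_).mono ?_
  · simp [h0]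
  · rintro τ hF ⟨h1, h2, h3⟩ hlt
    have R := R.frame hF rfl
    rw [R.size] at hlt
    have hb := R.own_lt _ hlt
    have hK := R.lt
    apply wp.of_vc
    simp [vc, numArrays, R.zero]
    refine ⟨by omega, by omega, ⟨by omega, ?_, ?_⟩, by omega⟩
    · intro h hh
      rw [update_apply]
      split_ifs with e
      · rfl
      · rcases hh.lt_or_eq with h' | rfl
        · exact h2 h h'
        · exact absurd rfl e
    · intro h hh
      rw [update_apply]
      split_ifs with e
      · rw [e]
      · rcases hh.lt_or_eq with h' | rfl
        · exact h3 h h'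
        · exact absurd rfl e
  · rintro τ t hF ⟨⟨h1, h2, h3⟩, hlt, ht⟩
    rw [hF.reg 6 rfl, R.size] at hlt
    have e : τ.reg 10 = K := by omega
    rw [e] at h2 h3
    refine ⟨h2, h3, by rw [h0] at ht; omega⟩

/-- The loop counter serves as the parameter `s` of `BfsInv`. That all queued nodes have level at
most one is added to the invariant: it shows that a start node met again already has level one. -/
theorem seedLoop_spec {σ : State} (R : Rep K B σ) (h10 : σ.reg 10 = 0) (h14 : σ.reg 14 = 0)
    (h15 : σ.reg 15 = 1) (hlev : ∀ h < K, σ.mem 15 (σ.mem 10 h) = 0)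
    (hcur : ∀ h < K, σ.mem 16 (σ.mem 10 h) = σ.mem 13 (σ.mem 10 h)) :
    wp B seedLoop (fun τ t => BfsInv K (σ.mem 10) (σ.mem 11) (σ.mem 18) (σ.mem 14) (τ.mem 15)
      (τ.mem 16) (τ.mem 17) 0 (τ.reg 14) K ∧ t ≤ 11 * K + 1) σ := by
  refine (wp.while (I := fun τ => τ.reg 10 ≤ K ∧
      BfsInv K (σ.mem 10) (σ.mem 11) (σ.mem 18) (σ.mem 14) (τ.mem 15)
      (τ.mem 16) (τ.mem 17) 0 (τ.reg 14) (τ.reg 10) ∧ ∀ i < τ.reg 14, τ.mem 15 (τ.mem 17 i) ≤ 1)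
    (Φ := fun τ => 11 * (K - τ.reg 10)) ?_ ?_).mono ?_
  · rw [h10, h14]
    exact ⟨Nat.zero_le _, BfsInv.init R.arcs hlev hcur, by simp⟩
  · rintro τ hF ⟨h1, I, h3⟩ hlt
    have R' := R.frame hF rfl
    rw [R'.size] at hlt
    have hb := R'.own_lt _ hlt
    have hK := R'.lt
    have hc := I.count
    have e10 := hF.mem 10 rfl
    have e18 := hF.mem 18 rfl
    have e15 := (hF.reg 15 rfl).trans h15
    rw [e10] at hb
    apply wp.of_vc
    simp [vc, numArrays, R'.zero, skip, e10, e18, e15]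
    refine ⟨by omega, hb, fun hs => ⟨hb, fun hl => ⟨hb, by omega, ⟨by omega, ?_, ?_⟩, by omega⟩,
      fun hl => ⟨⟨by omega, ?_, h3⟩, by omega⟩⟩, fun hs => ⟨⟨by omega, ?_, h3⟩, by omega⟩⟩
    · refine (I.enqueue ⟨_, hlt, rfl⟩ hl one_pos (by omega) h3 (fun _ => by omega)
        (Or.inl ⟨rfl, hs⟩) (fun _ => rfl)).seed_succ ?_
      intro _ _
      simp
    · intro i hi
      by_cases e : i = τ.reg 14
      · simp [e]
      · rw [update_of_ne e, update_apply]
        split_ifs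
        · exact le_rfl
        · exact h3 i (by omega)
    · refine I.seed_succ fun _ _ => ?_
      obtain ⟨i, hi, e⟩ := I.lev_q _ hlt hl
      have := h3 i hi
      rw [e] at this
      omega
    · exact I.seed_succ fun _ h => by omega
  · rintro τ t hF ⟨⟨h1, h2, h3⟩, hlt, ht⟩
    rw [hF.reg 6 rfl, R.size] at hlt
    have e : τ.reg 10 = K := by omega
    rw [e] at h2
    exact ⟨h2, by rw [h10] at ht; omega⟩

/-- Each round lowers the potential by at least `18`, the price of a round: it dequeues a node, or
it moves a pointer past an arc. If it also enqueues a node, the longer queue is paid for by an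
unvisited arc. By `count` the queue length and the number of unvisited arcs are together at most
`K`, whence `36 * K` at the start. -/
theorem scanLoop_spec {σ : State} (R : Rep K B σ) (h13 : σ.reg 13 = 0)
    (h15 : σ.reg 15 = 1) (hres : ∀ h < K, σ.mem 14 h ≤ 1)
    (I : BfsInv K (σ.mem 10) (σ.mem 11) (σ.mem 18) (σ.mem 14) (σ.mem 15) (σ.mem 16) (σ.mem 17) 0
      (σ.reg 14) K) :
    wp B scanLoop (fun τ t =>
      IsLevel K (σ.mem 10) (σ.mem 11) (σ.mem 18) (σ.mem 14) (τ.mem 15) ∧ t ≤ 36 * K + 1) σ := by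
  refine (wp.while (I := fun τ =>
      BfsInv K (σ.mem 10) (σ.mem 11) (σ.mem 18) (σ.mem 14) (τ.mem 15)
      (τ.mem 16) (τ.mem 17) (τ.reg 13) (τ.reg 14) K)
    (Φ := fun τ => 18 * (pending K (σ.mem 10) (τ.mem 16) + (τ.reg 14 - τ.reg 13) +
      unvisited K (σ.mem 10) (τ.mem 15))) ?_ ?_).mono ?_
  · rwa [h13]
  · intro τ hF I hlt
    have R' := R.frame hF rfl
    have hK := R'.lt
    have hc := I.count
    have e10 := hF.mem 10 rfl
    have e18 := hF.mem 18 rfl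
    have e11 := hF.mem 11 rfl
    have e12 := hF.mem 12 rfl
    have e14 := hF.mem 14 rfl
    have e15 := (hF.reg 15 rfl).trans h15
    obtain ⟨g, hg, hgq⟩ := I.q_own _ hlt
    have hb := R.own_lt g hg
    rw [hgq] at hb
    apply wp.of_vc
    simp [vc, numArrays, R'.zero, skip, e10, e15, e11, e14, e12]
    refine ⟨by omega, hb, fun hpos => ?_, fun hz => ⟨I.dequeue hlt hz, by omega⟩⟩
    obtain ⟨hle, hown⟩ := I.cur_ok g hg (by rw [hgq]; omega)
    rw [hgq] at hle hown
    set h := τ.mem 16 (τ.mem 17 (τ.reg 13)) - 1 with hh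
    have hc : τ.mem 16 (τ.mem 17 (τ.reg 13)) = h + 1 := by omega
    have hhK : h < K := by omega
    have htK := R.arcs.tw_lt h hhK
    have hp := pending_update (cur := τ.mem 16) R.arcs hhK (by rw [hown, hc])
    rw [hown] at hp
    refine ⟨by omega, hb, by omega, fun hr => ⟨by omega, by omega, R.own_lt _ htK, fun hl =>
      ⟨I.skip R.arcs hlt hhK hown hc (fun _ => hl), by omega⟩,
      fun hl => ⟨hb, R.own_lt _ htK, by omega, ?_, ?_⟩⟩,
      fun hr => ⟨I.skip R.arcs hlt hhK hown hc (fun _ => by omega), by omega⟩⟩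
    · exact I.visit R.arcs hlt hhK hown hc (by have := hres h hhK; omega) hl
    · have := unvisited_update (K := K) (own := σ.mem 10) (lev := τ.mem 15)
        (l := τ.mem 15 (τ.mem 17 (τ.reg 13)) + 1) ⟨_, htK, rfl⟩ hl (Nat.succ_pos _)
      omega
  · rintro τ t hF ⟨I', hlt, ht⟩
    refine ⟨I'.isLevel hlt, ?_⟩
    have h1 := pending_le K (σ.mem 10) (σ.mem 16)
    have h2 := I.count
    rw [h13] at ht
    omega

theorem bfs_spec {σ : State} (R : Rep K B σ) (hres : ∀ h < K, σ.mem 14 h ≤ 1) :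
    wp B bfs (fun τ t => IsLevel K (σ.mem 10) (σ.mem 11) (σ.mem 18) (σ.mem 14) (τ.mem 15) ∧
      τ.reg 15 = 1 ∧ t ≤ 53 * K + 8) σ := by
  refine wp.vc_seq (wp.seq ?_)
  refine (resetLoop_spec (σ := σ.setReg 10 0) (R.of_eq rfl rfl rfl rfl rfl rfl) rfl).mono ?_
  rintro τ t hF ⟨h1, h2, h3⟩
  have e10 := hF.mem 10 rfl
  have e11 := hF.mem 11 rfl
  have e14 := hF.mem 14 rfl
  have e18 := hF.mem 18 rfl
  have R := R.of_eq (τ := τ) (hF.reg 5 rfl) (hF.reg 6 rfl) e10 e11 (hF.mem 12 rfl) (hF.mem 13 rfl)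
  refine wp.vc_seq (wp.vc_seq (wp.vc_seq (wp.vc_seq (wp.seq ?_))))
  refine (seedLoop_spec
    (σ := (((τ.setReg 10 0).setReg 13 0).setReg 14 0).setReg 15 1) (R.of_eq rfl rfl rfl rfl rfl rfl) rfl rfl rfl h1 h2).mono ?_
  rintro ρ u hF' ⟨I, h4⟩
  have f10 := hF'.mem 10 rfl
  have f11 := hF'.mem 11 rfl
  have f14 := hF'.mem 14 rfl
  have f18 := hF'.mem 18 rfl
  simp at e10 e11 e14 e18 f10 f11 f14 f18 I
  refine (scanLoop_spec (R.of_eq (hF'.reg 5 rfl) (hF'.reg 6 rfl) f10 f11 (hF'.mem 12 rfl)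
    (hF'.mem 13 rfl)) (hF'.reg 13 rfl) (hF'.reg 15 rfl) ?_ ?_).mono ?_
  · rwa [f14, e14]
  · rwa [f10, f11, f14, f18]
  · rintro π v hF'' ⟨h5, h6⟩
    rw [f10, f11, f14, f18, e10, e11, e14, e18] at h5
    exact ⟨h5, (hF''.reg 15 rfl).trans (hF'.reg 15 rfl), by omega⟩

end DSM

namespace DSM

open Finset Function

/-! ### The program for a blocking flow -/

/-- Reset the list pointers. -/
def rewindLoop : Prog :=
  .whileLt 10 6 (.load 11 10 10 ;; .load 12 13 11 ;; .store 16 11 12 ;; .inc 10)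

/-- Move on to the next start node. -/
def nextStart : Prog := .inc 19 ;; .load 20 10 19 ;; .const 21 0

/-- Deliver one unit of flow. -/
def deliverUnit : Prog :=
  .sub 12 12 15 ;; .store 19 20 12 ;; .load 12 18 11 ;; .sub 12 12 15 ;; .store 18 11 12 ;;
    .copy 20 11 ;; .const 21 0

/-- Move back along the last arc of the path. -/
def retreatArc : Prog :=
  .sub 21 21 15 ;; .load 16 20 21 ;; .load 17 11 16 ;; .store 14 16 15 ;; .store 14 17 5 ;;
    .load 20 10 16 ;; .load 17 12 16 ;; .store 16 20 17

/-- Append an arc to the path. -/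
def pushArc : Prog :=
  .store 14 17 15 ;; .store 14 16 5 ;; .store 20 21 16 ;; .inc 21 ;; .copy 20 18

/-- Skip an arc. -/
def skipArc : Prog := .load 17 12 16 ;; .store 16 20 17

/-- Push along the current arc if this is possible, and skip the arc otherwise. -/
def tryArc : Prog :=
  .sub 16 12 15 ;; .load 17 11 16 ;; .load 18 10 17 ;; .load 22 15 18 ;; .load 23 15 20 ;;
    .inc 23 ;; .load 24 14 16 ;;
    .ifLt 5 24 (.ifLt 22 23 skipArc (.ifLt 23 22 skipArc pushArc)) skipArc

/-- The search for a blocking flow. -/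
def blockLoop : Prog :=
  .whileLt 19 6 (.load 11 10 19 ;; .load 12 18 11 ;;
    .ifLt 5 12
      (.load 12 19 20 ;;
        .ifLt 5 12 deliverUnit
          (.load 12 16 20 ;; .ifLt 5 12 tryArc (.ifLt 5 21 retreatArc nextStart)))
      nextStart)

variable {K B : ℕ}

theorem rewindLoop_spec {σ : State} (R : Rep K B σ) (h0 : σ.reg 10 = 0) :
    wp B rewindLoop (fun τ t =>
      (∀ h < K, τ.mem 16 (τ.mem 10 h) = τ.mem 13 (τ.mem 10 h)) ∧ t ≤ 5 * K + 1) σ := by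
  refine (wp.while (I := fun τ => τ.reg 10 ≤ K ∧
    (∀ h < τ.reg 10, τ.mem 16 (τ.mem 10 h) = τ.mem 13 (τ.mem 10 h)))
    (Φ := fun τ => 5 * (K - τ.reg 10)) ?_ ?_).mono ?_
  · simp [h0]
  · rintro τ hF ⟨h1, h3⟩ hlt
    have R := R.frame hF rfl
    rw [R.size] at hlt
    have hb := R.own_lt _ hlt
    have hK := R.lt
    apply wp.of_vc
    simp [vc, numArrays]
    refine ⟨by omega, by omega, ⟨by omega, ?_⟩, by omega⟩
    intro h hh
    rw [update_apply]
    split_ifs with e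
    · rw [e]
    · rcases hh.lt_or_eq with h' | rfl
      · exact h3 h h'
      · exact absurd rfl e
  · rintro τ t hF ⟨⟨h1, h3⟩, hlt, ht⟩
    rw [hF.reg 6 rfl, R.size] at hlt
    have e : τ.reg 10 = K := by omega
    rw [e] at h3
    refine ⟨h3, by rw [h0] at ht; omega⟩

theorem BlockInv.init {own tw nxt head lev res sup dem cur : ℕ → ℕ} {stk : ℕ → ℕ}
    (A : ArcList K own tw nxt head) (L : IsLevel K own tw sup res lev)
    (hres : ∀ h < K, res h + res (tw h) = 1) (hexcl : ∀ v, sup v = 0 ∨ dem v = 0)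
    (hcur : ∀ h < K, cur (own h) = head (own h)) :
    BlockInv K own tw lev res sup dem res cur sup dem stk 0 (own 0) 0 where
  cur_ok h hh := by
    rw [hcur h hh]
    exact curOK_head A h hh
  res_tw := hres
  lev_step := L.step
  lev_sup := L.seed
  dead h hh hc := by
    have := A.lt_head h hh
    rw [hcur h hh] at hc
    omega
  dead_dem h hh hc := by
    have := A.lt_head h hh
    rw [hcur h hh] at hc
    omega
  excl := hexcl
  start _ := rfl
  path h := by omega
  chain i h := by omega
  stk_lt i h := by omega
  stk_lev i h := by omega
  stk_tight i h := by omega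
  stk_res i h := by omega
  stk_cur i h := by omega
  stk_dem i h := by omega
  past i h := by omega
  gain := Or.inr ⟨rfl, fun h _ h1 h2 => by omega, fun i h => by omega⟩
  sup_le _ := le_rfl
  dem_le _ := le_rfl
  balance _ := rfl
  h₀_le := Nat.zero_le _

/-- The potential of the search for a blocking flow. -/
def blockPot (K : ℕ) (own tw lev res cur : ℕ → ℕ) (h₀ sp : ℕ) : ℕ :=
  4 * pending K own cur + 2 * tightCount K own tw lev res + (if sp = 0 then 0 else 1) +
    2 * (K - h₀)

-- A round takes at most `25` steps including the loop test, and `blockPot` falls in each. Skipping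
-- an arc gains `4`. A push gains `2` from `tightCount` and loses at most `1` if the path was empty.
-- A retreat gains `4` from the pointer and loses at most `2` from the restored arc. A delivery
-- gains `1` by emptying the path, and taking the next start node gains `2`. Initially `blockPot` is
-- at most `8 * K`.
set_option maxHeartbeats 1000000 in
theorem blockLoop_spec {σ : State} (R : Rep K B σ) (h15 : σ.reg 15 = 1) (h19 : σ.reg 19 = 0)
    (h20 : σ.reg 20 = σ.mem 10 0) (h21 : σ.reg 21 = 0)
    (L : IsLevel K (σ.mem 10) (σ.mem 11) (σ.mem 18) (σ.mem 14) (σ.mem 15))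
    (hres : ∀ h < K, σ.mem 14 h + σ.mem 14 (σ.mem 11 h) = 1)
    (hexcl : ∀ v, σ.mem 18 v = 0 ∨ σ.mem 19 v = 0)
    (hcur : ∀ h < K, σ.mem 16 (σ.mem 10 h) = σ.mem 13 (σ.mem 10 h)) :
    wp B blockLoop (fun τ t =>
      IsBlocking K (σ.mem 10) (σ.mem 11) (σ.mem 15) (σ.mem 14) (σ.mem 18) (σ.mem 19)
        (τ.mem 14) (τ.mem 16) (τ.mem 18) (τ.mem 19) ∧ t ≤ 200 * K + 1) σ := by
  refine (wp.while (I := fun τ =>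
      BlockInv K (σ.mem 10) (σ.mem 11) (σ.mem 15) (σ.mem 14) (σ.mem 18) (σ.mem 19)
        (τ.mem 14) (τ.mem 16) (τ.mem 18) (τ.mem 19) (τ.mem 20) (τ.reg 19) (τ.reg 20) (τ.reg 21))
    (Φ := fun τ => 25 * blockPot K (σ.mem 10) (σ.mem 11) (σ.mem 15) (τ.mem 14) (τ.mem 16)
      (τ.reg 19) (τ.reg 21)) ?_ ?_).mono ?_
  · rw [h19, h20, h21]
    exact BlockInv.init R.arcs L hres hexcl hcur
  · intro τ hF I hlt
    have R' := R.frame hF rfl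
    rw [R'.size] at hlt
    have hK := R'.lt
    have e10 := hF.mem 10 rfl
    have e11 := hF.mem 11 rfl
    have e12 := hF.mem 12 rfl
    have e15 := (hF.reg 15 rfl).trans h15
    have f15 := hF.mem 15 rfl
    have hb := R.own_lt _ hlt
    obtain ⟨gx, hgx, hxe⟩ := I.x_own R.arcs hlt
    have hbx := R.own_lt _ hgx
    rw [hxe] at hbx
    apply wp.of_vc
    simp [vc, numArrays, R'.zero, e10, e15, e11, e12, f15, deliverUnit, tryArc, skipArc,
      retreatArc, nextStart, pushArc]
    refine ⟨by omega, hb, fun hs => ⟨hbx, fun hd => ?_, fun hd => ⟨hbx, fun hc => ?_,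
      fun hc => ⟨fun hsp => ?_, fun hsp => ?_⟩⟩⟩, fun hs => ?_⟩
    · obtain ⟨hsp, I'⟩ := I.deliver hlt hs hd
      refine ⟨hbx, hb, I', ?_⟩
      simp only [blockPot, if_neg hsp.ne']
      simp
      omega
    · obtain ⟨hle, hown⟩ := I.cur_ok gx hgx (by rw [hxe]; omega)
      rw [hxe] at hle hown
      set g := τ.mem 16 (τ.reg 20) - 1 with hgdef
      have hc : τ.mem 16 (τ.reg 20) = g + 1 := by omega
      have hg : g < K := by omega
      have hgt := R.arcs.tw_lt g hg
      have hbg := R.own_lt _ hgt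
      have hp := pending_update (cur := τ.mem 16) R.arcs hg (by rw [hown, hc])
      rw [hown] at hp
      have hadv : ¬ (τ.mem 14 g = 1 ∧ Tight (σ.mem 10) (σ.mem 11) (σ.mem 15) g) →
          BlockInv K (σ.mem 10) (σ.mem 11) (σ.mem 15) (σ.mem 14) (σ.mem 18) (σ.mem 19)
            (τ.mem 14) (update (τ.mem 16) (τ.reg 20) (σ.mem 12 g)) (τ.mem 18) (τ.mem 19)
            (τ.mem 20) (τ.reg 19) (τ.reg 20) (τ.reg 21) :=
        fun hn => I.advance R.arcs hlt hs hd hg hown hc hn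
      have hpot : 25 * blockPot K (σ.mem 10) (σ.mem 11) (σ.mem 15) (τ.mem 14)
            (update (τ.mem 16) (τ.reg 20) (σ.mem 12 g)) (τ.reg 19) (τ.reg 21) + 25 ≤
          25 * blockPot K (σ.mem 10) (σ.mem 11) (σ.mem 15) (τ.mem 14) (τ.mem 16) (τ.reg 19)
            (τ.reg 21) := by
        unfold blockPot
        omega
      refine ⟨by omega, by omega, hbg, hbx, by omega, fun hr => ⟨fun hl => ?_, fun hl =>
        ⟨fun hl' => ?_, fun hl' => ?_⟩⟩, fun hr => ?_⟩
      · refine ⟨by omega, hbx, hadv ?_, by omega⟩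
        unfold Tight
        rw [hown]
        omega
      · refine ⟨by omega, hbx, hadv ?_, by omega⟩
        unfold Tight
        rw [hown]
        omega
      · have hr1 : τ.mem 14 g = 1 := by
          have := I.res_tw g hg
          omega
        have ht : Tight (σ.mem 10) (σ.mem 11) (σ.mem 15) g := by
          unfold Tight
          rw [hown]
          omega
        -- The level of the current node is the stack height plus one and at most `K`, so the stack
        -- stays inside the permitted cells.
        have hlev := I.lev_x hlt hs
        have hlevle := L.le gx hgx
        rw [hxe] at hlevle
        have I' := I.push R.arcs hlt hs hd hg hown hc hr1 ht hres
        refine ⟨by omega, by omega, by omega, I', ?_⟩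
        have h5 := tightCount_turn_up R.arcs hg hr1 ht
        unfold turn at h5
        simp only [blockPot]
        split_ifs <;> omega
      · refine ⟨by omega, hbx, hadv ?_, by omega⟩
        omega
    · have hgK := I.stk_lt (τ.reg 21 - 1) (by omega)
      have hgt := R.arcs.tw_lt _ hgK
      have hbg := R.own_lt _ hgK
      have I' := I.retreat R.arcs hsp hc rfl
      have hlev := I.lev_x hlt hs
      have hlevle := L.le gx hgx
      rw [hxe] at hlevle
      refine ⟨by omega, by omega, by omega, by omega, hbg, I', ?_⟩
      have hp := pending_update (cur := τ.mem 16) R.arcs hgK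
        (I.stk_cur (τ.reg 21 - 1) (by omega))
      have h5 := tightCount_turn_down (K := K) (own := σ.mem 10) (tw := σ.mem 11)
        (lev := σ.mem 15) (res := τ.mem 14) (g := τ.mem 20 (τ.reg 21 - 1))
        (b := σ.mem 11 (τ.mem 20 (τ.reg 21 - 1)))
      unfold turn at h5
      simp only [blockPot]
      split_ifs <;> omega
    -- After the last start node the load reads index `K`. The value is irrelevant, and the access
    -- is covered by `K < B`.
    · refine ⟨by omega, I.next hlt hsp (Or.inr ?_), ?_⟩
      · rw [← I.start hsp, hc]
      · simp only [blockPot]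
        split_ifs <;> omega
    · have hsp : τ.reg 21 = 0 := by
        by_contra hne
        have := (I.path (by omega)).2.1
        omega
      refine ⟨by omega, I.next hlt hsp (Or.inl hs), ?_⟩
      simp only [blockPot]
      split_ifs <;> omega
  · rintro τ t hF ⟨I, hlt, ht⟩
    rw [hF.reg 6 rfl, R.size] at hlt
    refine ⟨I.isBlocking hlt hres, ?_⟩
    have h1 := pending_le K (σ.mem 10) (σ.mem 16)
    have h2 : tightCount K (σ.mem 10) (σ.mem 11) (σ.mem 15) (σ.mem 14) ≤ K := by
      simpa [tightCount] using card_filter_le (range K)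
        (fun h => σ.mem 14 h = 1 ∧ Tight (σ.mem 10) (σ.mem 11) (σ.mem 15) h)
    simp only [blockPot, h19, h21] at ht
    simp at ht
    omega

end DSM

namespace DSM

open Finset Function

/-! ### The program for a maximum flow -/

/-- Test whether a node of positive demand has been visited. -/
def demandLoop : Prog :=
  .whileLt 10 6 (.load 11 10 10 ;; .load 12 15 11 ;;
    .ifLt 5 12 (.load 12 19 11 ;; .ifLt 5 12 (.const 25 1) skip) skip ;; .inc 10)

/-- Breadth-first search and the test whether a node of positive demand has been reached. -/
def search : Prog := bfs ;; .const 25 0 ;; .const 10 0 ;; demandLoop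

/-- The search for a blocking flow with its initialization. -/
def blocking : Prog :=
  .const 10 0 ;; rewindLoop ;; .const 19 0 ;; .load 20 10 19 ;; .const 21 0 ;; blockLoop

/-- Augment by blocking flows as long as a node of positive demand can be reached. -/
def augmentLoop : Prog := search ;; .whileLt 5 25 (blocking ;; search)

variable {K B : ℕ}

theorem demandLoop_spec {σ : State} (R : Rep K B σ) (h10 : σ.reg 10 = 0) (h25 : σ.reg 25 = 0) :
    wp B demandLoop (fun τ t =>
      (0 < τ.reg 25 ↔ ∃ h < K, 0 < σ.mem 15 (σ.mem 10 h) ∧ 0 < σ.mem 19 (σ.mem 10 h)) ∧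
      t ≤ 9 * K + 1) σ := by
  refine (wp.while (I := fun τ => τ.reg 10 ≤ K ∧ (0 < τ.reg 25 ↔
      ∃ h < τ.reg 10, 0 < σ.mem 15 (σ.mem 10 h) ∧ 0 < σ.mem 19 (σ.mem 10 h)))
    (Φ := fun τ => 9 * (K - τ.reg 10)) ?_ ?_).mono ?_
  · simp [h10, h25]
  · rintro τ hF ⟨h1, h3⟩ hlt
    have R := R.frame hF rfl
    rw [R.size] at hlt
    have hb := R.own_lt _ hlt
    have hK := R.lt
    have e10 := hF.mem 10 rfl
    have e15 := hF.mem 15 rfl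
    have e19 := hF.mem 19 rfl
    rw [e10] at hb
    have hor : (∃ h < τ.reg 10 + 1, 0 < σ.mem 15 (σ.mem 10 h) ∧ 0 < σ.mem 19 (σ.mem 10 h)) ↔
        (∃ h < τ.reg 10, 0 < σ.mem 15 (σ.mem 10 h) ∧ 0 < σ.mem 19 (σ.mem 10 h)) ∨
        (0 < σ.mem 15 (σ.mem 10 (τ.reg 10)) ∧ 0 < σ.mem 19 (σ.mem 10 (τ.reg 10))) := by
      constructor
      · rintro ⟨h, hh, h4⟩
        rcases Nat.lt_succ_iff_lt_or_eq.1 hh with h' | rfl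
        · exact Or.inl ⟨h, h', h4⟩
        · exact Or.inr h4
      · rintro (⟨h, hh, h4⟩ | h4)
        · exact ⟨h, by omega, h4⟩
        · exact ⟨_, Nat.lt_succ_self _, h4⟩
    apply wp.of_vc
    simp only [vc, numArrays, skip, State.reg_setReg, State.mem_setReg, State.reg_touch,
      State.mem_touch, e10, e15, e19, R.zero]
    simp only [reduceIte, Nat.reduceEqDiff, Nat.reduceLT, true_and, h3]
    refine ⟨by omega, hb, fun hl => ⟨hb, fun hd => ⟨⟨by omega, ?_⟩, by omega⟩,
      fun hd => ⟨⟨by omega, ?_⟩, by omega⟩⟩, fun hl => ⟨⟨by omega, ?_⟩, by omega⟩⟩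
    · exact iff_of_true trivial ⟨_, Nat.lt_succ_self _, hl, hd⟩
    · rw [hor, or_iff_left]
      omega
    · rw [hor, or_iff_left]
      omega
  · rintro τ t hF ⟨⟨h1, h3⟩, hlt, ht⟩
    rw [hF.reg 6 rfl, R.size] at hlt
    have e : τ.reg 10 = K := by omega
    rw [e] at h3
    refine ⟨h3, by rw [h10] at ht; omega⟩

theorem search_spec {σ : State} (R : Rep K B σ) (hres : ∀ h < K, σ.mem 14 h ≤ 1) :
    wp B search (fun τ t => IsLevel K (σ.mem 10) (σ.mem 11) (σ.mem 18) (σ.mem 14) (τ.mem 15) ∧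
      (0 < τ.reg 25 ↔ ∃ h < K, 0 < τ.mem 15 (σ.mem 10 h) ∧ 0 < σ.mem 19 (σ.mem 10 h)) ∧
      τ.reg 15 = 1 ∧ t ≤ 62 * K + 11) σ := by
  refine wp.seq ((bfs_spec R hres).mono ?_)
  rintro τ t hF ⟨L, h15, ht⟩
  refine wp.vc_seq (wp.vc_seq ((demandLoop_spec (σ := (τ.setReg 25 0).setReg 10 0)
    (R.of_eq (hF.reg 5 rfl) (hF.reg 6 rfl) (hF.mem 10 rfl) (hF.mem 11 rfl) (hF.mem 12 rfl)
    (hF.mem 13 rfl)) rfl rfl).mono ?_))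
  rintro ρ u hF' ⟨h1, hu⟩
  have e10 := hF.mem 10 rfl
  have e19 := hF.mem 19 rfl
  have f15 := hF'.mem 15 rfl
  simp only [State.mem_setReg] at h1 f15
  rw [e10, e19] at h1
  rw [f15]
  exact ⟨L, h1, (hF'.reg 15 rfl).trans h15, by omega⟩

theorem blocking_spec {σ : State} (R : Rep K B σ) (h15 : σ.reg 15 = 1)
    (L : IsLevel K (σ.mem 10) (σ.mem 11) (σ.mem 18) (σ.mem 14) (σ.mem 15))
    (hres : ∀ h < K, σ.mem 14 h + σ.mem 14 (σ.mem 11 h) = 1)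
    (hexcl : ∀ v, σ.mem 18 v = 0 ∨ σ.mem 19 v = 0) :
    wp B blocking (fun τ t => (∃ cur,
      IsBlocking K (σ.mem 10) (σ.mem 11) (σ.mem 15) (σ.mem 14) (σ.mem 18) (σ.mem 19)
        (τ.mem 14) cur (τ.mem 18) (τ.mem 19)) ∧ t ≤ 205 * K + 6) σ := by
  refine wp.vc_seq (wp.seq ?_)
  refine (rewindLoop_spec (σ := σ.setReg 10 0) (R.of_eq rfl rfl rfl rfl rfl rfl) rfl).mono ?_
  rintro τ t hF ⟨h2, h3⟩
  have e10 := hF.mem 10 rfl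
  have e11 := hF.mem 11 rfl
  have e14 := hF.mem 14 rfl
  have e15 := hF.mem 15 rfl
  have e18 := hF.mem 18 rfl
  have e19 := hF.mem 19 rfl
  have R := R.of_eq (τ := τ) (hF.reg 5 rfl) (hF.reg 6 rfl) e10 e11 (hF.mem 12 rfl) (hF.mem 13 rfl)
  simp only [State.mem_setReg] at e10 e11 e14 e15 e18 e19
  rw [← e11, ← e14] at hres
  rw [← e18, ← e19] at hexcl
  rw [← e10, ← e11, ← e14, ← e15, ← e18] at L
  have hB := R.lt
  refine wp.vc_seq (wp.vc_seq ⟨by decide, by simp; omega, wp.vc_seq ?_⟩)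
  refine (blockLoop_spec (σ := ((((τ.setReg 19 0).touch 10 0).setReg 20 (τ.mem 10 0)).setReg 21 0))
    (R.of_eq rfl rfl rfl rfl rfl rfl) ((hF.reg 15 rfl).trans h15) rfl rfl rfl L hres hexcl
    h2).mono ?_
  rintro ρ u hF' ⟨J, hu⟩
  simp only [State.mem_setReg, State.mem_touch, e10, e11, e14, e15, e18, e19] at J
  exact ⟨⟨_, J⟩, by omega⟩

/-- A bound for the number of phases: as long as the levels grow, up to `D`, or the residual
capacity of a cut decreases. -/
def PhaseBound (K : ℕ) (own tw res sup dem : ℕ → ℕ) (D N : ℕ) : Prop :=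
  (∃ j ≤ D, LevelBound K own tw res sup dem j ∧ N = D - j + K / D) ∨
    CutBound K own tw res sup dem N

/-- While `j < D` the phase raises the level bound. At `j = D` one passes to a level cut of capacity
at most `K / D`, and this and every later phase lowers the capacity of the cut by at least one. -/
theorem PhaseBound.decrease {own tw nxt head lev res₀ sup₀ dem₀ res cur sup dem : ℕ → ℕ} {D N : ℕ}
    (A : ArcList K own tw nxt head) (hD : 0 < D)
    (J : IsBlocking K own tw lev res₀ sup₀ dem₀ res cur sup dem)
    (L : IsLevel K own tw sup₀ res₀ lev) (hres₀ : ∀ h < K, res₀ h + res₀ (tw h) = 1)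
    (hvis : ∃ h < K, 0 < lev (own h) ∧ 0 < dem₀ (own h))
    (hN : PhaseBound K own tw res₀ sup₀ dem₀ D N) :
    ∃ N' < N, PhaseBound K own tw res sup dem D N' := by
  obtain ⟨h, hK, hl, hd⟩ := hvis
  have hgain := J.exists_gain A L hres₀ hK hl hd
  rcases hN with ⟨j, hj, hb, rfl⟩ | hb
  · rcases hj.lt_or_eq with hj | rfl
    · exact ⟨D - (j + 1) + K / D, by omega, Or.inl ⟨j + 1, hj, J.levelBound L hb, rfl⟩⟩
    · obtain ⟨r, hr, hc⟩ := J.cutBound A hres₀ hgain (hb.cutBound A hD)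
      exact ⟨r, by omega, Or.inr hc⟩
  · obtain ⟨r, hr, hc⟩ := J.cutBound A hres₀ hgain hb
    exact ⟨r, hr, Or.inr hc⟩

/-- The residual arcs `res`, supplies `sup` and demands `dem` arise from `res₀`, `sup₀`, `dem₀` by
a flow. -/
structure IsResidual (K : ℕ) (own tw res₀ sup₀ dem₀ res sup dem : ℕ → ℕ) : Prop where
  res_tw : ∀ h < K, res h + res (tw h) = 1
  excl : ∀ v, sup v = 0 ∨ dem v = 0
  sup_le : ∀ v, sup v ≤ sup₀ v
  dem_le : ∀ v, dem v ≤ dem₀ v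
  balance : ∀ v, outdeg K own res v + sup₀ v + dem v = outdeg K own res₀ v + sup v + dem₀ v

theorem IsBlocking.isResidual {own tw lev res₀ sup₀ dem₀ res₁ sup₁ dem₁ res cur sup dem : ℕ → ℕ}
    (J : IsBlocking K own tw lev res₁ sup₁ dem₁ res cur sup dem)
    (F : IsResidual K own tw res₀ sup₀ dem₀ res₁ sup₁ dem₁) :
    IsResidual K own tw res₀ sup₀ dem₀ res sup dem where
  res_tw := J.res_tw
  excl := J.excl
  sup_le v := (J.sup_le v).trans (F.sup_le v)
  dem_le v := (J.dem_le v).trans (F.dem_le v)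
  balance v := by
    have := J.balance v
    have := F.balance v
    omega

/-- The potential is the least available phase bound times the cost of a round, `205 * K + 6` for
the blocking flow, `62 * K + 11` for the next search and `1` for the test. The additional factor `1`
in the time bound covers the first search. -/
theorem augmentLoop_spec {σ : State} (R : Rep K B σ)
    (hres : ∀ h < K, σ.mem 14 h + σ.mem 14 (σ.mem 11 h) = 1)
    (hexcl : ∀ v, σ.mem 18 v = 0 ∨ σ.mem 19 v = 0) {D : ℕ} (hD : 0 < D) :
    wp B augmentLoop (fun τ t =>
      IsResidual K (σ.mem 10) (σ.mem 11) (σ.mem 14) (σ.mem 18) (σ.mem 19)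
        (τ.mem 14) (τ.mem 18) (τ.mem 19) ∧
      IsLevel K (σ.mem 10) (σ.mem 11) (τ.mem 18) (τ.mem 14) (τ.mem 15) ∧
      (∀ h < K, 0 < τ.mem 15 (σ.mem 10 h) → τ.mem 19 (σ.mem 10 h) = 0) ∧
      t ≤ (267 * K + 18) * (D + K / D + 1)) σ := by
  refine wp.seq ((search_spec R fun h hh => by have := hres h hh; omega).mono ?_)
  rintro τ t hF ⟨L, hvis, h15, ht⟩
  have e10 := hF.mem 10 rfl
  have e11 := hF.mem 11 rfl
  have e14 := hF.mem 14 rfl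
  have e18 := hF.mem 18 rfl
  have e19 := hF.mem 19 rfl
  have R₁ := R.frame hF rfl
  set own := σ.mem 10 with hown
  set tw := σ.mem 11 with htw
  -- The potential that is zero everywhere shows the level bound `0`.
  have hP : PhaseBound K own tw (σ.mem 14) (σ.mem 18) (σ.mem 19) D (D + K / D) :=
    Or.inl ⟨0, Nat.zero_le _, ⟨fun _ => 0, by simp⟩, by simp⟩
  refine (wp.while (I := fun ρ =>
      IsResidual K own tw (σ.mem 14) (σ.mem 18) (σ.mem 19) (ρ.mem 14) (ρ.mem 18) (ρ.mem 19) ∧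
      IsLevel K own tw (ρ.mem 18) (ρ.mem 14) (ρ.mem 15) ∧
      (0 < ρ.reg 25 ↔ ∃ h < K, 0 < ρ.mem 15 (own h) ∧ 0 < ρ.mem 19 (own h)) ∧
      ρ.reg 15 = 1 ∧ ∃ N, PhaseBound K own tw (ρ.mem 14) (ρ.mem 18) (ρ.mem 19) D N)
    (Φ := fun ρ => (267 * K + 18) *
      sInf {N | PhaseBound K own tw (ρ.mem 14) (ρ.mem 18) (ρ.mem 19) D N}) ?_ ?_).mono ?_
  · rw [e14, e18, e19]
    exact ⟨⟨hres, hexcl, fun _ => le_rfl, fun _ => le_rfl, fun _ => rfl⟩, L, hvis, h15, _, hP⟩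
  · rintro ρ hF' ⟨F, L, hvis, h15, hN⟩ hlt
    have R₂ := R₁.frame hF' rfl
    have f10 := (hF'.mem 10 rfl).trans e10
    have f11 := (hF'.mem 11 rfl).trans e11
    rw [R₂.zero] at hlt
    have hmem := Nat.sInf_mem (s := {N | PhaseBound K own tw (ρ.mem 14) (ρ.mem 18) (ρ.mem 19) D N})
      hN
    refine wp.seq ((blocking_spec R₂ h15 ?_ ?_ F.excl).mono ?_)
    · rwa [f10, f11]
    · rw [f11]
      exact F.res_tw
    rintro π u hG ⟨⟨cur, J⟩, hu⟩
    rw [f10, f11] at J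
    have g10 := (hG.mem 10 rfl).trans f10
    have g11 := (hG.mem 11 rfl).trans f11
    refine (search_spec (R₂.frame hG rfl) ?_).mono ?_
    · intro h hh
      have := J.res_tw h hh
      omega
    rintro ω v hG' ⟨L', hvis', h15', hv⟩
    rw [g10, g11] at L'
    rw [g10] at hvis'
    rw [hG'.mem 14 rfl, hG'.mem 18 rfl, hG'.mem 19 rfl]
    have hA := R.arcs
    obtain ⟨N', hN', hP'⟩ := PhaseBound.decrease hA hD J L F.res_tw (hvis.1 hlt) hmem
    refine ⟨⟨J.isResidual F, L', hvis', h15', N', hP'⟩, ?_⟩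
    have hle := Nat.sInf_le (s := {N | PhaseBound K own tw (π.mem 14) (π.mem 18) (π.mem 19) D N})
      hP'
    have hmul := Nat.mul_le_mul_left (267 * K + 18) (Nat.succ_le_of_lt (lt_of_le_of_lt hle hN'))
    rw [Nat.mul_succ] at hmul
    omega
  · rintro ρ u hF' ⟨⟨F, L, hvis, h15, hN⟩, hlt, hu⟩
    rw [hF'.reg 5 rfl, R₁.zero, hvis] at hlt
    refine ⟨F, L, fun h hh hl => ?_, ?_⟩
    · by_contra hd
      exact hlt ⟨h, hh, hl, by omega⟩
    · rw [e14, e18, e19] at hu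
      have hle := Nat.sInf_le (s := {N | PhaseBound K own tw (σ.mem 14) (σ.mem 18) (σ.mem 19) D N})
        hP
      have hmul := Nat.mul_le_mul_left (267 * K + 18) hle
      rw [Nat.mul_succ]
      omega

end DSM

/-! ### From the input to the initial orientation and the stored network -/

namespace DSM

open Finset Function

/-! ### Positions in the concatenated list -/

theorem getElem?_flatten_of_lt {α : Type*} : ∀ (l : List (List α)) (e i : ℕ) (he : e < l.length),
    i < l[e].length → l.flatten[((l.take e).map List.length).sum + i]? = l[e][i]?
  | [], e, i, he, _ => by simp at he
  | a :: l, 0, i, _, hi => by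
    simp at hi
    simp [List.getElem?_append, hi]
  | a :: l, e + 1, i, he, hi => by
    simp at hi he
    have := getElem?_flatten_of_lt l e i he hi
    simp [List.getElem?_append, ← this, add_assoc]

namespace Listing

variable {n m : ℕ} {G : Hypergraph n m} (L : Listing G)

theorem offset_zero : L.offset 0 = 0 := by simp [offset]

theorem offset_succ (e : Fin m) : L.offset (e + 1) = L.offset e + (L.verts e).length := by
  unfold offset
  have : (univ.filter fun g : Fin m => (g : ℕ) < e + 1) =
      insert e (univ.filter fun g : Fin m => (g : ℕ) < e) := by
    ext g
    simp only [mem_filter, mem_univ, true_and, mem_insert, Fin.ext_iff]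
    omega
  rw [this, sum_insert (by simp), add_comm]

theorem offset_mono {i j : ℕ} (h : i ≤ j) : L.offset i ≤ L.offset j := by
  unfold offset
  refine sum_le_sum_of_subset fun e => ?_
  simp only [mem_filter, mem_univ, true_and]
  omega

theorem length_verts (e : Fin m) : (L.verts e).length = (G.edge e).card := by
  rw [← L.toFinset_eq, List.toFinset_card_of_nodup (L.nodup e)]

theorem offset_last : L.offset m = ∑ e, (G.edge e).card := by
  simp [offset, length_verts]

/-- Non-emptiness of the hyperedges enters here. For `i = m` it gives that `m` is at most the number
of incidences, so terms in `m` are absorbed. -/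
theorem le_offset {i : ℕ} (hi : i ≤ m) : i ≤ L.offset i := by
  induction i with
  | zero => exact Nat.zero_le _
  | succ i ih =>
    have h1 := L.offset_succ ⟨i, hi⟩
    have h2 := L.length_verts ⟨i, hi⟩
    have h3 := (G.nonempty ⟨i, hi⟩).card_pos
    have h4 := ih (by omega)
    simp only at h1
    omega

theorem offset_eq_sum {i : ℕ} (hi : i ≤ m) :
    L.offset i = (((List.ofFn L.verts).take i).map List.length).sum := by
  induction i with
  | zero => simp [offset_zero]
  | succ i ih =>
    have h1 := L.offset_succ ⟨i, hi⟩
    simp only at h1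
    rw [h1, ih (by omega), List.take_succ_eq_append_getElem (by simpa using hi)]
    simp

theorem flat_offset (e : Fin m) {i : ℕ} (hi : i < (L.verts e).length) :
    L.flat.getD (L.offset e + i) 0 = (L.verts e)[i] := by
  have := getElem?_flatten_of_lt (List.ofFn L.verts) e i (by simp) (by simpa using hi)
  rw [← L.offset_eq_sum e.2.le] at this
  rw [flat, List.getD_eq_getElem?_getD, List.getElem?_map, this]
  simp [hi]

theorem exists_position {p : ℕ} (hp : p < L.offset m) :
    ∃ e : Fin m, L.offset e ≤ p ∧ p < L.offset (e + 1) := by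
  by_contra! h
  have : ∀ i ≤ m, L.offset i ≤ p := by
    intro i
    induction i with
    | zero => intro _; rw [offset_zero]; exact Nat.zero_le _
    | succ i ih => exact fun hi => h ⟨i, hi⟩ (ih (by omega))
  have := this m le_rfl
  omega

theorem position_unique {p : ℕ} {e e' : Fin m} (h1 : L.offset e ≤ p) (h2 : p < L.offset (e + 1))
    (h3 : L.offset e' ≤ p) (h4 : p < L.offset (e' + 1)) : e = e' := by
  by_contra hne
  rcases Nat.lt_or_gt_of_ne (fun h => hne (Fin.ext h)) with h | h
  · have := L.offset_mono (Nat.succ_le_of_lt h)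
    simp only [Nat.succ_eq_add_one] at this
    omega
  · have := L.offset_mono (Nat.succ_le_of_lt h)
    simp only [Nat.succ_eq_add_one] at this
    omega

end Listing

/-- The incidences of a hypergraph, numbered by `0, …, M - 1`: the incidence `p` consists of the
hyperedge `E p` and its vertex `U p`. -/
structure Incidence {n m : ℕ} (G : Hypergraph n m) (M : ℕ) (E : ℕ → Fin m) (U : ℕ → Fin n) :
    Prop where
  mem : ∀ p < M, U p ∈ G.edge (E p)
  inj : ∀ p < M, ∀ q < M, E p = E q → U p = U q → p = q
  surj : ∀ e, ∀ u ∈ G.edge e, ∃ p < M, E p = e ∧ U p = u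

/-- The incidences in the order in which a listing gives them. -/
structure Listing.Numbering {n m : ℕ} {G : Hypergraph n m} (L : Listing G) (E : ℕ → Fin m)
    (U : ℕ → Fin n) : Prop where
  incidence : Incidence G (L.offset m) E U
  edge_eq : ∀ (e : Fin m) p, L.offset e ≤ p → p < L.offset (e + 1) → E p = e
  vert_eq : ∀ (e : Fin m) i (hi : i < (L.verts e).length), U (L.offset e + i) = (L.verts e)[i]
  flat_eq : ∀ p < L.offset m, L.flat.getD p 0 = U p

theorem Listing.exists_numbering {n m : ℕ} (hm : 0 < m) {G : Hypergraph n m} (L : Listing G) :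
    ∃ E U, L.Numbering E U := by
  -- `U` is total and needs a default vertex beyond the last position. One exists because there is a
  -- hyperedge and it is non-empty.
  have hn : 0 < n := by
    obtain ⟨u, -⟩ := G.nonempty ⟨0, hm⟩
    exact u.pos
  have hex : ∀ p, ∃ e : Fin m, p < L.offset m → L.offset e ≤ p ∧ p < L.offset (e + 1) := fun p => by
    by_cases hp : p < L.offset m
    · obtain ⟨e, he⟩ := L.exists_position hp
      exact ⟨e, fun _ => he⟩
    · exact ⟨⟨0, hm⟩, fun h => absurd h hp⟩
  choose E hE using hex
  have hlast : ∀ (e : Fin m) {p}, p < L.offset (e + 1) → p < L.offset m := fun e p hp =>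
    hp.trans_le (L.offset_mono e.2)
  have hEe : ∀ (e : Fin m) p, L.offset e ≤ p → p < L.offset (e + 1) → E p = e := fun e p h1 h2 =>
    L.position_unique (hE p (hlast e h2)).1 (hE p (hlast e h2)).2 h1 h2
  let U : ℕ → Fin n := fun p => (L.verts (E p))[p - L.offset (E p)]?.getD ⟨0, hn⟩
  have hU : ∀ (e : Fin m) i (hi : i < (L.verts e).length),
      U (L.offset e + i) = (L.verts e)[i] := fun e i hi => by
    have h1 := L.offset_succ e
    have h2 := hEe e (L.offset e + i) (by omega) (by omega)
    simp [U, h2, hi]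
  have hform : ∀ p < L.offset m, ∃ (e : Fin m) (i : ℕ), i < (L.verts e).length ∧
      p = L.offset e + i := fun p hp => by
    have h1 := hE p hp
    have h2 := L.offset_succ (E p)
    exact ⟨E p, p - L.offset (E p), by omega, by omega⟩
  have hEoff : ∀ (e : Fin m) i, i < (L.verts e).length → E (L.offset e + i) = e := fun e i hi => by
    have h1 := L.offset_succ e
    exact hEe e _ (by omega) (by omega)
  have hoff : ∀ (e : Fin m) i, i < (L.verts e).length → L.offset e + i < L.offset m :=
    fun e i hi => hlast e (by have := L.offset_succ e; omega)
  refine ⟨E, U, ⟨?_, ?_, ?_⟩, hEe, hU, ?_⟩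
  · intro p hp
    obtain ⟨e, i, hi, rfl⟩ := hform p hp
    rw [hU e i hi, hEoff e i hi, ← L.toFinset_eq]
    exact List.mem_toFinset.2 (List.getElem_mem hi)
  · intro p hp q hq hpq hu
    obtain ⟨e, i, hi, rfl⟩ := hform p hp
    obtain ⟨e', j, hj, rfl⟩ := hform q hq
    rw [hEoff e i hi, hEoff e' j hj] at hpq
    subst hpq
    rw [hU e i hi, hU e j hj] at hu
    rw [(L.nodup e).getElem_inj_iff.1 hu]
  · intro e u hu
    rw [← L.toFinset_eq, List.mem_toFinset] at hu
    obtain ⟨i, hi, rfl⟩ := List.getElem_of_mem hu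
    exact ⟨_, hoff e i hi, hEoff e i hi, hU e i hi⟩
  · intro p hp
    obtain ⟨e, i, hi, rfl⟩ := hform p hp
    rw [L.flat_offset e hi, hU e i hi]

/-- The orientation in which the first `δ` vertices listed are the target vertices. -/
def Listing.orientation {n m : ℕ} {G : Hypergraph n m} (L : Listing G) (δ : ℕ) :
    Orientation G where
  head e := ((L.verts e).take δ).toFinset
  head_subset e := by
    rw [← L.toFinset_eq]
    intro u
    rw [List.mem_toFinset, List.mem_toFinset]
    exact List.mem_of_mem_take

theorem Listing.isDelta_orientation {n m : ℕ} {G : Hypergraph n m} (L : Listing G) (δ : ℕ) :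
    (L.orientation δ).IsDelta δ := fun e => by
  have h : ((L.verts e).take δ).Nodup := (L.nodup e).sublist (List.take_sublist _ _)
  simp only [orientation]
  rw [List.toFinset_card_of_nodup h, List.length_take, L.length_verts]

theorem Listing.mem_orientation {n m : ℕ} {G : Hypergraph n m} (L : Listing G) (δ : ℕ) (e : Fin m)
    {i : ℕ} (hi : i < (L.verts e).length) : (L.verts e)[i] ∈ (L.orientation δ).head e ↔ i < δ := by
  simp only [orientation, List.mem_toFinset, List.mem_take_iff_getElem]
  constructor
  · rintro ⟨j, hj, h⟩
    rw [(L.nodup e).getElem_inj_iff] at h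
    omega
  · intro h
    exact ⟨i, by omega, rfl⟩

/-- Array `2` holds an orientation, in terms of the incidences. -/
theorem Listing.holdsOrientation_of {n m : ℕ} {G : Hypergraph n m} {L : Listing G}
    {E : ℕ → Fin m} {U : ℕ → Fin n} (N : L.Numbering E U) {O : Orientation G} {σ : State}
    (h : ∀ p < L.offset m, σ.mem 2 p = if U p ∈ O.head (E p) then 1 else 0) :
    L.HoldsOrientation O σ := fun e i hi => by
  have h1 := L.offset_succ e
  have h2 := L.offset_mono (i := e + 1) (j := m) e.2
  rw [h _ (by omega), N.vert_eq e i hi, N.edge_eq e _ (by omega) (by omega)]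

end DSM

namespace DSM

open Finset Function

/-! ### The program for the initial orientation -/

/-- The parameters and the incidences are stored where the programs expect them. -/
structure Base {n m : ℕ} (k M : ℕ) (E : ℕ → Fin m) (U : ℕ → Fin n) (σ : State) : Prop where
  r0 : σ.reg 0 = n
  r2 : σ.reg 2 = k
  r5 : σ.reg 5 = 0
  r7 : σ.reg 7 = M
  r15 : σ.reg 15 = 1
  r26 : σ.reg 26 = n + m
  vert : ∀ p < M, σ.mem 1 p = U p
  edge : ∀ p < M, σ.mem 8 p = n + E p

theorem Base.of_eq {n m k M : ℕ} {E : ℕ → Fin m} {U : ℕ → Fin n} {σ τ : State}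
    (b : Base k M E U σ) (h0 : τ.reg 0 = σ.reg 0) (h2 : τ.reg 2 = σ.reg 2)
    (h5 : τ.reg 5 = σ.reg 5) (h7 : τ.reg 7 = σ.reg 7) (h15 : τ.reg 15 = σ.reg 15)
    (h26 : τ.reg 26 = σ.reg 26) (hm1 : τ.mem 1 = σ.mem 1) (hm8 : τ.mem 8 = σ.mem 8) :
    Base k M E U τ where
  r0 := h0.trans b.r0
  r2 := h2.trans b.r2
  r5 := h5.trans b.r5
  r7 := h7.trans b.r7
  r15 := h15.trans b.r15
  r26 := h26.trans b.r26
  vert := by rw [hm1]; exact b.vert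
  edge := by rw [hm8]; exact b.edge

theorem Base.frame {n m k M : ℕ} {E : ℕ → Fin m} {U : ℕ → Fin n} {σ τ : State} {P : Prog}
    (b : Base k M E U σ) (hF : Frame P σ τ) (h15 : τ.reg 15 = σ.reg 15)
    (h : (P.setsReg 0 || P.setsReg 2 || P.setsReg 5 || P.setsReg 7 ||
      P.setsReg 26 || P.setsMem 1 || P.setsMem 8) = false) : Base k M E U τ := by
  simp only [Bool.or_eq_false_iff] at h
  obtain ⟨⟨⟨⟨⟨⟨h0, h2⟩, h5⟩, h7⟩, h26⟩, h1⟩, h8⟩ := h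
  exact b.of_eq (hF.reg 0 h0) (hF.reg 2 h2) (hF.reg 5 h5) (hF.reg 7 h7) h15
    (hF.reg 26 h26) (hF.mem 1 h1) (hF.mem 8 h8)

/-- Array `2` holds the orientation `O`. -/
def Bits {n m : ℕ} (M : ℕ) (E : ℕ → Fin m) (U : ℕ → Fin n) {G : Hypergraph n m}
    (O : Orientation G) (σ : State) : Prop :=
  ∀ p < M, σ.mem 2 p = if U p ∈ O.head (E p) then 1 else 0

/-- Go through all hyperedges and mark the first `δ` vertices of each. -/
def orientLoop : Prog :=
  .whileLt 10 1
    (.ifLt 11 13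
      (.ifLt 12 3 (.store 2 11 15) (.store 2 11 5) ;; .store 8 11 26 ;; .inc 11 ;; .inc 12)
      (.inc 10 ;; .inc 26 ;; .const 12 0 ;; .copy 14 10 ;; .inc 14 ;; .load 13 0 14))

/-- Compute an orientation. -/
def orientProg : Prog :=
  .const 15 1 ;; .load 7 0 1 ;; .load 13 0 15 ;; .copy 26 0 ;; orientLoop

/-- The nested loops over hyperedges and over their vertices are merged: each round handles one
position or passes to the next hyperedge. The potential counts the remaining positions and the
remaining hyperedges, and the latter number at most `L.offset m`. Register `13` holds the end of the
current hyperedge. After the last hyperedge it is loaded from index `m + 1` and is no longer used.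
-/
theorem orientLoop_spec {n m B : ℕ} {G : Hypergraph n m} {L : Listing G} {E : ℕ → Fin m}
    {U : ℕ → Fin n} (N : L.Numbering E U) {δ : ℕ} {σ : State} (hB : 2 * L.offset m + n + m + 2 ≤ B)
    (hoff : ∀ i ≤ m, σ.mem 0 i = L.offset i)
    (h1 : σ.reg 1 = m) (h3 : σ.reg 3 = δ) (h5 : σ.reg 5 = 0)
    (h15 : σ.reg 15 = 1) (h10 : σ.reg 10 = 0) (h11 : σ.reg 11 = 0) (h12 : σ.reg 12 = 0)
    (h13 : σ.reg 13 = σ.mem 0 1) (h26 : σ.reg 26 = n) :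
    wp B orientLoop (fun τ t => Bits (L.offset m) E U (L.orientation δ) τ ∧
      (∀ p < L.offset m, τ.mem 8 p = n + E p) ∧ τ.reg 26 = n + m ∧
      t ≤ 18 * L.offset m + 1) σ := by
  refine (wp.while (I := fun τ => τ.reg 10 ≤ m ∧ τ.reg 13 = τ.mem 0 (τ.reg 10 + 1) ∧
      L.offset (τ.reg 10) ≤ τ.reg 11 ∧ (τ.reg 10 < m → τ.reg 11 ≤ L.offset (τ.reg 10 + 1)) ∧
      τ.reg 12 = τ.reg 11 - L.offset (τ.reg 10) ∧ τ.reg 26 = n + τ.reg 10 ∧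
      ∀ p < τ.reg 11, p < L.offset m →
        τ.mem 2 p = (if U p ∈ (L.orientation δ).head (E p) then 1 else 0) ∧ τ.mem 8 p = n + E p)
    (Φ := fun τ => 9 * (L.offset m - τ.reg 11 + (m - τ.reg 10))) ?_ ?_).mono ?_
  · simp [h10, h11, h12, h13, h26, L.offset_zero]
  · rintro τ hF ⟨i1, i2, i3, i4, i5, i6, i7⟩ hlt
    have e1 := (hF.reg 1 rfl).trans h1
    have e3 := (hF.reg 3 rfl).trans h3
    have e5 := (hF.reg 5 rfl).trans h5
    have e15 := (hF.reg 15 rfl).trans h15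
    have e0 := hF.mem 0 rfl
    rw [e1] at hlt
    have i4 := i4 hlt
    have hoff' : σ.mem 0 (τ.reg 10 + 1) = L.offset (τ.reg 10 + 1) := hoff _ hlt
    rw [e0, hoff'] at i2
    have hlast : L.offset (τ.reg 10 + 1) ≤ L.offset m := L.offset_mono hlt
    have hsucc := L.offset_succ ⟨τ.reg 10, hlt⟩
    simp only at hsucc
    apply wp.of_vc
    simp [vc, numArrays, e5, e3, e15, e0]
    refine ⟨fun hp => ?_, fun hp => ?_⟩
    · have hE : E (τ.reg 11) = ⟨τ.reg 10, hlt⟩ := N.edge_eq ⟨τ.reg 10, hlt⟩ _ i3 (by rw [← i2]; exact hp)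
      have hU := N.vert_eq ⟨τ.reg 10, hlt⟩ (τ.reg 12) (by omega)
      have hpos : L.offset (τ.reg 10) + τ.reg 12 = τ.reg 11 := by omega
      simp only [hpos] at hU
      have hmem := L.mem_orientation δ ⟨τ.reg 10, hlt⟩ (i := τ.reg 12) (by omega)
      refine ⟨fun hc => ⟨by omega, ?_, by omega⟩, fun hc => ⟨by omega, ?_, by omega⟩⟩
      all_goals
        refine ⟨i1, ?_, by omega, by omega, by omega, i6, ?_⟩
        · rw [hoff', i2]
        · intro p hp hpM
          rcases hp.lt_or_eq with hlt' | rfl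
          · rw [update_of_ne hlt'.ne, update_of_ne hlt'.ne]
            exact i7 p hlt' hpM
          · rw [update_self, update_self, hE, hU]
            simp only [hmem]
            simp [i6]
            omega
    · refine ⟨by omega, ⟨by omega, by omega, fun h => ?_, by omega, by omega, i7⟩, by omega⟩
      have := L.offset_mono (i := τ.reg 10 + 1) (j := τ.reg 10 + 1 + 1) (by omega)
      omega
  · rintro τ t hF ⟨⟨i1, i2, i3, i4, i5, i6, i7⟩, hlt, ht⟩
    rw [hF.reg 1 rfl, h1] at hlt
    have e : τ.reg 10 = m := by omega
    rw [e] at i3 i6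
    refine ⟨fun p hp => (i7 p (by omega) hp).1, fun p hp => (i7 p (by omega) hp).2, i6, ?_⟩
    have := L.le_offset (le_refl m)
    rw [h10, h11] at ht
    omega

theorem orientProg_spec {n m k B : ℕ} (hm : 0 < m) {G : Hypergraph n m} {L : Listing G}
    {E : ℕ → Fin m} {U : ℕ → Fin n} (N : L.Numbering E U) {δ : ℕ}
    (hB : 2 * L.offset m + n + m + 2 ≤ B) :
    wp B orientProg (fun τ t => Base k (L.offset m) E U τ ∧
      Bits (L.offset m) E U (L.orientation δ) τ ∧ t ≤ 18 * L.offset m + 5) (L.input k δ) := by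
  refine wp.vc_seq (wp.vc_seq ⟨by decide, ?_, wp.vc_seq ⟨by decide, ?_, wp.vc_seq ?_⟩⟩)
  · simp [Listing.input]
    omega
  · simp [Listing.input]
    omega
  refine (orientLoop_spec N (δ := δ) hB ?_ ?_ ?_ ?_ ?_ ?_ ?_ ?_ ?_ ?_).mono ?_
  · intro i hi
    simp [Listing.input, hi]
  all_goals try (simp [Listing.input]; done)
  rintro τ t hF ⟨h1, h2, h3, ht⟩
  have e0 := hF.reg 0 rfl
  have e2 := hF.reg 2 rfl
  have e5 := hF.reg 5 rfl
  have e7 := hF.reg 7 rfl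
  have e15 := hF.reg 15 rfl
  have em := hF.mem 1 rfl
  simp [Listing.input] at e0 e2 e5 e7 e15 em
  refine ⟨⟨e0, e2, e5, e7, e15, h3, ?_, h2⟩, h1, by omega⟩
  intro p hp
  rw [em, ← N.flat_eq p hp, List.getD_eq_getElem?_getD]

end DSM

namespace DSM

open Finset Function

/-! ### The program for the re-orientation network -/

/-- Compute the indegrees in array `9`, which has to be cleared before. -/
def indegLoop : Prog :=
  .whileLt 10 7 (.load 11 1 10 ;; .load 12 2 10 ;;
    .ifLt 5 12 (.load 12 9 11 ;; .inc 12 ;; .store 9 11 12) skip ;; .inc 10)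

/-- List the arcs between vertices and hyperedges. -/
def unitArcLoop : Prog :=
  .whileLt 10 7 (.load 11 1 10 ;; .load 12 8 10 ;; .load 13 2 10 ;;
    .ifLt 5 13 (.store 3 10 12 ;; .store 4 10 11) (.store 3 10 11 ;; .store 4 10 12) ;;
    .store 5 10 15 ;; .inc 10)

/-- List the arcs at the source and the sink. -/
def terminalArcLoop : Prog :=
  .whileLt 10 0 (.load 11 9 10 ;; .inc 11 ;;
    .ifLt 11 2
      (.sub 12 2 11 ;; .store 3 4 26 ;; .store 4 4 10 ;; .store 5 4 12 ;; .store 18 10 12 ;; .inc 4)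
      (.ifLt 2 11
        (.sub 12 11 2 ;; .store 3 4 10 ;; .store 4 4 17 ;; .store 5 4 12 ;; .store 19 10 12 ;;
          .inc 4)
        skip) ;;
    .inc 10)

/-- Compute the re-orientation network. -/
def networkProg : Prog :=
  .const 10 0 ;; indegLoop ;; .const 10 0 ;; unitArcLoop ;; .copy 17 26 ;; .inc 17 ;; .copy 4 7 ;;
    .const 10 0 ;; terminalArcLoop

variable {n m k M B : ℕ} {G : Hypergraph n m} {E : ℕ → Fin m} {U : ℕ → Fin n} {O : Orientation G}

theorem Incidence.indeg_eq (N : Incidence G M E U) (u : Fin n) :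
    O.indeg u = #{p ∈ range M | U p = u ∧ U p ∈ O.head (E p)} := by
  unfold Orientation.indeg
  symm
  refine card_nbij E ?_ ?_ ?_
  · intro p hp
    simp only [coe_filter, mem_range, Set.mem_ofPred_eq, mem_univ, true_and] at hp ⊢
    rw [← hp.2.1]
    exact hp.2.2
  · intro p hp q hq h
    simp only [coe_filter, mem_range, Set.mem_ofPred_eq] at hp hq
    exact N.inj p hp.1 q hq.1 h (by rw [hp.2.1, hq.2.1])
  · intro e he
    simp only [coe_filter, mem_univ, true_and, Set.mem_ofPred_eq] at he
    obtain ⟨p, hp, h1, h2⟩ := N.surj e u (O.head_subset e he)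
    refine ⟨p, ?_, h1⟩
    simp only [coe_filter, mem_range, Set.mem_ofPred_eq]
    exact ⟨hp, h2, by rw [h1, h2]; exact he⟩

theorem indegLoop_spec (N : Incidence G M E U) {σ : State} (hB : 2 * M + n + m + 2 ≤ B)
    (b : Base k M E U σ) (hO : Bits M E U O σ) (h10 : σ.reg 10 = 0) (h9 : ∀ u < n, σ.mem 9 u = 0) :
    wp B indegLoop (fun τ t => (∀ u : Fin n, τ.mem 9 u = O.indeg u) ∧ t ≤ 9 * M + 1) σ := by
  -- `c i u` counts the incidences before position `i` at which `u` is a target. Only its recursion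
  -- is needed in the loop.
  obtain ⟨c, hc0, hcs, hcM⟩ : ∃ c : ℕ → Fin n → ℕ, (∀ u, c 0 u = 0) ∧
      (∀ i u, c (i + 1) u = c i u + if U i = u ∧ U i ∈ O.head (E i) then 1 else 0) ∧
      ∀ u, c M u = O.indeg u :=
    ⟨fun i u => #{p ∈ range i | U p = u ∧ U p ∈ O.head (E p)}, fun u => by simp, fun i u => by
      simp only [card_filter, sum_range_succ], fun u => N.indeg_eq u |>.symm⟩
  refine (wp.while (I := fun τ => τ.reg 10 ≤ M ∧ ∀ u : Fin n, τ.mem 9 u = c (τ.reg 10) u)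
    (Φ := fun τ => 9 * (M - τ.reg 10)) ?_ ?_).mono ?_
  · simp [h10, h9, hc0]
  · rintro τ hF ⟨i1, i2⟩ hlt
    have b' := b.frame hF (hF.reg 15 rfl) rfl
    rw [b'.r7] at hlt
    have hu := (U (τ.reg 10)).2
    have e2 : τ.mem 2 (τ.reg 10) = _ := (congrFun (hF.mem 2 rfl) _).trans (hO _ hlt)
    apply wp.of_vc
    by_cases hh : U (τ.reg 10) ∈ O.head (E (τ.reg 10))
    · rw [if_pos hh] at e2
      simp [vc, numArrays, skip, b'.r5, b'.vert _ hlt, e2, hcs, hh]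
      refine ⟨by omega, by omega, ⟨by omega, fun u => ?_⟩, by omega⟩
      by_cases e : U (τ.reg 10) = u
      · subst e
        simp [i2]
      · rw [update_of_ne (fun h => e (Fin.ext h.symm)), i2]
        simp [e]
    · rw [if_neg hh] at e2
      simp [vc, numArrays, skip, b'.r5, b'.vert _ hlt, e2, hcs, hh]
      exact ⟨by omega, ⟨by omega, i2⟩, by omega⟩
  · rintro τ t hF ⟨⟨i1, i2⟩, hlt, ht⟩
    rw [hF.reg 7 rfl, b.r7] at hlt
    have e : τ.reg 10 = M := by omega
    rw [e] at i2
    refine ⟨fun u => by rw [i2, hcM], by rw [h10] at ht; omega⟩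

/-- The arcs between vertices and hyperedges are listed at the positions of their incidences. -/
def UnitArcs (M : ℕ) (E : ℕ → Fin m) (U : ℕ → Fin n) (O : Orientation G) (σ : State) : Prop :=
  ∀ p < M, σ.mem 5 p = 1 ∧
    (U p ∈ O.head (E p) → σ.mem 3 p = n + E p ∧ σ.mem 4 p = U p) ∧
    (U p ∉ O.head (E p) → σ.mem 3 p = U p ∧ σ.mem 4 p = n + E p)

theorem unitArcLoop_spec {σ : State} (hB : 2 * M + n + m + 2 ≤ B)
    (b : Base k M E U σ) (hO : Bits M E U O σ) (h10 : σ.reg 10 = 0) :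
    wp B unitArcLoop (fun τ t => UnitArcs M E U O τ ∧ t ≤ 9 * M + 1) σ := by
  refine (wp.while (I := fun τ => τ.reg 10 ≤ M ∧ UnitArcs (τ.reg 10) E U O τ)
    (Φ := fun τ => 9 * (M - τ.reg 10)) ?_ ?_).mono ?_
  · simp [h10, UnitArcs]
  · rintro τ hF ⟨i1, i2⟩ hlt
    have b' := b.frame hF (hF.reg 15 rfl) rfl
    rw [b'.r7] at hlt
    have e2 : τ.mem 2 (τ.reg 10) = _ := (congrFun (hF.mem 2 rfl) _).trans (hO _ hlt)
    apply wp.of_vc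
    simp [vc, numArrays, b'.r5, b'.vert _ hlt, b'.edge _ hlt, b'.r15]
    refine ⟨by omega, fun hp => ⟨by omega, ⟨by omega, ?_⟩, by omega⟩,
      fun hp => ⟨by omega, ⟨by omega, ?_⟩, by omega⟩⟩
    all_goals
      intro p hp'
      rcases Nat.lt_succ_iff_lt_or_eq.1 hp' with hlt' | rfl
      · simp [hlt'.ne]
        exact i2 p hlt'
      · simp
        intro hh
        simp [hh] at e2
        omega
  · rintro τ t hF ⟨⟨i1, i2⟩, hlt, ht⟩
    rw [hF.reg 7 rfl, b.r7] at hlt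
    have e : τ.reg 10 = M := by omega
    rw [e] at i2
    exact ⟨i2, by rw [h10] at ht; omega⟩

/-- The arcs at the source and the sink that belong to the first `i` vertices are listed from
position `M` on, up to position `r`. -/
structure TerminalArcs (n m k M : ℕ) (w : ℕ → ℕ) (i r : ℕ) (σ : State) : Prop where
  le : M ≤ r
  r_le : r ≤ M + i
  listed : ∀ j, M ≤ j → j < r → ∃ u < i,
    (w u < k ∧ σ.mem 3 j = n + m ∧ σ.mem 4 j = u ∧ σ.mem 5 j = k - w u) ∨
    (k < w u ∧ σ.mem 3 j = u ∧ σ.mem 4 j = n + m + 1 ∧ σ.mem 5 j = w u - k)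
  source : ∀ u < i, w u < k → ∃ j, M ≤ j ∧ j < r ∧ σ.mem 3 j = n + m ∧ σ.mem 4 j = u
  sink : ∀ u < i, k < w u → ∃ j, M ≤ j ∧ j < r ∧ σ.mem 3 j = u ∧ σ.mem 4 j = n + m + 1
  inj : ∀ j j', M ≤ j → j < r → M ≤ j' → j' < r → σ.mem 3 j = σ.mem 3 j' →
    σ.mem 4 j = σ.mem 4 j' → j = j'

/-- Here the indegree equals `k - 1`, so the vertex is joined neither to the source nor to the sink.
-/
theorem TerminalArcs.skip {w : ℕ → ℕ} {i r : ℕ} {σ : State} (T : TerminalArcs n m k M w i r σ)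
    (h : w i = k) {τ : State} (hm : τ.mem = σ.mem) : TerminalArcs n m k M w (i + 1) r τ where
  le := T.le
  r_le := by have := T.r_le; omega
  listed j h1 h2 := by
    obtain ⟨u, hu, h'⟩ := T.listed j h1 h2
    rw [hm]
    exact ⟨u, by omega, h'⟩
  source u hu hw := by
    rw [hm]
    rcases Nat.lt_succ_iff_lt_or_eq.1 hu with h' | rfl
    · exact T.source u h' hw
    · omega
  sink u hu hw := by
    rw [hm]
    rcases Nat.lt_succ_iff_lt_or_eq.1 hu with h' | rfl
    · exact T.sink u h' hw
    · omega
  inj := by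
    rw [hm]
    exact T.inj

/-- One more arc is listed. -/
theorem TerminalArcs.add {w : ℕ → ℕ} {i r x y c : ℕ} {σ τ : State}
    (T : TerminalArcs n m k M w i r σ) (hi : i < n) (h3 : τ.mem 3 = update (σ.mem 3) r x)
    (h4 : τ.mem 4 = update (σ.mem 4) r y) (h5 : τ.mem 5 = update (σ.mem 5) r c)
    (h : (w i < k ∧ x = n + m ∧ y = i ∧ c = k - w i) ∨
      (k < w i ∧ x = i ∧ y = n + m + 1 ∧ c = w i - k)) :
    TerminalArcs n m k M w (i + 1) (r + 1) τ := by
  have old : ∀ j < r, τ.mem 3 j = σ.mem 3 j ∧ τ.mem 4 j = σ.mem 4 j ∧ τ.mem 5 j = σ.mem 5 j :=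
    fun j hj => by
      rw [h3, h4, h5, update_of_ne hj.ne, update_of_ne hj.ne, update_of_ne hj.ne]
      exact ⟨rfl, rfl, rfl⟩
  have new : τ.mem 3 r = x ∧ τ.mem 4 r = y ∧ τ.mem 5 r = c := by
    rw [h3, h4, h5, update_self, update_self, update_self]
    exact ⟨rfl, rfl, rfl⟩
  have hle := T.le
  -- The arcs listed so far belong to vertices smaller than `i`, and the codes of source and sink
  -- are not codes of vertices.
  have hne : ∀ j, M ≤ j → j < r → σ.mem 3 j = x → σ.mem 4 j = y → False := by
    intro j hj1 hj2 e3 e4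
    obtain ⟨u, hu, h'⟩ := T.listed j hj1 hj2
    omega
  refine ⟨by omega, by have := T.r_le; omega, ?_, ?_, ?_, ?_⟩
  · intro j h1 h2
    rcases Nat.lt_succ_iff_lt_or_eq.1 h2 with h' | rfl
    · obtain ⟨u, hu, h''⟩ := T.listed j h1 h'
      rw [(old j h').1, (old j h').2.1, (old j h').2.2]
      exact ⟨u, by omega, h''⟩
    · rw [new.1, new.2.1, new.2.2]
      exact ⟨i, by omega, h⟩
  · intro u hu hw
    rcases Nat.lt_succ_iff_lt_or_eq.1 hu with h' | rfl
    · obtain ⟨j, h1, h2, h''⟩ := T.source u h' hw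
      refine ⟨j, h1, by omega, ?_⟩
      rwa [(old j h2).1, (old j h2).2.1]
    · refine ⟨r, hle, by omega, ?_⟩
      rw [new.1, new.2.1]
      omega
  · intro u hu hw
    rcases Nat.lt_succ_iff_lt_or_eq.1 hu with h' | rfl
    · obtain ⟨j, h1, h2, h''⟩ := T.sink u h' hw
      refine ⟨j, h1, by omega, ?_⟩
      rwa [(old j h2).1, (old j h2).2.1]
    · refine ⟨r, hle, by omega, ?_⟩
      rw [new.1, new.2.1]
      omega
  · intro j j' h1 h2 h1' h2' e3 e4
    rcases Nat.lt_succ_iff_lt_or_eq.1 h2 with h' | rfl <;>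
      rcases Nat.lt_succ_iff_lt_or_eq.1 h2' with h'' | rfl
    · rw [(old j h').1, (old j' h'').1] at e3
      rw [(old j h').2.1, (old j' h'').2.1] at e4
      exact T.inj j j' h1 h' h1' h'' e3 e4
    · rw [(old j h').1, new.1] at e3
      rw [(old j h').2.1, new.2.1] at e4
      exact (hne j h1 h' e3 e4).elim
    · rw [(old j' h'').1, new.1] at e3
      rw [(old j' h'').2.1, new.2.1] at e4
      exact (hne j' h1' h'' e3.symm e4.symm).elim
    · rfl

/-- Since `d = k - 1` is negative for `k = 0`, the machine compares the indegree plus one with `k`.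
The capacities are stored a second time as supplies and demands, indexed by vertices, for use in the
phases. -/
theorem terminalArcLoop_spec {σ : State} (hB : 2 * M + n + m + 2 ≤ B)
    (b : Base k M E U σ) (h10 : σ.reg 10 = 0) (h4 : σ.reg 4 = M) (h17 : σ.reg 17 = n + m + 1)
    (h18 : ∀ v, σ.mem 18 v = 0) (h19 : ∀ v, σ.mem 19 v = 0) :
    wp B terminalArcLoop (fun τ t =>
      TerminalArcs n m k M (fun u => σ.mem 9 u + 1) n (τ.reg 4) τ ∧
      (∀ j < M, τ.mem 3 j = σ.mem 3 j ∧ τ.mem 4 j = σ.mem 4 j ∧ τ.mem 5 j = σ.mem 5 j) ∧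
      (∀ v, τ.mem 18 v = if v < n then k - (σ.mem 9 v + 1) else 0) ∧
      (∀ v, τ.mem 19 v = if v < n then σ.mem 9 v + 1 - k else 0) ∧ t ≤ 13 * n + 1) σ := by
  refine (wp.while (I := fun τ => τ.reg 10 ≤ n ∧
      TerminalArcs n m k M (fun u => σ.mem 9 u + 1) (τ.reg 10) (τ.reg 4) τ ∧
      (∀ j < M, τ.mem 3 j = σ.mem 3 j ∧ τ.mem 4 j = σ.mem 4 j ∧ τ.mem 5 j = σ.mem 5 j) ∧
      (∀ v, τ.mem 18 v = if v < τ.reg 10 then k - (σ.mem 9 v + 1) else 0) ∧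
      (∀ v, τ.mem 19 v = if v < τ.reg 10 then σ.mem 9 v + 1 - k else 0))
    (Φ := fun τ => 13 * (n - τ.reg 10)) ?_ ?_).mono ?_
  · simp [h10, h18, h19]
    constructor <;> intros <;> omega
  · rintro τ hF ⟨i1, T, i3, i4, i5⟩ hlt
    have b' := b.frame hF (hF.reg 15 rfl) rfl
    rw [b'.r0] at hlt
    have e9 := hF.mem 9 rfl
    have e17 := (hF.reg 17 rfl).trans h17
    have hr := T.r_le
    have hM := T.le
    have hext : ∀ (f g : ℕ → ℕ) (c : ℕ), (∀ v, f v = if v < τ.reg 10 then g v else 0) →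
        c = g (τ.reg 10) →
        ∀ v, update f (τ.reg 10) c v = if v ≤ τ.reg 10 then g v else 0 := by
      intro f g c hf hc v
      by_cases e : v = τ.reg 10
      · simp [e, hc]
      · rw [update_of_ne e, hf]
        split_ifs <;> omega
    have hext' : ∀ (f g : ℕ → ℕ), (∀ v, f v = if v < τ.reg 10 then g v else 0) →
        g (τ.reg 10) = 0 → ∀ v, f v = if v ≤ τ.reg 10 then g v else 0 := by
      intro f g hf hc v
      have := hext f g 0 hf hc.symm v
      rw [← this, update_apply]
      split_ifs with e
      · rw [hf, e]
        simp
      · rfl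
    apply wp.of_vc
    simp [vc, numArrays, skip, b'.r2, b'.r26, e9, e17]
    refine ⟨by omega, fun hk => ⟨by omega, by omega, ⟨by omega, ?_, ?_, ?_, ?_⟩, by omega⟩,
      fun hk => ⟨fun hk' => ⟨by omega, by omega, ⟨by omega, ?_, ?_, ?_, ?_⟩, by omega⟩,
      fun hk' => ⟨⟨by omega, ?_, ?_, ?_, ?_⟩, by omega⟩⟩⟩
    · exact T.add hlt rfl rfl rfl (Or.inl ⟨hk, rfl, rfl, rfl⟩)
    · intro j hj
      rw [update_of_ne (by omega), update_of_ne (by omega), update_of_ne (by omega)]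
      exact i3 j hj
    · exact hext _ _ _ i4 rfl
    · exact hext' _ _ i5 (by omega)
    · exact T.add hlt rfl rfl rfl (Or.inr ⟨Nat.lt_succ_of_le hk', rfl, rfl, rfl⟩)
    · intro j hj
      rw [update_of_ne (by omega), update_of_ne (by omega), update_of_ne (by omega)]
      exact i3 j hj
    · exact hext' _ _ i4 (by omega)
    · exact hext _ _ _ i5 rfl
    · exact T.skip (by omega) rfl
    · exact i3
    · exact hext' _ _ i4 (by omega)
    · exact hext' _ _ i5 (by omega)
  · rintro τ t hF ⟨⟨i1, T, i3, i4, i5⟩, hlt, ht⟩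
    rw [hF.reg 0 rfl, b.r0] at hlt
    have e : τ.reg 10 = n := by omega
    rw [e] at T i4 i5
    exact ⟨T, i3, i4, i5, by rw [h10] at ht; omega⟩

theorem networkProg_spec (N : Incidence G M E U) {σ : State} (hB : 2 * M + n + m + 2 ≤ B)
    (b : Base k M E U σ) (hO : Bits M E U O σ) (h9 : ∀ v, σ.mem 9 v = 0)
    (h18 : ∀ v, σ.mem 18 v = 0) (h19 : ∀ v, σ.mem 19 v = 0) :
    wp B networkProg (fun τ t => UnitArcs M E U O τ ∧
      (∃ w : ℕ → ℕ, (∀ u : Fin n, w u = O.indeg u + 1) ∧ TerminalArcs n m k M w n (τ.reg 4) τ ∧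
        (∀ v, τ.mem 18 v = if v < n then k - w v else 0) ∧
        ∀ v, τ.mem 19 v = if v < n then w v - k else 0) ∧
      t ≤ 18 * M + 13 * n + 9) σ := by
  refine wp.vc_seq (wp.seq ?_)
  refine (indegLoop_spec (σ := σ.setReg 10 0) N hB (b.of_eq rfl rfl rfl rfl rfl rfl rfl rfl) hO rfl
    (fun u _ => h9 u)).mono ?_
  rintro τ t hF ⟨hw, ht⟩
  have b₁ : Base k M E U τ := (b.of_eq rfl rfl rfl rfl rfl rfl rfl rfl :
    Base k M E U (σ.setReg 10 0)).frame hF (hF.reg 15 rfl) rfl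
  have hO₁ : Bits M E U O τ := fun p hp => (congrFun (hF.mem 2 rfl) p).trans (hO p hp)
  refine wp.vc_seq (wp.seq ?_)
  refine (unitArcLoop_spec (σ := τ.setReg 10 0) hB (b₁.of_eq rfl rfl rfl rfl rfl rfl rfl rfl) hO₁
    rfl).mono ?_
  rintro ρ u hF' ⟨hU, hu⟩
  have b₂ : Base k M E U ρ := (b₁.of_eq rfl rfl rfl rfl rfl rfl rfl rfl :
    Base k M E U (τ.setReg 10 0)).frame hF' (hF'.reg 15 rfl) rfl
  refine wp.vc_seq (wp.vc_seq (wp.vc_seq (wp.vc_seq ?_)))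
  refine (terminalArcLoop_spec (σ := (((ρ.setReg 17 (ρ.reg 26)).setReg 17 (ρ.reg 26 + 1)).setReg 4
    (ρ.reg 7)).setReg 10 0) hB (b₂.of_eq rfl rfl rfl rfl rfl rfl rfl rfl) rfl b₂.r7
    (congrArg (· + 1) b₂.r26) ?_ ?_).mono ?_
  · intro v
    exact (congrFun ((hF'.mem 18 rfl).trans (hF.mem 18 rfl)) v).trans (h18 v)
  · intro v
    exact (congrFun ((hF'.mem 19 rfl).trans (hF.mem 19 rfl)) v).trans (h19 v)
  rintro π v hF'' ⟨T, h1, h2, h3, hv⟩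
  have e9 : ρ.mem 9 = τ.mem 9 := hF'.mem 9 rfl
  simp only [State.mem_setReg, e9] at T h1 h2 h3
  refine ⟨fun p hp => ?_, ⟨_, fun u => by rw [hw], T, h2, h3⟩, by omega⟩
  rw [(h1 p hp).1, (h1 p hp).2.1, (h1 p hp).2.2]
  exact hU p hp

end DSM

/-! ### Changes of orientation as flows -/

namespace DSM

open Finset Function

/-! ### Maximum flows and the re-orientation network -/

/-- Summing the excess over `R` leaves the excess of the source, by conservation. The terms inside
`R` cancel. -/
theorem IsFlow.value_eq {N : Type} [Fintype N] [DecidableEq N] {c f : N → N → ℝ} {s t : N}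
    (hf : IsFlow c s t f) {R : Finset N} (hs : s ∈ R) (ht : t ∉ R) :
    flowValue s f = ∑ x ∈ R, ∑ y ∈ Rᶜ, f x y - ∑ x ∈ R, ∑ y ∈ Rᶜ, f y x := by
  have h1 : ∑ x ∈ R, (∑ y, f x y - ∑ y, f y x) = flowValue s f := by
    rw [Finset.sum_eq_single s]
    · rfl
    · intro x hx hxs
      rw [hf.conservation x hxs (fun h => ht (h ▸ hx)), sub_self]
    · exact fun h => absurd hs h
  have h2 : ∀ g : N → ℝ, ∑ y, g y = ∑ y ∈ R, g y + ∑ y ∈ Rᶜ, g y := fun g =>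
    (sum_add_sum_compl R g).symm
  have h3 : ∑ x ∈ R, ∑ y ∈ R, f x y = ∑ x ∈ R, ∑ y ∈ R, f y x := sum_comm
  rw [← h1, sum_sub_distrib]
  simp only [h2, sum_add_distrib]
  rw [h3]
  ring

/-- A flow that saturates a cut is maximum. -/
theorem IsFlow.isMaxFlow {N : Type} [Fintype N] [DecidableEq N] {c f : N → N → ℝ} {s t : N}
    (hf : IsFlow c s t f) (R : Finset N) (hs : s ∈ R) (ht : t ∉ R)
    (hc : ∀ x ∈ R, ∀ y ∉ R, f x y = c x y) (h0 : ∀ x ∈ R, ∀ y ∉ R, f y x = 0) :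
    IsMaxFlow c s t f := by
  refine ⟨hf, fun g hg => ?_⟩
  rw [hf.value_eq hs ht, hg.value_eq hs ht]
  have h1 : ∑ x ∈ R, ∑ y ∈ Rᶜ, g x y ≤ ∑ x ∈ R, ∑ y ∈ Rᶜ, f x y :=
    sum_le_sum fun x hx => sum_le_sum fun y hy => by
      rw [hc x hx y (mem_compl.1 hy)]
      exact hg.le_capacity x y
  have h2 : ∑ x ∈ R, ∑ y ∈ Rᶜ, f y x = 0 :=
    sum_eq_zero fun x hx => sum_eq_zero fun y hy => h0 x hx y (mem_compl.1 hy)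
  have h3 : 0 ≤ ∑ x ∈ R, ∑ y ∈ Rᶜ, g y x :=
    sum_nonneg fun x _ => sum_nonneg fun y _ => hg.nonneg y x
  linarith

variable {n m : ℕ}

theorem Node.sum_eq (g : Node n m → ℝ) :
    ∑ x, g x = ∑ u, g (.vert u) + ∑ e, g (.edge e) + g .source + g .sink := by
  let φ : Fin n ⊕ Fin m ⊕ Bool ≃ Node n m :=
    { toFun := Sum.elim .vert (Sum.elim .edge fun b => if b then .source else .sink)
      invFun := fun x => match x with
        | .vert u => .inl u
        | .edge e => .inr (.inl e)
        | .source => .inr (.inr true)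
        | .sink => .inr (.inr false)
      left_inv := by rintro (u | e | _ | _) <;> rfl
      right_inv := by rintro (u | e | _ | _) <;> rfl }
  rw [← φ.sum_comp]
  simp [φ, add_assoc]

theorem Node.code_injective : Injective (Node.code : Node n m → ℕ) := by
  intro x y h
  cases x <;> cases y <;> simp only [Node.code] at h
  case vert.vert u v => rw [Fin.ext h]
  case edge.edge e f => rw [Fin.ext (by omega : (e : ℕ) = f)]
  all_goals first | rfl | omega

variable {G : Hypergraph n m}

theorem Orientation.mem_tail {O : Orientation G} {e : Fin m} {u : Fin n} :
    u ∈ O.tail e ↔ u ∈ G.edge e ∧ u ∉ O.head e := by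
  rw [Orientation.tail, mem_sdiff]

theorem Orientation.ext_head {O O' : Orientation G} (h : ∀ e, O.head e = O'.head e) : O = O' := by
  cases O
  cases O'
  simp only [mk.injEq]
  exact funext h

/-- The flow by which the orientation `O` changes into `O'`, if the amounts `sup` and `dem` at the
source and at the sink remain. -/
def changeFlow (O O' : Orientation G) (k : ℕ) (sup dem : ℕ → ℕ) : Node n m → Node n m → ℝ
  | .vert u, .edge e => if u ∈ O.tail e ∧ u ∈ O'.head e then 1 else 0
  | .edge e, .vert u => if u ∈ O.head e ∧ u ∉ O'.head e then 1 else 0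
  | .source, .vert u => ((k - (O.indeg u + 1) - sup u : ℕ) : ℝ)
  | .vert u, .sink => ((O.indeg u + 1 - k - dem u : ℕ) : ℝ)
  | _, _ => 0

/-- The conditions under which `changeFlow` is a flow. -/
structure IsChange (O O' : Orientation G) (k : ℕ) (sup dem : ℕ → ℕ) : Prop where
  sup_le : ∀ u : Fin n, sup u ≤ k - (O.indeg u + 1)
  dem_le : ∀ u : Fin n, dem u ≤ O.indeg u + 1 - k
  vert : ∀ u : Fin n, O.indeg u + (k - (O.indeg u + 1)) + dem u =
    O'.indeg u + sup u + (O.indeg u + 1 - k)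
  edge : ∀ e, (O'.head e).card = (O.head e).card

variable {O O' : Orientation G} {k : ℕ} {sup dem : ℕ → ℕ}

/-- Truncated subtraction does the case distinction of the network: `k - (indeg + 1)` on `ℕ` is the
positive part of `d - indeg`, also for `k = 0`. -/
theorem Orientation.capacity_source (O : Orientation G) (k : ℕ) (u : Fin n) :
    O.capacity ((k : ℤ) - 1) .source (.vert u) = ((k - (O.indeg u + 1) : ℕ) : ℝ) := by
  simp only [Orientation.capacity]
  split_ifs with h
  · rw [Nat.cast_sub (by omega)]
    push_cast
    ring
  · rw [Nat.sub_eq_zero_of_le (by omega), Nat.cast_zero]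

theorem Orientation.capacity_sink (O : Orientation G) (k : ℕ) (u : Fin n) :
    O.capacity ((k : ℤ) - 1) (.vert u) .sink = ((O.indeg u + 1 - k : ℕ) : ℝ) := by
  simp only [Orientation.capacity]
  split_ifs with h
  · rw [Nat.cast_sub (by omega)]
    push_cast
    ring
  · rw [Nat.sub_eq_zero_of_le (by omega), Nat.cast_zero]

/-- A vertex sends a unit to every hyperedge that gains it as a target and receives one from every
hyperedge that loses it. The difference is the change of its indegree, which is balanced against the
terminal arcs. At a hyperedge conservation says that the number of targets is unchanged. -/
theorem IsChange.isFlow (h : IsChange O O' k sup dem) :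
    IsFlow (O.capacity ((k : ℤ) - 1)) .source .sink (changeFlow O O' k sup dem) where
  nonneg x y := by
    cases x <;> cases y <;> simp only [changeFlow] <;> positivity
  le_capacity x y := by
    cases x <;> cases y
    case vert.sink u =>
      rw [Orientation.capacity_sink]
      exact Nat.cast_le.2 (Nat.sub_le _ _)
    case source.vert u =>
      rw [Orientation.capacity_source]
      exact Nat.cast_le.2 (Nat.sub_le _ _)
    all_goals
      simp only [changeFlow, Orientation.capacity]
      first
        | exact le_rfl
        | (split_ifs <;> first | (exfalso; tauto) | norm_num)
  conservation y hs ht := by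
    cases y with
    | source => exact absurd rfl hs
    | sink => exact absurd rfl ht
    | vert u =>
      rw [Node.sum_eq, Node.sum_eq]
      simp only [changeFlow, sum_const_zero, zero_add, add_zero]
      have h1 : (O'.indeg u : ℝ) = ∑ e, if u ∈ O'.head e then 1 else 0 := by
        rw [Orientation.indeg, card_filter]
        push_cast
        rfl
      have h2 : (O.indeg u : ℝ) = ∑ e, if u ∈ O.head e then 1 else 0 := by
        rw [Orientation.indeg, card_filter]
        push_cast
        rfl
      have h3 : (O'.indeg u : ℝ) + ∑ e, (if u ∈ O.head e ∧ u ∉ O'.head e then (1 : ℝ) else 0) =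
          O.indeg u + ∑ e, if u ∈ O.tail e ∧ u ∈ O'.head e then (1 : ℝ) else 0 := by
        rw [h1, h2, ← sum_add_distrib, ← sum_add_distrib]
        refine sum_congr rfl fun e _ => ?_
        have := @O'.head_subset e u
        have := @Orientation.mem_tail _ _ _ O e u
        by_cases h4 : u ∈ O.head e <;> by_cases h5 : u ∈ O'.head e <;> simp_all
      have h4 := h.sup_le u
      have h5 := h.dem_le u
      have h6 : (O.indeg u : ℝ) + (k - (O.indeg u + 1) : ℕ) + dem u =
          O'.indeg u + sup u + (O.indeg u + 1 - k : ℕ) := by exact_mod_cast h.vert u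
      rw [Nat.cast_sub h4, Nat.cast_sub h5]
      linarith
    | edge e =>
      rw [Node.sum_eq, Node.sum_eq]
      simp only [changeFlow, sum_const_zero, add_zero]
      have h1 : ((O'.head e).card : ℝ) = ∑ u, if u ∈ O'.head e then 1 else 0 := by simp
      have h2 : ((O.head e).card : ℝ) = ∑ u, if u ∈ O.head e then 1 else 0 := by simp
      have h3 : ((O'.head e).card : ℝ) +
          ∑ u, (if u ∈ O.head e ∧ u ∉ O'.head e then (1 : ℝ) else 0) =
          (O.head e).card + ∑ u, if u ∈ O.tail e ∧ u ∈ O'.head e then (1 : ℝ) else 0 := by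
        rw [h1, h2, ← sum_add_distrib, ← sum_add_distrib]
        refine sum_congr rfl fun u _ => ?_
        have := @O'.head_subset e u
        have := @Orientation.mem_tail _ _ _ O e u
        by_cases h4 : u ∈ O.head e <;> by_cases h5 : u ∈ O'.head e <;> simp_all
      have h4 : ((O'.head e).card : ℝ) = (O.head e).card := by exact_mod_cast h.edge e
      linarith

/-- If no residual path leads from a remaining supply to a remaining demand, then the flow is
maximum. -/
theorem IsChange.isMaxFlow (h : IsChange O O' k sup dem) (P : Fin n → Prop) (Q : Fin m → Prop)
    (hPQ : ∀ u e, u ∈ O'.tail e → P u → Q e) (hQP : ∀ u e, u ∈ O'.head e → Q e → P u)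
    (hsup : ∀ u : Fin n, 0 < sup u → P u) (hdem : ∀ u : Fin n, P u → dem u = 0) :
    IsMaxFlow (O.capacity ((k : ℤ) - 1)) .source .sink (changeFlow O O' k sup dem) := by
  classical
  -- The cut consists of the source and of a set closed under the residual arcs of `O'`. Hence arcs
  -- that leave it are saturated and arcs that enter it carry nothing.
  let R : Node n m → Prop := fun x => match x with
    | .vert u => P u
    | .edge e => Q e
    | .source => True
    | .sink => False
  refine h.isFlow.isMaxFlow (univ.filter R) (by simp [R]) (by simp [R]) ?_ ?_
  · intro x hx y hy
    simp only [mem_filter, mem_univ, true_and] at hx hy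
    cases x <;> cases y <;> simp only [R, not_true_eq_false, not_false_eq_true] at hx hy
    case vert.sink u =>
      rw [Orientation.capacity_sink]
      simp only [changeFlow, hdem u hx, Nat.sub_zero]
    case source.vert u =>
      rw [Orientation.capacity_source]
      have : sup u = 0 := by
        by_contra h0
        exact hy (hsup u (by omega))
      simp only [changeFlow, this, Nat.sub_zero]
    case vert.edge u e =>
      simp only [changeFlow, Orientation.capacity]
      by_cases h1 : u ∈ O.tail e
      · have h2 : u ∈ O'.head e := by
          by_contra h2
          exact hy (hPQ u e (Orientation.mem_tail.2 ⟨(Orientation.mem_tail.1 h1).1, h2⟩) hx)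
        simp [h1, h2]
      · simp [h1]
    case edge.vert e u =>
      simp only [changeFlow, Orientation.capacity]
      have h2 : u ∉ O'.head e := fun h2 => hy (hQP u e h2 hx)
      simp [h2]
    all_goals rfl
  · intro x hx y hy
    simp only [mem_filter, mem_univ, true_and] at hx hy
    cases x <;> cases y <;> simp only [R, not_true_eq_false, not_false_eq_true] at hx hy
    case vert.edge u e =>
      simp only [changeFlow]
      rw [if_neg]
      rintro ⟨h1, h2⟩
      exact hy (hPQ u e (Orientation.mem_tail.2 ⟨O.head_subset e h1, h2⟩) hx)
    case edge.vert e u =>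
      simp only [changeFlow]
      rw [if_neg]
      rintro ⟨h1, h2⟩
      exact hy (hQP u e h2 hx)
    all_goals rfl

/-- Reversing the saturated pairs of arcs turns `O` into `O'`. -/
theorem IsChange.reverseSaturated_eq (h : IsChange O O' k sup dem) :
    O.reverseSaturated ((k : ℤ) - 1) (changeFlow O O' k sup dem) = O' := by
  have hpair : ∀ x e y, O.SaturatedPair ((k : ℤ) - 1) (changeFlow O O' k sup dem) x e y ↔
      (x ∈ O.tail e ∧ x ∈ O'.head e) ∧ (y ∈ O.head e ∧ y ∉ O'.head e) := by
    intro x e y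
    unfold Orientation.SaturatedPair
    constructor
    · rintro ⟨h1, h2, h3, h4⟩
      simp only [changeFlow, Orientation.capacity, h1, h2, true_and, if_true] at h3 h4
      refine ⟨⟨h1, ?_⟩, h2, ?_⟩
      · by_contra h5
        simp [h5] at h3
      · intro h5
        simp [h5] at h4
    · rintro ⟨⟨h1, h2⟩, h3, h4⟩
      refine ⟨h1, h3, ?_, ?_⟩ <;> simp [changeFlow, Orientation.capacity, h1, h2, h3, h4]
  -- The head keeps its size, so a hyperedge gains a target exactly if it loses one. Thus every
  -- saturated unit arc has a partner and belongs to a saturated pair.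
  have hcons : ∀ e, (∃ x, x ∈ O.tail e ∧ x ∈ O'.head e) ↔ ∃ y, y ∈ O.head e ∧ y ∉ O'.head e := by
    intro e
    have h1 : ∀ x, x ∈ O'.head e → x ∉ O.head e → x ∈ O.tail e := fun x hx hx' =>
      Orientation.mem_tail.2 ⟨O'.head_subset e hx, hx'⟩
    constructor
    · rintro ⟨x, hx, hx'⟩
      by_contra! hno
      have h2 : O.head e ⊆ O'.head e := hno
      have h3 := eq_of_subset_of_card_le h2 (h.edge e).le
      rw [← h3] at hx'
      exact (Orientation.mem_tail.1 hx).2 hx'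
    · rintro ⟨y, hy, hy'⟩
      by_contra! hno
      have h2 : O'.head e ⊆ O.head e := fun x hx => by
        by_contra hx'
        exact hno x (h1 x hx hx') hx
      have h3 := eq_of_subset_of_card_le h2 (h.edge e).ge
      rw [h3] at hy'
      exact hy' hy
  refine Orientation.ext_head fun e => ?_
  ext u
  simp only [Orientation.reverseSaturated, mem_filter, hpair]
  have h1 := hcons e
  have h2 := @O'.head_subset e u
  have h3 := @O.head_subset e u
  have h4 := @Orientation.mem_tail _ _ _ O e u
  constructor
  · rintro ⟨h5, ⟨h6, h7⟩ | ⟨y, h6, h7⟩⟩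
    · by_contra h8
      obtain ⟨x, hx⟩ := h1.2 ⟨u, h6, h8⟩
      exact h7 ⟨x, hx, h6, h8⟩
    · exact h6.2
  · intro h5
    refine ⟨h2 h5, ?_⟩
    by_cases h6 : u ∈ O.head e
    · exact Or.inl ⟨h6, fun ⟨x, _, hx⟩ => hx.2 h5⟩
    · obtain ⟨y, hy⟩ := h1.1 ⟨u, h4.2 ⟨h2 h5, h6⟩, h5⟩
      exact Or.inr ⟨y, ⟨h4.2 ⟨h2 h5, h6⟩, h5⟩, hy⟩

end DSM

namespace DSM

open Finset Function

/-! ### The stored network -/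

variable {n m k M B : ℕ} {G : Hypergraph n m} {E : ℕ → Fin m} {U : ℕ → Fin n} {O : Orientation G}

/-- The arcs of the re-orientation network `O` are stored in the arrays `3`, `4`, `5`. -/
structure Network (k M : ℕ) (E : ℕ → Fin m) (U : ℕ → Fin n) (O : Orientation G) (σ : State) :
    Prop where
  unit : UnitArcs M E U O σ
  terminal : TerminalArcs n m k M
    (fun u => if h : u < n then O.indeg ⟨u, h⟩ + 1 else k) n (σ.reg 4) σ

/-- The types of the stored arcs. -/
theorem Network.cases {σ : State} (T : Network k M E U O σ) {i : ℕ} (hi : i < σ.reg 4) :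
    (i < M ∧ σ.mem 5 i = 1 ∧
      ((U i ∈ O.head (E i) ∧ σ.mem 3 i = (Node.edge (E i) : Node n m).code ∧
        σ.mem 4 i = (Node.vert (U i) : Node n m).code) ∨
      (U i ∉ O.head (E i) ∧ σ.mem 3 i = (Node.vert (U i) : Node n m).code ∧
        σ.mem 4 i = (Node.edge (E i) : Node n m).code))) ∨
    (M ≤ i ∧ ∃ u : Fin n,
      (O.indeg u + 1 < k ∧ σ.mem 3 i = (Node.source : Node n m).code ∧
        σ.mem 4 i = (Node.vert u : Node n m).code ∧ σ.mem 5 i = k - (O.indeg u + 1)) ∨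
      (k < O.indeg u + 1 ∧ σ.mem 3 i = (Node.vert u : Node n m).code ∧
        σ.mem 4 i = (Node.sink : Node n m).code ∧ σ.mem 5 i = O.indeg u + 1 - k)) := by
  rcases lt_or_ge i M with h | h
  · obtain ⟨h1, h2, h3⟩ := T.unit i h
    refine Or.inl ⟨h, h1, ?_⟩
    by_cases h4 : U i ∈ O.head (E i)
    · exact Or.inl ⟨h4, h2 h4⟩
    · exact Or.inr ⟨h4, h3 h4⟩
  · obtain ⟨u, hu, h'⟩ := T.terminal.listed i h hi
    simp only [hu, dif_pos] at h'
    exact Or.inr ⟨h, ⟨u, hu⟩, h'⟩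

theorem Network.holdsNetwork (N : Incidence G M E U) {σ : State} (T : Network k M E U O σ) :
    HoldsNetwork (O.capacity ((k : ℤ) - 1)) σ := by
  have hM := T.terminal.le
  -- Codes of vertices, hyperedges, source and sink lie in disjoint ranges. The two end codes of a
  -- unit arc therefore determine its direction and its incidence.
  have hunit : ∀ p < M, ∀ i < σ.reg 4, σ.mem 3 i = σ.mem 3 p → σ.mem 4 i = σ.mem 4 p → i = p := by
    intro p hp i hi h3 h4
    have hEi := (E i).2
    have hUi := (U i).2
    have hEp := (E p).2
    have hUp := (U p).2
    rcases T.cases (show p < σ.reg 4 by omega) with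
      ⟨-, -, ⟨a0, a1, a2⟩ | ⟨a0, a1, a2⟩⟩ | ⟨a, -⟩
    · rcases T.cases hi with ⟨h, -, ⟨b0, b1, b2⟩ | ⟨b0, b1, b2⟩⟩ |
        ⟨h, u, ⟨b0, b1, b2, b3⟩ | ⟨b0, b1, b2, b3⟩⟩ <;> simp only [Node.code] at a1 a2 b1 b2
      · exact N.inj i h p hp (Fin.ext (by omega)) (Fin.ext (by omega))
      · omega
      · omega
      · omega
    · rcases T.cases hi with ⟨h, -, ⟨b0, b1, b2⟩ | ⟨b0, b1, b2⟩⟩ |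
        ⟨h, u, ⟨b0, b1, b2, b3⟩ | ⟨b0, b1, b2, b3⟩⟩ <;> simp only [Node.code] at a1 a2 b1 b2
      · omega
      · exact N.inj i h p hp (Fin.ext (by omega)) (Fin.ext (by omega))
      · omega
      · omega
    · omega
  have hterm : ∀ p, M ≤ p → p < σ.reg 4 → ∀ i < σ.reg 4, σ.mem 3 i = σ.mem 3 p →
      σ.mem 4 i = σ.mem 4 p → i = p := by
    intro p hp hp' i hi h3 h4
    rcases lt_or_ge i M with h | h
    · exact (hunit i h p hp' h3.symm h4.symm).symm
    · exact T.terminal.inj i p h hi hp hp' h3 h4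
  constructor
  · intro x y hc
    cases x <;> cases y
    case vert.edge u e =>
      simp only [Orientation.capacity] at hc
      split_ifs at hc with h
      · rw [Orientation.mem_tail] at h
        obtain ⟨p, hp, rfl, rfl⟩ := N.surj e u h.1
        obtain ⟨-, -, h3⟩ := T.unit p hp
        obtain ⟨h3, h4⟩ := h3 h.2
        refine ⟨p, ⟨by omega, h3, h4⟩, fun i ⟨hi, h3', h4'⟩ => hunit p hp i hi ?_ ?_⟩
        · rw [h3, h3']; rfl
        · rw [h4, h4']; rfl
      · exact absurd hc (lt_irrefl _)
    case edge.vert e u =>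
      simp only [Orientation.capacity] at hc
      split_ifs at hc with h
      · obtain ⟨p, hp, rfl, rfl⟩ := N.surj e u (O.head_subset e h)
        obtain ⟨-, h3, -⟩ := T.unit p hp
        obtain ⟨h3, h4⟩ := h3 h
        refine ⟨p, ⟨by omega, h3, h4⟩, fun i ⟨hi, h3', h4'⟩ => hunit p hp i hi ?_ ?_⟩
        · rw [h3, h3']; rfl
        · rw [h4, h4']; rfl
      · exact absurd hc (lt_irrefl _)
    case source.vert u =>
      rw [Orientation.capacity_source] at hc
      have hc : 0 < k - (O.indeg u + 1) := by exact_mod_cast hc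
      obtain ⟨j, h1, h2, h3, h4⟩ := T.terminal.source u u.2 (by simp; omega)
      refine ⟨j, ⟨h2, h3, h4⟩, fun i ⟨hi, h3', h4'⟩ => hterm j h1 h2 i hi ?_ ?_⟩
      · rw [h3, h3']; rfl
      · rw [h4, h4']; rfl
    case vert.sink u =>
      rw [Orientation.capacity_sink] at hc
      have hc : 0 < O.indeg u + 1 - k := by exact_mod_cast hc
      obtain ⟨j, h1, h2, h3, h4⟩ := T.terminal.sink u u.2 (by simp; omega)
      refine ⟨j, ⟨h2, h3, h4⟩, fun i ⟨hi, h3', h4'⟩ => hterm j h1 h2 i hi ?_ ?_⟩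
      · rw [h3, h3']; rfl
      · rw [h4, h4']; rfl
    all_goals
      simp only [Orientation.capacity] at hc
      exact absurd hc (lt_irrefl _)
  · intro i hi
    rcases T.cases hi with ⟨h, h5, ⟨b0, b1, b2⟩ | ⟨b0, b1, b2⟩⟩ |
        ⟨h, u, ⟨b0, b1, b2, b3⟩ | ⟨b0, b1, b2, b3⟩⟩
    · refine ⟨_, _, ?_, b1, b2, ?_⟩ <;> simp [Orientation.capacity, b0, h5]
    · have : U i ∈ O.tail (E i) := Orientation.mem_tail.2 ⟨N.mem i h, b0⟩
      refine ⟨_, _, ?_, b1, b2, ?_⟩ <;> simp [Orientation.capacity, this, h5]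
    · refine ⟨_, _, ?_, b1, b2, ?_⟩
      · rw [Orientation.capacity_source]
        exact_mod_cast (by omega : 0 < k - (O.indeg u + 1))
      · rw [Orientation.capacity_source, b3]
    · refine ⟨_, _, ?_, b1, b2, ?_⟩
      · rw [Orientation.capacity_sink]
        exact_mod_cast (by omega : 0 < O.indeg u + 1 - k)
      · rw [Orientation.capacity_sink, b3]

theorem Network.of_eq {σ τ : State} (T : Network k M E U O σ) (h : τ.reg 4 = σ.reg 4)
    (h3 : τ.mem 3 = σ.mem 3) (h4 : τ.mem 4 = σ.mem 4) (h5 : τ.mem 5 = σ.mem 5) :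
    Network k M E U O τ := by
  refine ⟨fun p hp => ?_, ?_⟩
  · rw [h3, h4, h5]
    exact T.unit p hp
  · rw [h]
    obtain ⟨t1, t2, t3, t4, t5, t6⟩ := T.terminal
    constructor <;> simpa only [h3, h4, h5]

/-- Array `6` holds the flow that changes `O` into `O'`. -/
theorem Network.holdsFlow {σ : State} (T : Network k M E U O σ) (N : Incidence G M E U)
    {O' : Orientation G} {sup dem : ℕ → ℕ}
    (hunit : ∀ p < M, σ.mem 6 p =
      if (U p ∈ O.head (E p) ↔ U p ∈ O'.head (E p)) then 0 else 1)
    (hterm : ∀ j, M ≤ j → j < σ.reg 4 → ∀ u : Fin n,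
      (σ.mem 3 j = u → σ.mem 6 j = σ.mem 5 j - dem u) ∧
      (σ.mem 3 j = n + m → σ.mem 4 j = u → σ.mem 6 j = σ.mem 5 j - sup u)) :
    HoldsFlow (changeFlow O O' k sup dem) σ := by
  intro i hi x y hx hy
  rcases T.cases hi with ⟨h, h5, ⟨b0, b1, b2⟩ | ⟨b0, b1, b2⟩⟩ |
      ⟨h, u, ⟨b0, b1, b2, b3⟩ | ⟨b0, b1, b2, b3⟩⟩
  all_goals
    obtain rfl := Node.code_injective (hx.symm.trans b1)
    obtain rfl := Node.code_injective (hy.symm.trans b2)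
  · rw [hunit i h]
    simp only [changeFlow, b0, true_and, true_iff]
    split_ifs <;> simp
  · have : U i ∈ O.tail (E i) := Orientation.mem_tail.2 ⟨N.mem i h, b0⟩
    rw [hunit i h]
    simp only [changeFlow, b0, this, true_and, false_iff]
    split_ifs <;> simp
  · rw [(hterm i h hi u).2 b1 b2, b3]
    rfl
  · rw [(hterm i h hi u).1 b1, b3]
    rfl

end DSM

/-! ### Residual arcs as orientations, and the last three parts of the algorithm -/

namespace DSM

open Finset Function

/-! ### The program that builds the arc list -/

/-- The first `K` arcs have been inserted into the lists of their start nodes. -/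
structure Linked (K : ℕ) (own nxt head : ℕ → ℕ) : Prop where
  nxt_le : ∀ h < K, nxt h ≤ h
  nxt_own : ∀ h < K, nxt h ≠ 0 → own (nxt h - 1) = own h
  nxt_gap : ∀ h < K, ∀ g, nxt h ≤ g → g < h → own g ≠ own h
  head_le : ∀ x, head x ≤ K
  head_own : ∀ x, head x ≠ 0 → own (head x - 1) = x
  lt_head : ∀ h < K, h < head (own h)

/-- The new arc `K` is put in front of the list of `x`. Every older arc of `x` lies below `head x`,
so none lies between the old head and `K`, as `nxt_gap` requires. -/
theorem Linked.add {K : ℕ} {own nxt head : ℕ → ℕ} (l : Linked K own nxt head) (x : ℕ) :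
    Linked (K + 1) (update own K x) (update nxt K (head x)) (update head x (K + 1)) := by
  have hown : ∀ h < K, update own K x h = own h := fun h hh => update_of_ne hh.ne _ _
  have hnxt : ∀ h < K, update nxt K (head x) h = nxt h := fun h hh => update_of_ne hh.ne _ _
  have hx := l.head_le x
  constructor
  · intro h hh
    rcases Nat.lt_succ_iff_lt_or_eq.1 hh with h' | rfl
    · rw [hnxt h h']; exact l.nxt_le h h'
    · rwa [update_self]
  · intro h hh hne
    rcases Nat.lt_succ_iff_lt_or_eq.1 hh with h' | rfl
    · rw [hnxt h h'] at hne ⊢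
      have := l.nxt_le h h'
      rw [hown _ (by omega), hown h h']
      exact l.nxt_own h h' hne
    · rw [update_self] at hne ⊢
      rw [update_self, hown _ (by omega)]
      exact l.head_own x hne
  · intro h hh g hg hgh
    rcases Nat.lt_succ_iff_lt_or_eq.1 hh with h' | rfl
    · rw [hnxt h h'] at hg
      rw [hown g (by omega), hown h h']
      exact l.nxt_gap h h' g hg hgh
    · rw [update_self] at hg
      rw [update_self, hown g hgh]
      rintro rfl
      have := l.lt_head g hgh
      omega
  · intro y
    have := l.head_le y
    rw [update_apply]
    split_ifs <;> omega
  · intro y hy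
    have := l.head_le y
    by_cases e : y = x
    · simp [e]
    · rw [update_of_ne e] at hy ⊢
      rw [hown _ (by omega)]
      exact l.head_own y hy
  · intro h hh
    rcases Nat.lt_succ_iff_lt_or_eq.1 hh with h' | rfl
    · rw [hown h h', update_apply]
      have := l.lt_head h h'
      split_ifs <;> omega
    · simp

/-- Store the arcs `2 p` and `2 p + 1` that belong to the incidences `p`. -/
def buildLoop : Prog :=
  .whileLt 10 7 (.load 11 1 10 ;; .load 12 8 10 ;; .load 13 2 10 ;; .copy 14 6 ;; .inc 14 ;;
    .sub 16 15 13 ;;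
    .store 10 6 11 ;; .store 10 14 12 ;; .store 11 6 14 ;; .store 11 14 6 ;;
    .store 14 6 16 ;; .store 14 14 13 ;;
    .load 16 13 11 ;; .store 12 6 16 ;; .store 13 11 14 ;;
    .load 16 13 12 ;; .store 12 14 16 ;; .inc 14 ;; .store 13 12 14 ;; .copy 6 14 ;; .inc 10)

variable {n m k M B : ℕ} {G : Hypergraph n m} {E : ℕ → Fin m} {U : ℕ → Fin n} {O : Orientation G}

/-- The arcs `2 p` and `2 p + 1` join the vertex and the hyperedge of the incidence `p`. -/
structure ArcPairs (M : ℕ) (E : ℕ → Fin m) (U : ℕ → Fin n) (σ : State) : Prop where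
  own_even : ∀ p < M, σ.mem 10 (2 * p) = U p
  own_odd : ∀ p < M, σ.mem 10 (2 * p + 1) = n + E p
  tw_even : ∀ p < M, σ.mem 11 (2 * p) = 2 * p + 1
  tw_odd : ∀ p < M, σ.mem 11 (2 * p + 1) = 2 * p

/-- The even arc leads from the vertex to the hyperedge and is residual if the vertex is a source;
the odd arc leads back and is residual if it is a target. -/
theorem buildLoop_spec {σ : State} (hB : 2 * M + n + m + 2 ≤ B) (b : Base k M E U σ)
    (h10 : σ.reg 10 = 0) (h6 : σ.reg 6 = 0) (hhead : ∀ x, σ.mem 13 x = 0) :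
    wp B buildLoop (fun τ t => Linked (2 * M) (τ.mem 10) (τ.mem 12) (τ.mem 13) ∧
      ArcPairs M E U τ ∧ τ.reg 6 = 2 * M ∧
      (∀ p < M, τ.mem 14 (2 * p) = 1 - σ.mem 2 p ∧ τ.mem 14 (2 * p + 1) = σ.mem 2 p) ∧
      t ≤ 22 * M + 1) σ := by
  refine (wp.while (I := fun τ => τ.reg 10 ≤ M ∧ τ.reg 6 = 2 * τ.reg 10 ∧
      Linked (2 * τ.reg 10) (τ.mem 10) (τ.mem 12) (τ.mem 13) ∧ ArcPairs (τ.reg 10) E U τ ∧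
      ∀ p < τ.reg 10, τ.mem 14 (2 * p) = 1 - σ.mem 2 p ∧ τ.mem 14 (2 * p + 1) = σ.mem 2 p)
    (Φ := fun τ => 22 * (M - τ.reg 10)) ?_ ?_).mono ?_
  · rw [h10, h6]
    refine ⟨Nat.zero_le _, rfl, ?_, ?_, ?_⟩
    · constructor <;> intros <;> simp_all
    · constructor <;> intros <;> omega
    · intros
      omega
  · rintro τ hF ⟨i1, i2, l, a, i5⟩ hlt
    have b' := b.frame hF (hF.reg 15 rfl) rfl
    rw [b'.r7] at hlt
    have hu := (U (τ.reg 10)).2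
    have he := (E (τ.reg 10)).2
    have e2 := hF.mem 2 rfl
    have hl := (l.add (U (τ.reg 10))).add (n + E (τ.reg 10))
    have hext : ∀ (f : ℕ → ℕ) (x y : ℕ) (F F' : ℕ → ℕ),
        (∀ p < τ.reg 10, f (2 * p) = F p) → (∀ p < τ.reg 10, f (2 * p + 1) = F' p) →
        x = F (τ.reg 10) → y = F' (τ.reg 10) →
        (∀ p < τ.reg 10 + 1,
          update (update f (2 * τ.reg 10) x) (2 * τ.reg 10 + 1) y (2 * p) = F p) ∧
        ∀ p < τ.reg 10 + 1,
          update (update f (2 * τ.reg 10) x) (2 * τ.reg 10 + 1) y (2 * p + 1) = F' p := by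
      intro f x y F F' hf hf' hx hy
      constructor
      · intro p hp
        rw [update_of_ne (by omega)]
        rcases Nat.lt_succ_iff_lt_or_eq.1 hp with h | rfl
        · rw [update_of_ne (by omega), hf p h]
        · rw [update_self, hx]
      · intro p hp
        rcases Nat.lt_succ_iff_lt_or_eq.1 hp with h | rfl
        · rw [update_of_ne (by omega), update_of_ne (by omega), hf' p h]
        · rw [update_self, hy]
    obtain ⟨a1, a2⟩ := hext _ _ _ (fun p => U p) (fun p => n + E p) a.own_even a.own_odd rfl rfl
    obtain ⟨a3, a4⟩ := hext _ _ _ (fun p => 2 * p + 1) (fun p => 2 * p) a.tw_even a.tw_odd rfl rfl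
    obtain ⟨a5, a6⟩ := hext (τ.mem 14) _ _ (fun p => 1 - σ.mem 2 p) (fun p => σ.mem 2 p)
      (fun p hp => (i5 p hp).1) (fun p hp => (i5 p hp).2) rfl rfl
    apply wp.of_vc
    simp only [vc, numArrays, State.reg_setReg, State.mem_setReg, State.reg_touch,
      State.mem_touch, State.mem_setMem, State.reg_setMem, b'.r15, b'.vert _ hlt, b'.edge _ hlt, e2,
      i2, Nat.reduceEqDiff, Nat.reduceLT, reduceIte, true_and]
    refine ⟨by omega, by omega, by omega, by omega, by omega, by omega, by omega, by omega, by omega,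
      by omega, by omega, by omega, by omega, by omega, by omega, ⟨by omega, by omega, hl,
      ⟨a1, a2, a3, a4⟩, fun p hp => ⟨a5 p hp, a6 p hp⟩⟩, by omega⟩
  · rintro τ t hF ⟨⟨i1, i2, l, a, i5⟩, hlt, ht⟩
    rw [hF.reg 7 rfl, b.r7] at hlt
    have e : τ.reg 10 = M := by omega
    rw [e] at l a i5 i2
    exact ⟨l, a, i2, i5, by rw [h10] at ht; omega⟩

theorem ArcPairs.frame {σ τ : State} {P : Prog} (a : ArcPairs M E U σ) (hF : Frame P σ τ)
    (h : (P.setsMem 10 || P.setsMem 11) = false) : ArcPairs M E U τ := by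
  simp only [Bool.or_eq_false_iff] at h
  obtain ⟨h1, h2, h3, h4⟩ := a
  constructor <;> simpa only [hF.mem 10 h.1, hF.mem 11 h.2]

theorem even_or_odd_of_lt {h : ℕ} (hh : h < 2 * M) : ∃ p < M, h = 2 * p ∨ h = 2 * p + 1 :=
  ⟨h / 2, by omega, by omega⟩

theorem ArcPairs.rep {σ : State} (hB : 2 * M + n + m + 2 ≤ B) (a : ArcPairs M E U σ)
    (l : Linked (2 * M) (σ.mem 10) (σ.mem 12) (σ.mem 13)) (h5 : σ.reg 5 = 0)
    (h6 : σ.reg 6 = 2 * M) : Rep (2 * M) B σ where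
  zero := h5
  size := h6
  lt := by omega
  own_lt h hh := by
    obtain ⟨p, hp, rfl | rfl⟩ := even_or_odd_of_lt hh
    · rw [a.own_even p hp]
      have := (U p).2
      omega
    · rw [a.own_odd p hp]
      have := (E p).2
      omega
  arcs :=
    { tw_lt := fun h hh => by
        obtain ⟨p, hp, rfl | rfl⟩ := even_or_odd_of_lt hh
        · rw [a.tw_even p hp]; omega
        · rw [a.tw_odd p hp]; omega
      tw_tw := fun h hh => by
        obtain ⟨p, hp, rfl | rfl⟩ := even_or_odd_of_lt hh
        · rw [a.tw_even p hp, a.tw_odd p hp]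
        · rw [a.tw_odd p hp, a.tw_even p hp]
      nxt_le := l.nxt_le
      nxt_own := l.nxt_own
      nxt_gap := l.nxt_gap
      head_le := fun h _ => l.head_le _
      head_own := fun h hh => l.head_own _ (by have := l.lt_head h hh; omega)
      lt_head := l.lt_head }

end DSM

namespace DSM

open Finset Function

/-! ### Residual arcs and orientations -/

variable {n m k M B : ℕ} {G : Hypergraph n m} {E : ℕ → Fin m} {U : ℕ → Fin n}
  {O O' : Orientation G}

theorem sum_range_two_mul (f : ℕ → ℕ) (M : ℕ) :
    ∑ h ∈ range (2 * M), f h = ∑ p ∈ range M, (f (2 * p) + f (2 * p + 1)) := by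
  induction M with
  | zero => rfl
  | succ M ih => rw [Nat.mul_succ, sum_range_succ, sum_range_succ, sum_range_succ, ih, add_assoc]

theorem Incidence.card_head (N : Incidence G M E U) (O : Orientation G) (e : Fin m) :
    (O.head e).card = #{p ∈ range M | E p = e ∧ U p ∈ O.head (E p)} := by
  symm
  refine card_nbij U ?_ ?_ ?_
  · intro p hp
    simp only [coe_filter, mem_range, Set.mem_ofPred_eq] at hp
    rw [← hp.2.1]
    exact hp.2.2
  · intro p hp q hq h
    simp only [coe_filter, mem_range, Set.mem_ofPred_eq] at hp hq
    exact N.inj p hp.1 q hq.1 (by rw [hp.2.1, hq.2.1]) h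
  · intro u hu
    obtain ⟨p, hp, h1, h2⟩ := N.surj e u (O.head_subset e hu)
    refine ⟨p, ?_, h2⟩
    simp only [coe_filter, mem_range, Set.mem_ofPred_eq]
    exact ⟨hp, h1, by rw [h1, h2]; exact hu⟩

theorem Incidence.exists_orientation (N : Incidence G M E U) (f : ℕ → Prop) :
    ∃ O : Orientation G, ∀ p < M, U p ∈ O.head (E p) ↔ f p := by
  classical
  refine ⟨⟨fun e => (G.edge e).filter fun u => ∃ p < M, E p = e ∧ U p = u ∧ f p,
    fun e => filter_subset _ _⟩, fun p hp => ?_⟩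
  simp only [mem_filter]
  constructor
  · rintro ⟨-, q, hq, h1, h2, h3⟩
    rwa [← N.inj q hq p hp h1 h2]
  · exact fun h => ⟨N.mem p hp, p, hp, rfl, rfl, h⟩

/-- The residual arcs are those of the orientation `O`: from sources to hyperedges and from
hyperedges to targets. -/
def Marks (M : ℕ) (E : ℕ → Fin m) (U : ℕ → Fin n) (O : Orientation G) (res : ℕ → ℕ) : Prop :=
  ∀ p < M, res (2 * p) = (if U p ∈ O.head (E p) then 0 else 1) ∧
    res (2 * p + 1) = if U p ∈ O.head (E p) then 1 else 0

/-- A state in which one of any two opposite arcs is residual is the residual state of an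
orientation. This is how the result of the augmentations becomes the orientation `O'`. -/
theorem Incidence.exists_marks (N : Incidence G M E U) {res : ℕ → ℕ}
    (h : ∀ p < M, res (2 * p) + res (2 * p + 1) = 1) :
    ∃ O : Orientation G, Marks M E U O res := by
  obtain ⟨O, hO⟩ := N.exists_orientation fun p => res (2 * p + 1) = 1
  refine ⟨O, fun p hp => ?_⟩
  have h1 := hO p hp
  have h2 := h p hp
  split_ifs with h3
  · have := h1.1 h3
    omega
  · have : res (2 * p + 1) ≠ 1 := fun h4 => h3 (h1.2 h4)
    omega

/-- The residual arcs that leave a vertex are the incidences in which it is a source, so together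
with its indegree they make up its degree, which does not depend on the orientation. -/
theorem Marks.outdeg_vert {res : ℕ → ℕ} {σ : State} (a : ArcPairs M E U σ) (N : Incidence G M E U)
    (hres : Marks M E U O res) (u : Fin n) :
    outdeg (2 * M) (σ.mem 10) res u + O.indeg u = #{p ∈ range M | U p = u} := by
  unfold outdeg
  rw [sum_range_two_mul, N.indeg_eq, card_filter, card_filter, ← sum_add_distrib]
  refine sum_congr rfl fun p hp => ?_
  rw [mem_range] at hp
  obtain ⟨h1, h2⟩ := hres p hp
  have hu := u.2
  rw [a.own_even p hp, a.own_odd p hp, h1, if_neg (show n + (E p : ℕ) ≠ u by omega)]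
  by_cases h3 : U p = u
  · by_cases h4 : U p ∈ O.head (E p) <;> simp [← h3, h4]
  · simp [h3, Fin.val_inj]

theorem Marks.outdeg_edge {res : ℕ → ℕ} {σ : State} (a : ArcPairs M E U σ) (N : Incidence G M E U)
    (hres : Marks M E U O res) (e : Fin m) :
    outdeg (2 * M) (σ.mem 10) res (n + e) = (O.head e).card := by
  unfold outdeg
  rw [sum_range_two_mul, N.card_head, card_filter]
  refine sum_congr rfl fun p hp => ?_
  rw [mem_range] at hp
  obtain ⟨h1, h2⟩ := hres p hp
  have hu := (U p).2
  rw [a.own_even p hp, a.own_odd p hp, h2, if_neg (show (U p : ℕ) ≠ n + e by omega)]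
  by_cases h3 : E p = e
  · by_cases h4 : U p ∈ O.head (E p) <;> simp [← h3, h4]
  · simp [h3, Fin.val_inj]

/-- `balance` at a vertex turns into the balance of indegrees, as outdegree and indegree have a
constant sum. At a hyperedge there is neither supply nor demand, so its outdegree, the number of
targets, is preserved. -/
theorem IsResidual.isChange {res₀ sup₀ dem₀ res sup dem tw : ℕ → ℕ} {σ : State}
    (a : ArcPairs M E U σ) (N : Incidence G M E U)
    (F : IsResidual (2 * M) (σ.mem 10) tw res₀ sup₀ dem₀ res sup dem)
    (h₀ : Marks M E U O res₀) (h : Marks M E U O' res)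
    (hs : ∀ u : Fin n, sup₀ u = k - (O.indeg u + 1)) (hd : ∀ u : Fin n, dem₀ u = O.indeg u + 1 - k)
    (hs' : ∀ e : Fin m, sup₀ (n + e) = 0) (hd' : ∀ e : Fin m, dem₀ (n + e) = 0) :
    IsChange O O' k sup dem where
  sup_le u := hs u ▸ F.sup_le u
  dem_le u := hd u ▸ F.dem_le u
  vert u := by
    have h1 := F.balance u
    have h2 := h₀.outdeg_vert a N u
    have h3 := h.outdeg_vert a N u
    have h4 := hs u
    have h5 := hd u
    omega
  edge e := by
    have h1 := F.balance (n + e)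
    have h2 := h₀.outdeg_edge a N e
    have h3 := h.outdeg_edge a N e
    have h4 := hs' e
    have h5 := hd' e
    have h6 := F.sup_le (n + e)
    have h7 := F.dem_le (n + e)
    omega

/-- The cut consists of the visited nodes. `IsLevel` speaks only of nodes at which an arc starts, so
a vertex that lies in no hyperedge belongs to the cut exactly if it has supply. -/
theorem IsChange.isMaxFlow_of_level {res sup dem lev : ℕ → ℕ} {σ : State}
    (a : ArcPairs M E U σ) (N : Incidence G M E U) (C : IsChange O O' k sup dem)
    (h : Marks M E U O' res) (L : IsLevel (2 * M) (σ.mem 10) (σ.mem 11) sup res lev)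
    (hex : ∀ v, sup v = 0 ∨ dem v = 0)
    (hdem : ∀ h < 2 * M, 0 < lev (σ.mem 10 h) → dem (σ.mem 10 h) = 0) :
    IsMaxFlow (O.capacity ((k : ℤ) - 1)) .source .sink (changeFlow O O' k sup dem) := by
  refine C.isMaxFlow (fun u => 0 < sup u ∨ (0 < lev u ∧ ∃ p < M, U p = u))
    (fun e => 0 < lev (n + e)) ?_ ?_ (fun u => Or.inl) ?_
  · intro u e hu hP
    rw [Orientation.mem_tail] at hu
    obtain ⟨p, hp, rfl, rfl⟩ := N.surj e u hu.1
    have h1 := L.step (2 * p) (by omega)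
    have h2 := L.seed (2 * p) (by omega)
    rw [a.own_even p hp] at h1 h2
    rw [a.tw_even p hp, a.own_odd p hp, (h p hp).1, if_neg hu.2] at h1
    refine (h1 rfl ?_).1
    rcases hP with hP | hP
    · rw [h2 hP]
      exact one_pos
    · exact hP.1
  · intro u e hu hQ
    obtain ⟨p, hp, rfl, rfl⟩ := N.surj e u (O'.head_subset e hu)
    have h1 := L.step (2 * p + 1) (by omega)
    rw [a.own_odd p hp, a.tw_odd p hp, a.own_even p hp, (h p hp).2, if_pos hu] at h1
    exact Or.inr ⟨(h1 rfl hQ).1, p, hp, rfl⟩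
  · rintro u (hP | ⟨hP, p, hp, rfl⟩)
    · exact (hex u).resolve_left (by omega)
    · have h1 := hdem (2 * p) (by omega)
      rw [a.own_even p hp] at h1
      exact h1 hP

/-- The vertices that can reach a vertex of indegree at least `k`, by means of a search in the
reversed residual digraph. -/
theorem mem_denseSet_iff {sup res lev : ℕ → ℕ} {σ : State} (a : ArcPairs M E U σ)
    (N : Incidence G M E U) (h : Marks M E U O fun h => 1 - res h)
    (hres : ∀ h < 2 * M, res h ≤ 1)
    (L : IsLevel (2 * M) (σ.mem 10) (σ.mem 11) sup res lev)
    (hsup : ∀ u : Fin n, 0 < sup u ↔ k ≤ O.indeg u) (hsup' : ∀ e : Fin m, sup (n + e) = 0)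
    (u : Fin n) :
    u ∈ O.denseSet k ↔ k ≤ O.indeg u ∨ (0 < lev u ∧ ∃ p < M, U p = u) := by
  have hmem : ∀ u, u ∈ O.denseSet k ↔ ∃ w, k ≤ O.indeg w ∧ O.Reaches u w := by
    intro u
    constructor
    · rintro (hu | hu)
      · exact ⟨u, hu, Relation.ReflTransGen.refl⟩
      · exact hu
    · exact Or.inr
  have hhead : ∀ p < M, U p ∈ O.head (E p) → res (2 * p) = 1 ∧ res (2 * p + 1) = 0 := by
    intro p hp hh
    obtain ⟨h1, h2⟩ := h p hp
    dsimp only at h1 h2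
    rw [if_pos hh] at h1 h2
    have := hres (2 * p) (by omega)
    have := hres (2 * p + 1) (by omega)
    omega
  have htail : ∀ p < M, U p ∉ O.head (E p) → res (2 * p) = 0 ∧ res (2 * p + 1) = 1 := by
    intro p hp hh
    obtain ⟨h1, h2⟩ := h p hp
    dsimp only at h1 h2
    rw [if_neg hh] at h1 h2
    have := hres (2 * p) (by omega)
    have := hres (2 * p + 1) (by omega)
    omega
  constructor
  · intro hu
    obtain ⟨w, hw, hr⟩ := (hmem u).1 hu
    clear hu
    -- A step from `x` to `y` through `e` gives the arcs from `y` to `e` and from `e` to `x` in the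
    -- digraph that is searched. So the visit spreads from `y` back to `x`.
    induction hr using Relation.ReflTransGen.head_induction_on with
    | refl => exact Or.inl hw
    | head hxy hyw ih =>
      rename_i x y
      right
      obtain ⟨e, hx, hy⟩ := hxy
      obtain ⟨p, hp, h1, h2⟩ := N.surj e y (O.head_subset e hy)
      rw [Orientation.mem_tail] at hx
      obtain ⟨q, hq, h3, h4⟩ := N.surj e x hx.1
      have s1 := L.step (2 * p) (by omega) (hhead p hp (by rwa [h1, h2])).1
      have s2 := L.step (2 * q + 1) (by omega) (htail q hq (by rw [h3, h4]; exact hx.2)).2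
      have s3 := L.seed (2 * p) (by omega)
      rw [a.own_even p hp, h2] at s1 s3
      rw [a.tw_even p hp, a.own_odd p hp, h1] at s1
      rw [a.tw_odd q hq, a.own_odd q hq, a.own_even q hq, h3, h4] at s2
      refine ⟨(s2 (s1 ?_).1).1, q, hq, h4⟩
      rcases ih with ih | ih
      · rw [s3 ((hsup y).2 ih)]
        exact one_pos
      · exact ih.1
  · rintro (hu | ⟨hl, p, hp, rfl⟩)
    · exact Or.inl hu
    -- Conversely, by induction on the level: a visited vertex of level above one was reached from a
    -- hyperedge of which it is a source, and a visited hyperedge from one of its targets. Both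
    -- kinds of nodes are treated together because they alternate.
    have key : ∀ l, (∀ p < M, lev (U p) = l → 0 < l → U p ∈ O.denseSet k) ∧
        ∀ p < M, lev (n + E p) = l → 0 < l → ∃ w ∈ O.head (E p), w ∈ O.denseSet k := by
      intro l
      induction l with
      | zero => exact ⟨fun _ _ _ h => absurd h (lt_irrefl _), fun _ _ _ h => absurd h (lt_irrefl _)⟩
      | succ l ih =>
        constructor
        · intro p hp hl _
          rcases L.reason (2 * p) (by omega) (by rw [a.own_even p hp]; omega) with
            ⟨-, hs⟩ | ⟨g, hg, hr, h1, h2, h3⟩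
          · rw [a.own_even p hp, hsup] at hs
            exact Or.inl hs
          · obtain ⟨q, hq, rfl | rfl⟩ := even_or_odd_of_lt hg
            · have := (U p).2
              rw [a.tw_even q hq, a.own_odd q hq, a.own_even p hp] at h1
              omega
            · rw [a.tw_odd q hq, a.own_even q hq, a.own_even p hp] at h1
              rw [a.own_odd q hq] at h2 h3
              rw [a.own_even p hp] at h2
              obtain ⟨w, hw, hw'⟩ := ih.2 q hq (by omega) (by omega)
              obtain ⟨z, hz, hz'⟩ := (hmem w).1 hw'
              have hne : U q ∉ O.head (E q) := fun hh => by
                have := (hhead q hq hh).2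
                omega
              rw [← Fin.ext h1]
              exact (hmem _).2 ⟨z, hz, hz'.head
                ⟨E q, Orientation.mem_tail.2 ⟨N.mem q hq, hne⟩, hw⟩⟩
        · intro p hp hl _
          rcases L.reason (2 * p + 1) (by omega) (by rw [a.own_odd p hp]; omega) with
            ⟨-, hs⟩ | ⟨g, hg, hr, h1, h2, h3⟩
          · rw [a.own_odd p hp, hsup'] at hs
            exact absurd hs (lt_irrefl _)
          · obtain ⟨q, hq, rfl | rfl⟩ := even_or_odd_of_lt hg
            · rw [a.tw_even q hq, a.own_odd q hq, a.own_odd p hp] at h1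
              rw [a.own_even q hq] at h2 h3
              rw [a.own_odd p hp] at h2
              have hd := ih.1 q hq (by omega) (by omega)
              have he : E q = E p := Fin.ext (by omega)
              refine ⟨U q, ?_, hd⟩
              by_contra hh
              rw [← he] at hh
              have := (htail q hq hh).1
              omega
            · have := (U q).2
              rw [a.tw_odd q hq, a.own_even q hq, a.own_odd p hp] at h1
              omega
    exact (key _).1 p hp rfl hl

end DSM

namespace DSM

open Finset Function

/-! ### The program for the maximum flow -/

/-- Compute the flow on the arcs between vertices and hyperedges. -/
def unitFlowLoop : Prog :=
  .whileLt 10 7 (.load 11 2 10 ;; .load 12 14 14 ;; .sub 13 11 12 ;;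
    .ifLt 11 12 (.copy 13 15) skip ;; .store 6 10 13 ;; .inc 14 ;; .inc 14 ;; .inc 10)

/-- Compute the flow on the arcs at the source and the sink. -/
def terminalFlowLoop : Prog :=
  .whileLt 10 4 (.load 11 3 10 ;; .load 13 5 10 ;;
    .ifLt 11 26 (.load 12 19 11) (.load 11 4 10 ;; .load 12 18 11) ;;
    .sub 13 13 12 ;; .store 6 10 13 ;; .inc 10)

/-- Compute a maximum flow. -/
def maxFlowProg : Prog :=
  .const 10 0 ;; .const 6 0 ;; buildLoop ;; augmentLoop ;; .const 15 1 ;; .const 10 0 ;;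
    .const 14 1 ;; unitFlowLoop ;; terminalFlowLoop

variable {n m k M B : ℕ} {G : Hypergraph n m} {E : ℕ → Fin m} {U : ℕ → Fin n}
  {O O' : Orientation G}

/-- The flow on a unit arc is the absolute difference of the old and the new orientation bit.
Truncated subtraction gives one sign, and the test supplies the other. -/
theorem unitFlowLoop_spec {σ : State} (hB : 2 * M + n + m + 2 ≤ B) (b : Base k M E U σ)
    (hO : Bits M E U O σ) (h : Marks M E U O' (σ.mem 14)) (h10 : σ.reg 10 = 0)
    (h14 : σ.reg 14 = 1) :
    wp B unitFlowLoop (fun τ t => (∀ p < M, τ.mem 6 p =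
      if (U p ∈ O.head (E p) ↔ U p ∈ O'.head (E p)) then 0 else 1) ∧ τ.reg 10 = M ∧
      t ≤ 10 * M + 1) σ := by
  refine (wp.while (I := fun τ => τ.reg 10 ≤ M ∧ τ.reg 14 = 2 * τ.reg 10 + 1 ∧
      ∀ p < τ.reg 10, τ.mem 6 p =
        if (U p ∈ O.head (E p) ↔ U p ∈ O'.head (E p)) then 0 else 1)
    (Φ := fun τ => 10 * (M - τ.reg 10)) ?_ ?_).mono ?_
  · simp [h10, h14]
  · rintro τ hF ⟨i1, i2, i3⟩ hlt
    have b' := b.frame hF (hF.reg 15 rfl) rfl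
    rw [b'.r7] at hlt
    have e2 : τ.mem 2 (τ.reg 10) = _ := (congrFun (hF.mem 2 rfl) _).trans (hO _ hlt)
    have e14 : τ.mem 14 (τ.reg 14) = _ :=
      (congrFun (hF.mem 14 rfl) _).trans ((congrArg _ i2).trans (h _ hlt).2)
    have hext : ∀ v, v = (if (U (τ.reg 10) ∈ O.head (E (τ.reg 10)) ↔
        U (τ.reg 10) ∈ O'.head (E (τ.reg 10))) then 0 else 1) →
        ∀ p < τ.reg 10 + 1, update (τ.mem 6) (τ.reg 10) v p =
          if (U p ∈ O.head (E p) ↔ U p ∈ O'.head (E p)) then 0 else 1 := by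
      rintro v rfl p hp
      rcases Nat.lt_succ_iff_lt_or_eq.1 hp with hp | rfl
      · rw [update_of_ne hp.ne, i3 p hp]
      · rw [update_self]
    apply wp.of_vc
    simp only [vc, numArrays, skip, State.reg_setReg, State.mem_setReg, State.reg_touch,
      State.mem_touch, State.mem_setMem, State.reg_setMem, b'.r15, e2, e14,
      Nat.reduceEqDiff, Nat.reduceLT, reduceIte, true_and]
    refine ⟨by omega, by omega, fun hc => ⟨by omega, ⟨by omega, by omega, hext _ ?_⟩, by omega⟩,
      fun hc => ⟨by omega, ⟨by omega, by omega, hext _ ?_⟩, by omega⟩⟩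
    all_goals
      revert hc
      by_cases h1 : U (τ.reg 10) ∈ O.head (E (τ.reg 10)) <;>
      by_cases h2 : U (τ.reg 10) ∈ O'.head (E (τ.reg 10)) <;> simp [h1, h2]
  · rintro τ t hF ⟨⟨i1, i2, i3⟩, hlt, ht⟩
    rw [hF.reg 7 rfl, b.r7] at hlt
    have e : τ.reg 10 = M := by omega
    rw [e] at i3
    exact ⟨i3, e, by rw [h10] at ht; omega⟩

/-- The flow on a terminal arc is its capacity minus the supply or demand that remains. A start code
less than `n + m` means an arc to the sink, since the only other start node is the source. -/
theorem terminalFlowLoop_spec {σ : State} (hB : 2 * M + n + m + 2 ≤ B)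
    (b : Base k M E U σ) (T : Network k M E U O σ) (h10 : σ.reg 10 = M) :
    wp B terminalFlowLoop (fun τ t => (∀ p < M, τ.mem 6 p = σ.mem 6 p) ∧
      (∀ j, M ≤ j → j < σ.reg 4 → ∀ u : Fin n,
        (σ.mem 3 j = u → τ.mem 6 j = σ.mem 5 j - σ.mem 19 u) ∧
        (σ.mem 3 j = n + m → σ.mem 4 j = u → τ.mem 6 j = σ.mem 5 j - σ.mem 18 u)) ∧
      t ≤ 9 * n + 1) σ := by
  have t1 := T.terminal.le
  have t2 := T.terminal.r_le
  refine (wp.while (I := fun τ => M ≤ τ.reg 10 ∧ τ.reg 10 ≤ σ.reg 4 ∧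
      (∀ p < M, τ.mem 6 p = σ.mem 6 p) ∧
      ∀ j, M ≤ j → j < τ.reg 10 → ∀ u : Fin n,
        (σ.mem 3 j = u → τ.mem 6 j = σ.mem 5 j - σ.mem 19 u) ∧
        (σ.mem 3 j = n + m → σ.mem 4 j = u → τ.mem 6 j = σ.mem 5 j - σ.mem 18 u))
    (Φ := fun τ => 9 * (σ.reg 4 - τ.reg 10)) ?_ ?_).mono ?_
  · rw [h10]
    exact ⟨le_rfl, t1, fun _ _ => rfl, fun _ _ _ => by omega⟩
  · rintro τ hF ⟨i1, i2, i3, i4⟩ hlt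
    have b' := b.frame hF (hF.reg 15 rfl) rfl
    have e4 := hF.reg 4 rfl
    rw [e4] at hlt
    have f3 := hF.mem 3 rfl
    have f4 := hF.mem 4 rfl
    have f5 := hF.mem 5 rfl
    have f18 := hF.mem 18 rfl
    have f19 := hF.mem 19 rfl
    have hext : ∀ v, (∀ u : Fin n, (σ.mem 3 (τ.reg 10) = u →
        v = σ.mem 5 (τ.reg 10) - σ.mem 19 u) ∧
        (σ.mem 3 (τ.reg 10) = n + m → σ.mem 4 (τ.reg 10) = u →
          v = σ.mem 5 (τ.reg 10) - σ.mem 18 u)) →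
        (∀ p < M, update (τ.mem 6) (τ.reg 10) v p = σ.mem 6 p) ∧
        ∀ j, M ≤ j → j < τ.reg 10 + 1 → ∀ u : Fin n,
        (σ.mem 3 j = u → update (τ.mem 6) (τ.reg 10) v j = σ.mem 5 j - σ.mem 19 u) ∧
        (σ.mem 3 j = n + m → σ.mem 4 j = u →
          update (τ.mem 6) (τ.reg 10) v j = σ.mem 5 j - σ.mem 18 u) := by
      intro v hv
      constructor
      · intro p hp
        rw [update_of_ne (by omega), i3 p hp]
      · intro j hj hj' u
        rcases Nat.lt_succ_iff_lt_or_eq.1 hj' with hj' | rfl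
        · rw [update_of_ne hj'.ne]
          exact i4 j hj hj' u
        · rw [update_self]
          exact hv u
    apply wp.of_vc
    simp only [vc, numArrays, State.reg_setReg, State.mem_setReg, State.reg_touch,
      State.mem_touch, State.mem_setMem, State.reg_setMem, b'.r26, f3, f4, f5, f18, f19,
      Nat.reduceEqDiff, Nat.reduceLT, reduceIte, true_and]
    rcases T.cases hlt with ⟨h, -⟩ | ⟨-, u, ⟨c0, c1, c2, c3⟩ | ⟨c0, c1, c2, c3⟩⟩
    · omega
    · simp only [Node.code] at c1 c2
      have hu := u.2
      rw [c1, c2]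
      refine ⟨by omega, by omega, fun hc => by omega, fun _ => ⟨by omega, by omega, by omega,
        ⟨by omega, by omega, hext _ fun v => ⟨fun h => by omega, fun _ h => ?_⟩⟩, by omega⟩⟩
      rw [← h, c2]
    · simp only [Node.code] at c1 c2
      have hu := u.2
      rw [c1, c2]
      refine ⟨by omega, by omega, fun hc => ⟨by omega, by omega,
        ⟨by omega, by omega, hext _ fun v => ⟨fun h => ?_, fun h _ => by omega⟩⟩, by omega⟩,
        fun hc => by omega⟩
      rw [← h, c1]
  · rintro τ t hF ⟨⟨i1, i2, i3, i4⟩, hlt, ht⟩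
    rw [hF.reg 4 rfl] at hlt
    have e : τ.reg 10 = σ.reg 4 := by omega
    rw [e] at i4
    exact ⟨i3, i4, by rw [h10] at ht; omega⟩

/-- The machine state after the computation of the flow that changes `O` into `O'`. -/
structure Changed (M B : ℕ) (E : ℕ → Fin m) (U : ℕ → Fin n) (O : Orientation G) (σ : State) :
    Prop where
  marks : Marks M E U O (σ.mem 14)
  pairs : ArcPairs M E U σ
  rep : Rep (2 * M) B σ

theorem maxFlowProg_spec (N : Incidence G M E U) {σ : State} (hB : 2 * M + n + m + 2 ≤ B)
    (b : Base k M E U σ) (hO : Bits M E U O σ) (T : Network k M E U O σ)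
    (h13 : ∀ x, σ.mem 13 x = 0)
    (h18 : ∀ u : Fin n, σ.mem 18 u = k - (O.indeg u + 1))
    (h19 : ∀ u : Fin n, σ.mem 19 u = O.indeg u + 1 - k)
    (h18' : ∀ v, n ≤ v → σ.mem 18 v = 0) (h19' : ∀ v, n ≤ v → σ.mem 19 v = 0)
    {D : ℕ} (hD : 0 < D) :
    wp B maxFlowProg (fun τ t => Base k M E U τ ∧ Network k M E U O τ ∧
      (∃ (O' : Orientation G) (sup dem : ℕ → ℕ), IsChange O O' k sup dem ∧
        IsMaxFlow (O.capacity ((k : ℤ) - 1)) .source .sink (changeFlow O O' k sup dem) ∧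
        HoldsFlow (changeFlow O O' k sup dem) τ ∧ Changed M B E U O' τ) ∧
      t ≤ (267 * (2 * M) + 18) * (D + 2 * M / D + 1) + 32 * M + 9 * n + 8) σ := by
  refine wp.vc_seq (wp.vc_seq (wp.seq ?_))
  refine (buildLoop_spec (σ := (σ.setReg 10 0).setReg 6 0) hB
    (b.of_eq rfl rfl rfl rfl rfl rfl rfl rfl) rfl rfl h13).mono ?_
  rintro τ t₁ hF ⟨l, a, r6, hres, ht₁⟩
  have b₁ : Base k M E U τ := (b.of_eq rfl rfl rfl rfl rfl rfl rfl rfl :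
    Base k M E U ((σ.setReg 10 0).setReg 6 0)).frame hF (hF.reg 15 rfl) rfl
  have e18 : τ.mem 18 = σ.mem 18 := hF.mem 18 rfl
  have e19 : τ.mem 19 = σ.mem 19 := hF.mem 19 rfl
  have R := a.rep hB l b₁.r5 r6
  have m₀ : Marks M E U O (τ.mem 14) := by
    intro p hp
    rw [(hres p hp).1, (hres p hp).2, State.mem_setReg, State.mem_setReg, hO p hp]
    split_ifs <;> simp
  refine wp.seq ((augmentLoop_spec R ?_ ?_ hD).mono ?_)
  · intro h hh
    obtain ⟨p, hp, rfl | rfl⟩ := even_or_odd_of_lt hh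
    · rw [a.tw_even p hp, (m₀ p hp).1, (m₀ p hp).2]
      split_ifs <;> rfl
    · rw [a.tw_odd p hp, (m₀ p hp).1, (m₀ p hp).2]
      split_ifs <;> rfl
  · intro v
    rw [e18, e19]
    rcases lt_or_ge v n with h | h
    · have h1 := h18 ⟨v, h⟩
      have h2 := h19 ⟨v, h⟩
      simp only at h1 h2
      omega
    · exact Or.inl (h18' v h)
  rintro ρ t₂ hF₂ ⟨F, L, hdem, ht₂⟩
  rw [e18, e19] at F
  obtain ⟨O', m₁⟩ := N.exists_marks (res := ρ.mem 14) fun p hp => by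
    have := F.res_tw (2 * p) (by omega)
    rwa [a.tw_even p hp] at this
  have C : IsChange O O' k (ρ.mem 18) (ρ.mem 19) := F.isChange a N m₀ m₁ h18 h19
    (fun e => h18' _ (Nat.le_add_right _ _)) fun e => h19' _ (Nat.le_add_right _ _)
  have hmax := C.isMaxFlow_of_level a N m₁ L F.excl hdem
  refine wp.vc_seq (wp.vc_seq (wp.vc_seq (wp.seq ?_)))
  have b₂ : Base k M E U (((ρ.setReg 15 1).setReg 10 0).setReg 14 1) :=
    b₁.of_eq (hF₂.reg 0 rfl) (hF₂.reg 2 rfl) (hF₂.reg 5 rfl) (hF₂.reg 7 rfl) b₁.r15.symm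
      (hF₂.reg 26 rfl) (hF₂.mem 1 rfl) (hF₂.mem 8 rfl)
  refine (unitFlowLoop_spec hB b₂ (O := O) (O' := O') ?_ m₁ rfl rfl).mono ?_
  · intro p hp
    exact (congrFun ((hF₂.mem 2 rfl).trans (hF.mem 2 rfl)) p).trans (hO p hp)
  rintro π t₃ hF₃ ⟨hu, h10, ht₃⟩
  have b₃ : Base k M E U π := b₂.frame hF₃ (hF₃.reg 15 rfl) rfl
  have T₃ : Network k M E U O π := T.of_eq
    ((hF₃.reg 4 rfl).trans ((hF₂.reg 4 rfl).trans (hF.reg 4 rfl)))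
    ((hF₃.mem 3 rfl).trans ((hF₂.mem 3 rfl).trans (hF.mem 3 rfl)))
    ((hF₃.mem 4 rfl).trans ((hF₂.mem 4 rfl).trans (hF.mem 4 rfl)))
    ((hF₃.mem 5 rfl).trans ((hF₂.mem 5 rfl).trans (hF.mem 5 rfl)))
  refine (terminalFlowLoop_spec hB b₃ T₃ h10).mono ?_
  rintro ω t₄ hF₄ ⟨hu', hterm, ht₄⟩
  have T₄ : Network k M E U O ω := T₃.of_eq (hF₄.reg 4 rfl) (hF₄.mem 3 rfl) (hF₄.mem 4 rfl)
    (hF₄.mem 5 rfl)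
  refine ⟨b₃.frame hF₄ (hF₄.reg 15 rfl) rfl, T₄,
    ⟨O', ρ.mem 18, ρ.mem 19, C, hmax, T₄.holdsFlow N ?_ ?_, ?_, ?_, ?_⟩, ?_⟩
  · intro p hp
    rw [hu' p hp, hu p hp]
  · intro j hj hj' u
    rw [hF₄.reg 4 rfl] at hj'
    rw [hF₄.mem 3 rfl, hF₄.mem 4 rfl, hF₄.mem 5 rfl]
    have e18 : π.mem 18 = ρ.mem 18 := hF₃.mem 18 rfl
    have e19 : π.mem 19 = ρ.mem 19 := hF₃.mem 19 rfl
    rw [← e18, ← e19]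
    exact hterm j hj hj' u
  · rw [hF₄.mem 14 rfl, hF₃.mem 14 rfl]
    exact m₁
  · have a₂ : ArcPairs M E U (((ρ.setReg 15 1).setReg 10 0).setReg 14 1) := by
      obtain ⟨a1, a2, a3, a4⟩ := a.frame hF₂ rfl
      exact ⟨a1, a2, a3, a4⟩
    exact (a₂.frame hF₃ rfl).frame hF₄ rfl
  · have R₂ := R.frame hF₂ rfl
    have R₃ : Rep (2 * M) B (((ρ.setReg 15 1).setReg 10 0).setReg 14 1) :=
      R₂.of_eq rfl rfl rfl rfl rfl rfl
    exact (R₃.frame hF₃ rfl).frame hF₄ rfl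
  · omega

end DSM

namespace DSM

open Finset Function

/-! ### The programs for the new orientation and for its dense set -/

/-- Read off the new orientation from the residual arcs. -/
def reverseLoop : Prog :=
  .whileLt 10 7 (.load 12 14 14 ;; .store 2 10 12 ;; .inc 14 ;; .inc 14 ;; .inc 10)

/-- Compute the new orientation. -/
def reverseProg : Prog := .const 10 0 ;; .const 14 1 ;; reverseLoop

/-- Clear the indegrees and the supplies. -/
def clearLoop : Prog := .whileLt 10 26 (.store 9 10 5 ;; .store 18 10 5 ;; .inc 10)

/-- Put the vertices of indegree at least `k` into the output, and give them a positive supply. -/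
def denseLoop : Prog :=
  .whileLt 10 0 (.load 11 9 10 ;;
    .ifLt 11 2 (.store 7 10 5) (.store 18 10 15 ;; .store 7 10 15) ;; .inc 10)

/-- Reverse the residual arcs. -/
def flipLoop : Prog :=
  .whileLt 10 6 (.load 11 14 10 ;; .sub 11 15 11 ;; .store 14 10 11 ;; .inc 10)

/-- Put the nodes of positive level into the output. -/
def reachLoop : Prog :=
  .whileLt 10 6 (.load 11 10 10 ;; .load 12 15 11 ;; .ifLt 5 12 (.store 7 11 15) skip ;; .inc 10)

/-- Compute the vertices that can reach a vertex of indegree at least `k`. -/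
def extractProg : Prog :=
  .const 10 0 ;; clearLoop ;; .const 10 0 ;; indegLoop ;; .const 10 0 ;; denseLoop ;;
    .const 10 0 ;; flipLoop ;; bfs ;; .const 10 0 ;; reachLoop

variable {n m k M K B : ℕ} {G : Hypergraph n m} {E : ℕ → Fin m} {U : ℕ → Fin n}
  {O : Orientation G}

theorem reverseProg_spec {σ : State} (hB : 2 * M + n + m + 2 ≤ B) (b : Base k M E U σ)
    (h : Marks M E U O (σ.mem 14)) :
    wp B reverseProg (fun τ t => Bits M E U O τ ∧ t ≤ 6 * M + 3) σ := by
  refine wp.vc_seq (wp.vc_seq ?_)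
  refine (wp.while (σ := (σ.setReg 10 0).setReg 14 1)
    (I := fun τ => τ.reg 10 ≤ M ∧ τ.reg 14 = 2 * τ.reg 10 + 1 ∧ Bits (τ.reg 10) E U O τ)
    (Φ := fun τ => 6 * (M - τ.reg 10)) ?_ ?_).mono ?_
  · simp [Bits]
  · rintro τ hF ⟨i1, i2, i3⟩ hlt
    have e7 : τ.reg 7 = M := (hF.reg 7 rfl).trans b.r7
    have e14 : τ.mem 14 (τ.reg 14) = _ :=
      (congrFun (hF.mem 14 rfl) _).trans ((congrArg (σ.mem 14) i2).trans (h _ (e7 ▸ hlt)).2)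
    rw [e7] at hlt
    apply wp.of_vc
    simp only [vc, numArrays, State.reg_setReg, State.reg_touch, State.reg_setMem, e14,
      Nat.reduceEqDiff, Nat.reduceLT, reduceIte, true_and]
    refine ⟨by omega, by omega, ⟨by omega, by omega, fun p hp => ?_⟩, by omega⟩
    simp only [State.mem_setReg, State.mem_setMem, State.mem_touch, reduceIte]
    rcases Nat.lt_succ_iff_lt_or_eq.1 hp with hp | rfl
    · rw [update_of_ne hp.ne, i3 p hp]
    · rw [update_self]
  · rintro τ t hF ⟨⟨i1, i2, i3⟩, hlt, ht⟩
    have e7 : τ.reg 7 = M := (hF.reg 7 rfl).trans b.r7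
    rw [e7] at hlt
    have e : τ.reg 10 = M := by omega
    rw [e] at i3
    simp only [State.reg_setReg, Nat.reduceEqDiff, reduceIte] at ht
    exact ⟨i3, by omega⟩

theorem clearLoop_spec {σ : State} (h5 : σ.reg 5 = 0) (hB : σ.reg 26 ≤ B) (h10 : σ.reg 10 = 0) :
    wp B clearLoop (fun τ t => (∀ v < σ.reg 26, τ.mem 9 v = 0 ∧ τ.mem 18 v = 0) ∧
      t ≤ 4 * σ.reg 26 + 1) σ := by
  refine (wp.while (I := fun τ => τ.reg 10 ≤ σ.reg 26 ∧
      ∀ v < τ.reg 10, τ.mem 9 v = 0 ∧ τ.mem 18 v = 0)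
    (Φ := fun τ => 4 * (σ.reg 26 - τ.reg 10)) ?_ ?_).mono ?_
  · simp [h10]
  · rintro τ hF ⟨i1, i2⟩ hlt
    have e5 : τ.reg 5 = 0 := (hF.reg 5 rfl).trans h5
    rw [hF.reg 26 rfl] at hlt
    apply wp.of_vc
    simp only [vc, numArrays, State.reg_setReg, State.mem_setReg, State.reg_touch,
      State.mem_touch, State.mem_setMem, State.reg_setMem, e5,
      Nat.reduceEqDiff, Nat.reduceLT, reduceIte, true_and]
    refine ⟨by omega, by omega, ⟨by omega, fun v hv => ?_⟩, by omega⟩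
    rcases Nat.lt_succ_iff_lt_or_eq.1 hv with hv | rfl
    · rw [update_of_ne hv.ne, update_of_ne hv.ne]
      exact i2 v hv
    · rw [update_self, update_self]
      exact ⟨rfl, rfl⟩
  · rintro τ t hF ⟨⟨i1, i2⟩, hlt, ht⟩
    rw [hF.reg 26 rfl] at hlt
    exact ⟨fun v hv => i2 v (by omega), by omega⟩

/-- Vertices of large indegree are written to the output directly and not left to the search, which
does not see vertices outside all hyperedges. For `k = 0` these belong to the output as well. -/
theorem denseLoop_spec {σ : State} (b : Base k M E U σ) (hB : 2 * M + n + m + 2 ≤ B)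
    (h10 : σ.reg 10 = 0) (hw : ∀ u : Fin n, σ.mem 9 u = O.indeg u)
    (h18 : ∀ v < n + m, σ.mem 18 v = 0) :
    wp B denseLoop (fun τ t => (∀ u : Fin n, (0 < τ.mem 18 u ↔ k ≤ O.indeg u) ∧
        τ.mem 7 u = if k ≤ O.indeg u then 1 else 0) ∧
      (∀ e : Fin m, τ.mem 18 (n + e) = 0) ∧ t ≤ 6 * n + 1) σ := by
  refine (wp.while (I := fun τ => τ.reg 10 ≤ n ∧
      (∀ u : Fin n, u < τ.reg 10 → (0 < τ.mem 18 u ↔ k ≤ O.indeg u) ∧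
        τ.mem 7 u = if k ≤ O.indeg u then 1 else 0) ∧
      ∀ v, τ.reg 10 ≤ v → v < n + m → τ.mem 18 v = 0)
    (Φ := fun τ => 6 * (n - τ.reg 10)) ?_ ?_).mono ?_
  · rw [h10]
    exact ⟨Nat.zero_le _, fun _ h => absurd h (Nat.not_lt_zero _), fun v _ => h18 v⟩
  · rintro τ hF ⟨i1, i2, i3⟩ hlt
    have b' := b.frame hF (hF.reg 15 rfl) rfl
    rw [b'.r0] at hlt
    have e9 : τ.mem 9 (τ.reg 10) = O.indeg ⟨τ.reg 10, hlt⟩ :=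
      (congrFun (hF.mem 9 rfl) _).trans (hw ⟨τ.reg 10, hlt⟩)
    apply wp.of_vc
    simp only [vc, numArrays, State.reg_setReg, State.mem_setReg, State.reg_touch,
      State.mem_touch, State.mem_setMem, State.reg_setMem, e9, b'.r2, b'.r5, b'.r15,
      Nat.reduceEqDiff, Nat.reduceLT, reduceIte, true_and]
    refine ⟨by omega, fun hc => ⟨by omega, ⟨by omega, fun u hu => ?_, fun v hv hv' => ?_⟩,
      by omega⟩, fun hc => ⟨by omega, by omega, ⟨by omega, fun u hu => ?_, fun v hv hv' => ?_⟩,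
      by omega⟩⟩
    · rcases Nat.lt_succ_iff_lt_or_eq.1 hu with hu | hu
      · rw [update_of_ne hu.ne]
        exact i2 u hu
      · obtain rfl : u = ⟨τ.reg 10, hlt⟩ := Fin.ext hu
        rw [update_self, i3 _ le_rfl (by omega), if_neg (by omega)]
        exact ⟨⟨fun h => absurd h (lt_irrefl _), fun h => by omega⟩, rfl⟩
    · exact i3 v (by omega) hv'
    · rcases Nat.lt_succ_iff_lt_or_eq.1 hu with hu | hu
      · rw [update_of_ne hu.ne, update_of_ne hu.ne]
        exact i2 u hu
      · obtain rfl : u = ⟨τ.reg 10, hlt⟩ := Fin.ext hu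
        rw [update_self, update_self, if_pos hc]
        exact ⟨⟨fun _ => hc, fun _ => one_pos⟩, rfl⟩
    · rw [update_of_ne (by omega)]
      exact i3 v (by omega) hv'
  · rintro τ t hF ⟨⟨i1, i2, i3⟩, hlt, ht⟩
    rw [hF.reg 0 rfl, b.r0] at hlt
    exact ⟨fun u => i2 u (by omega), fun e => i3 _ (by omega) (by omega),
      by rw [h10] at ht; omega⟩

theorem flipLoop_spec {σ : State} (R : Rep K B σ) (h15 : σ.reg 15 = 1) (h10 : σ.reg 10 = 0) :
    wp B flipLoop (fun τ t => (∀ h < K, τ.mem 14 h = 1 - σ.mem 14 h) ∧ t ≤ 5 * K + 1) σ := by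
  have hK := R.lt
  refine (wp.while (I := fun τ => τ.reg 10 ≤ K ∧ (∀ h < τ.reg 10, τ.mem 14 h = 1 - σ.mem 14 h) ∧
      ∀ h, τ.reg 10 ≤ h → τ.mem 14 h = σ.mem 14 h)
    (Φ := fun τ => 5 * (K - τ.reg 10)) ?_ ?_).mono ?_
  · simp [h10]
  · rintro τ hF ⟨i1, i2, i3⟩ hlt
    rw [(R.frame hF rfl).size] at hlt
    have e15 : τ.reg 15 = 1 := (hF.reg 15 rfl).trans h15
    apply wp.of_vc
    simp only [vc, numArrays, State.reg_setReg, State.mem_setReg, State.reg_touch,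
      State.mem_touch, State.mem_setMem, State.reg_setMem, e15, i3 _ le_rfl,
      Nat.reduceEqDiff, Nat.reduceLT, reduceIte, true_and]
    refine ⟨by omega, by omega, ⟨by omega, fun h hh => ?_, fun h hh => ?_⟩, by omega⟩
    · rcases Nat.lt_succ_iff_lt_or_eq.1 hh with hh | rfl
      · rw [update_of_ne hh.ne, i2 h hh]
      · rw [update_self]
    · rw [update_of_ne (by omega), i3 h (by omega)]
  · rintro τ t hF ⟨⟨i1, i2, i3⟩, hlt, ht⟩
    rw [(R.frame hF rfl).size] at hlt
    exact ⟨fun h hh => i2 h (by omega), by rw [h10] at ht; omega⟩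

open Classical in
-- Visited hyperedges are marked too, at indices from `n` on, where the output is not read.
theorem reachLoop_spec {σ : State} (R : Rep K B σ) (h15 : σ.reg 15 = 1) (h10 : σ.reg 10 = 0) :
    wp B reachLoop (fun τ t => (∀ x, τ.mem 7 x =
      if 0 < σ.mem 15 x ∧ ∃ h < K, σ.mem 10 h = x then 1 else σ.mem 7 x) ∧ t ≤ 6 * K + 1) σ := by
  have hK := R.lt
  refine (wp.while (I := fun τ => τ.reg 10 ≤ K ∧ ∀ x, τ.mem 7 x =
      if 0 < σ.mem 15 x ∧ ∃ h < τ.reg 10, σ.mem 10 h = x then 1 else σ.mem 7 x)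
    (Φ := fun τ => 6 * (K - τ.reg 10)) ?_ ?_).mono ?_
  · simp [h10]
  · rintro τ hF ⟨i1, i2⟩ hlt
    rw [(R.frame hF rfl).size] at hlt
    have hown := R.own_lt _ hlt
    have e15 : τ.reg 15 = 1 := (hF.reg 15 rfl).trans h15
    have e5 : τ.reg 5 = 0 := (hF.reg 5 rfl).trans R.zero
    have f10 := hF.mem 10 rfl
    have f15 := hF.mem 15 rfl
    have hex : ∀ x, (∃ h < τ.reg 10 + 1, σ.mem 10 h = x) ↔
        (∃ h < τ.reg 10, σ.mem 10 h = x) ∨ σ.mem 10 (τ.reg 10) = x := by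
      intro x
      simp only [Nat.lt_succ_iff_lt_or_eq, or_and_right, exists_or, exists_eq_left]
    apply wp.of_vc
    simp only [vc, numArrays, skip, State.reg_setReg, State.mem_setReg, State.reg_touch,
      State.mem_touch, State.mem_setMem, State.reg_setMem, e15, e5, f10, f15, hex,
      Nat.reduceEqDiff, Nat.reduceLT, reduceIte, true_and]
    refine ⟨by omega, by omega, fun hc => ⟨by omega, ⟨by omega, fun x => ?_⟩, by omega⟩,
      fun hc => ⟨⟨by omega, fun x => ?_⟩, by omega⟩⟩
    · by_cases e : σ.mem 10 (τ.reg 10) = x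
      · rw [e] at hc ⊢
        rw [update_self, if_pos ⟨hc, Or.inr rfl⟩]
      · rw [update_of_ne (Ne.symm e), i2 x]
        simp only [e, or_false]
    · rw [i2 x]
      by_cases e : σ.mem 10 (τ.reg 10) = x
      · rw [e] at hc
        rw [if_neg fun h => by omega, if_neg fun h => by omega]
      · simp only [e, or_false]
  · rintro τ t hF ⟨⟨i1, i2⟩, hlt, ht⟩
    rw [(R.frame hF rfl).size] at hlt
    have e : τ.reg 10 = K := by omega
    rw [e] at i2
    exact ⟨i2, by rw [h10] at ht; omega⟩

theorem Rep.setReg {σ : State} (R : Rep K B σ) {r : ℕ} (v : ℕ) (h : r = 10) :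
    Rep K B (σ.setReg r v) := by
  subst h
  exact R.of_eq rfl rfl rfl rfl rfl rfl

theorem Base.setReg {σ : State} (b : Base k M E U σ) {r : ℕ} (v : ℕ) (h : r = 10) :
    Base k M E U (σ.setReg r v) := by
  subst h
  exact b.of_eq rfl rfl rfl rfl rfl rfl rfl rfl

/-- Complementing the bits exchanges every residual arc with its reverse. A search from the vertices
of indegree at least `k` then finds the vertices that can reach them. -/
theorem extractProg_spec (N : Incidence G M E U) {σ : State} (hB : 2 * M + n + m + 2 ≤ B)
    (b : Base k M E U σ) (hO : Bits M E U O σ) (c : Changed M B E U O σ) :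
    wp B extractProg (fun τ t => HoldsSet (O.denseSet k) τ ∧
      t ≤ 137 * M + 10 * n + 4 * m + 18) σ := by
  classical
  obtain ⟨hmarks, a, R⟩ := c
  refine wp.vc_seq (wp.seq ?_)
  refine (clearLoop_spec (σ := σ.setReg 10 0) b.r5 (by
    rw [State.reg_setReg, if_neg (by decide), b.r26]; omega) rfl).mono ?_
  rintro σ₁ t₁ hF₁ ⟨hz, ht₁⟩
  simp only [State.reg_setReg, Nat.reduceEqDiff, reduceIte, b.r26] at hz ht₁
  have b₁ := (b.setReg 0 rfl).frame hF₁ (hF₁.reg 15 rfl) rfl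
  have R₁ := (R.setReg 0 rfl).frame hF₁ rfl
  refine wp.vc_seq (wp.seq ?_)
  refine (indegLoop_spec (O := O) N hB (b₁.setReg 0 rfl) ?_ rfl ?_).mono ?_
  · intro p hp
    exact (congrFun (hF₁.mem 2 rfl) p).trans (hO p hp)
  · exact fun u hu => (hz u (by omega)).1
  rintro σ₂ t₂ hF₂ ⟨hw, ht₂⟩
  have b₂ := (b₁.setReg 0 rfl).frame hF₂ (hF₂.reg 15 rfl) rfl
  have R₂ := (R₁.setReg 0 rfl).frame hF₂ rfl
  refine wp.vc_seq (wp.seq ?_)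
  refine (denseLoop_spec (O := O) (b₂.setReg 0 rfl) hB rfl hw ?_).mono ?_
  · exact fun v hv => (congrFun (hF₂.mem 18 rfl) v).trans (hz v hv).2
  rintro σ₃ t₃ hF₃ ⟨hd, hd', ht₃⟩
  have b₃ := (b₂.setReg 0 rfl).frame hF₃ (hF₃.reg 15 rfl) rfl
  have R₃ := (R₂.setReg 0 rfl).frame hF₃ rfl
  refine wp.vc_seq (wp.seq ?_)
  refine (flipLoop_spec (R₃.setReg 0 rfl) b₃.r15 rfl).mono ?_
  rintro σ₄ t₄ hF₄ ⟨hfl, ht₄⟩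
  have R₄ := (R₃.setReg 0 rfl).frame hF₄ rfl
  have e14 : (σ₃.setReg 10 0).mem 14 = σ.mem 14 :=
    (hF₃.mem 14 rfl).trans ((hF₂.mem 14 rfl).trans (hF₁.mem 14 rfl))
  have e10 : σ₄.mem 10 = σ.mem 10 :=
    (hF₄.mem 10 rfl).trans ((hF₃.mem 10 rfl).trans ((hF₂.mem 10 rfl).trans (hF₁.mem 10 rfl)))
  have e11 : σ₄.mem 11 = σ.mem 11 :=
    (hF₄.mem 11 rfl).trans ((hF₃.mem 11 rfl).trans ((hF₂.mem 11 rfl).trans (hF₁.mem 11 rfl)))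
  have e18 : σ₄.mem 18 = σ₃.mem 18 := hF₄.mem 18 rfl
  rw [e14] at hfl
  have hres : ∀ h < 2 * M, σ₄.mem 14 h ≤ 1 := fun h hh => by
    rw [hfl h hh]
    exact Nat.sub_le _ _
  have hmarks' : Marks M E U O fun h => 1 - σ₄.mem 14 h := by
    intro p hp
    obtain ⟨h1, h2⟩ := hmarks p hp
    dsimp only
    rw [hfl _ (by omega), hfl _ (by omega), h1, h2]
    split_ifs <;> exact ⟨rfl, rfl⟩
  refine wp.seq ((bfs_spec R₄ hres).mono ?_)
  rintro σ₅ t₅ hF₅ ⟨L, h15, ht₅⟩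
  rw [e10, e11, e18] at L
  have R₅ := R₄.frame hF₅ rfl
  have hdense := mem_denseSet_iff a N hmarks' hres L (fun u => (hd u).1) hd'
  refine wp.vc_seq ?_
  refine (reachLoop_spec (R₅.setReg 0 rfl) h15 rfl).mono ?_
  rintro σ₆ t₆ hF₆ ⟨hout, ht₆⟩
  refine ⟨fun u => ?_, by omega⟩
  have e7 : σ₅.mem 7 = σ₃.mem 7 := (hF₅.mem 7 rfl).trans (hF₄.mem 7 rfl)
  have e10' : σ₅.mem 10 = σ.mem 10 := (hF₅.mem 10 rfl).trans e10
  have hex : (∃ h < 2 * M, σ.mem 10 h = u) ↔ ∃ p < M, U p = u := by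
    constructor
    · rintro ⟨h, hh, he⟩
      obtain ⟨p, hp, rfl | rfl⟩ := even_or_odd_of_lt hh
      · rw [a.own_even p hp] at he
        exact ⟨p, hp, Fin.ext he⟩
      · rw [a.own_odd p hp] at he
        have := u.2
        omega
    · rintro ⟨p, hp, rfl⟩
      exact ⟨2 * p, by omega, a.own_even p hp⟩
  have h := hout u
  simp only [State.mem_setReg, e7, e10', hex, (hd u).2] at h
  rw [h, Set.indicator_apply, hdense u]
  by_cases h1 : k ≤ O.indeg u <;> by_cases h2 : 0 < σ₅.mem 15 u ∧ ∃ p < M, U p = u <;>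
    simp [h1, h2]

end DSM

/-! ### Assembly and the numerical bounds -/

namespace DSM

open Finset Function

/-! ### The whole program -/

/-- A program for DSM-FLOW. -/
def flowProg : FlowProgram where
  orient := orientProg
  network := networkProg
  maxFlow := maxFlowProg
  reverse := reverseProg
  extract := extractProg

variable {n m : ℕ} {G : Hypergraph n m}

theorem TerminalArcs.congr {k M r : ℕ} {w w' : ℕ → ℕ} {σ : State}
    (T : TerminalArcs n m k M w n r σ) (h : ∀ u < n, w' u = w u) :
    TerminalArcs n m k M w' n r σ where
  le := T.le
  r_le := T.r_le
  listed j h1 h2 := by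
    obtain ⟨u, hu, h'⟩ := T.listed j h1 h2
    refine ⟨u, hu, ?_⟩
    rwa [h u hu]
  source u hu := by
    rw [h u hu]
    exact T.source u hu
  sink u hu := by
    rw [h u hu]
    exact T.sink u hu
  inj := T.inj

/-- The bound `B = 2 * M + n + m + 2` with `M = L.offset m` exceeds every index in use, in
particular those of the `2 * M` arcs, the `n + m` nodes and the at most `M + n` arcs of the network.
With `32` arrays this bounds the memory. `D` is still free. -/
theorem flowProg_runs (hm : 0 < m) (L : Listing G) (k δ : ℕ) {D : ℕ} (hD : 0 < D) :
    ∃ t s, flowProg.Runs L k δ t s ∧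
      t ≤ (534 * L.offset m + 18) * (D + 2 * L.offset m / D + 1) +
        211 * L.offset m + 32 * n + 4 * m + 43 ∧
      s ≤ 32 * (2 * L.offset m + n + m + 2) := by
  obtain ⟨E, U, N⟩ := L.exists_numbering hm
  obtain ⟨B, hB⟩ : ∃ B, 2 * L.offset m + n + m + 2 = B := ⟨_, rfl⟩
  have hB' := hB.le
  obtain ⟨t₁, σ₁, e₁, u₁, b₁, hO, ht₁⟩ := orientProg_spec (k := k) (δ := δ) hm N hB'
  have F₁ := e₁.frame
  have hzero : ∀ a, a ≠ 0 → a ≠ 1 → orientProg.setsMem a = false → ∀ v, σ₁.mem a v = 0 := by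
    intro a h0 h1 h v
    rw [F₁.mem a h]
    simp [Listing.input, h0, h1]
  obtain ⟨t₂, σ₂, e₂, u₂, hunit, ⟨w, hw, T, h18, h19⟩, ht₂⟩ :=
    networkProg_spec N.incidence hB' b₁ hO (hzero 9 (by decide) (by decide) rfl)
      (hzero 18 (by decide) (by decide) rfl) (hzero 19 (by decide) (by decide) rfl)
  have F₂ := e₂.frame
  have b₂ := b₁.frame F₂ (F₂.reg 15 rfl) rfl
  have hO₂ : Bits (L.offset m) E U (L.orientation δ) σ₂ := fun p hp =>
    (congrFun (F₂.mem 2 rfl) p).trans (hO p hp)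
  have T₂ : Network k (L.offset m) E U (L.orientation δ) σ₂ := ⟨hunit, T.congr fun u hu => by
    rw [dif_pos hu]
    exact (hw ⟨u, hu⟩).symm⟩
  obtain ⟨t₃, σ₃, e₃, u₃, b₃, T₃, ⟨O', sup, dem, C, hmax, hflow, c₃⟩, ht₃⟩ :=
    maxFlowProg_spec N.incidence hB' b₂ hO₂ T₂
      (fun v => (congrFun (F₂.mem 13 rfl) v).trans (hzero 13 (by decide) (by decide) rfl v))
      (fun u => by rw [h18, if_pos u.2, hw]) (fun u => by rw [h19, if_pos u.2, hw])
      (fun v hv => by rw [h18, if_neg (not_lt.2 hv)])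
      (fun v hv => by rw [h19, if_neg (not_lt.2 hv)]) hD
  obtain ⟨t₄, σ₄, e₄, u₄, hO₄, ht₄⟩ := reverseProg_spec hB' b₃ c₃.marks
  have F₄ := e₄.frame
  have b₄ := b₃.frame F₄ (F₄.reg 15 rfl) rfl
  have c₄ : Changed (L.offset m) B E U O' σ₄ :=
    ⟨by rw [F₄.mem 14 rfl]; exact c₃.marks, c₃.pairs.frame F₄ rfl, c₃.rep.frame F₄ rfl⟩
  obtain ⟨t₅, σ₅, e₅, u₅, hset, ht₅⟩ := extractProg_spec N.incidence hB' b₄ hO₄ c₄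
  have hrev := C.reverseSaturated_eq
  have hused : σ₅.used ⊆ cells B := by
    refine u₅.trans (union_subset (u₄.trans (union_subset (u₃.trans (union_subset (u₂.trans
      (union_subset (u₁.trans ?_) subset_rfl)) subset_rfl)) subset_rfl)) subset_rfl)
    simp [Listing.input]
  refine ⟨_, _, ⟨t₁, t₂, t₃, t₄, t₅, σ₁, σ₂, σ₃, σ₄, σ₅, L.orientation δ,
    changeFlow (L.orientation δ) O' k sup dem,
    ⟨e₁, L.isDelta_orientation δ, fun _ => rfl, Listing.holdsOrientation_of N hO⟩,
    ⟨e₂, T₂.holdsNetwork N.incidence⟩, ⟨e₃, hmax, T₃.holdsNetwork N.incidence, hflow⟩,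
    ⟨e₄, ?_⟩, ⟨e₅, ?_⟩, rfl, rfl⟩, ?_, ?_⟩
  · rw [hrev]
    exact Listing.holdsOrientation_of N hO₄
  · rw [hrev]
    exact hset
  · rw [show 534 * L.offset m = 267 * (2 * L.offset m) by ring]
    omega
  · refine (card_le_card hused).trans ?_
    simp [cells, numArrays, hB]

theorem Listing.card_le_offset (L : Listing G) (h : ∀ u, ∃ e, u ∈ G.edge e) : n ≤ L.offset m := by
  rw [L.offset_last]
  refine le_trans ?_ (card_biUnion_le (s := univ) (t := G.edge))
  rw [eq_univ_iff_forall.2 fun u => mem_biUnion.2 ⟨_, mem_univ _, (h u).choose_spec⟩, card_univ,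
    Fintype.card_fin]

theorem Listing.mul_avgSize (hm : 0 < m) (L : Listing G) : (m : ℝ) * G.avgSize = L.offset m := by
  have : (m : ℝ) ≠ 0 := Nat.cast_ne_zero.2 hm.ne'
  rw [Hypergraph.avgSize, L.offset_last]
  push_cast
  field_simp

/-- The number of steps for `M` incidences if the phases are split at the square root of `2 M`. -/
theorem steps_le {M : ℕ} (hM : 0 < M) :
    (((534 * M + 18) * (Nat.sqrt (2 * M) + 1 + 2 * M / (Nat.sqrt (2 * M) + 1) + 1) : ℕ) : ℝ) ≤
      3312 * (M : ℝ) ^ (3 / 2 : ℝ) := by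
  -- With `K = 2 * M` and `D = Nat.sqrt K + 1` one has `K < D * D`, so the quotient `K / D` is at
  -- most `D - 1`.
  have h1 : 2 * M / (Nat.sqrt (2 * M) + 1) ≤ Nat.sqrt (2 * M) :=
    Nat.lt_succ_iff.1 (Nat.div_lt_of_lt_mul (Nat.lt_succ_sqrt _))
  have h2 : (534 * M + 18) * (Nat.sqrt (2 * M) + 1 + 2 * M / (Nat.sqrt (2 * M) + 1) + 1) ≤
      552 * M * (2 * Nat.sqrt (2 * M) + 2) := Nat.mul_le_mul (by omega) (by omega)
  refine (Nat.cast_le.2 h2).trans ?_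
  have hM' : (1 : ℝ) ≤ M := by exact_mod_cast hM
  have h3 : (M : ℝ) ^ (3 / 2 : ℝ) = M * √M := by
    rw [show (3 / 2 : ℝ) = 1 + 1 / 2 by norm_num, Real.rpow_add (by linarith), Real.rpow_one,
      Real.sqrt_eq_rpow]
  have h4 : (1 : ℝ) ≤ √M := Real.one_le_sqrt.2 hM'
  have h5 : (Nat.sqrt (2 * M) : ℝ) ≤ 2 * √M := by
    refine Real.nat_sqrt_le_real_sqrt.trans (Real.sqrt_le_iff.2 ⟨by positivity, ?_⟩)
    rw [mul_pow, Real.sq_sqrt (by linarith)]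
    push_cast
    linarith
  rw [h3]
  push_cast
  -- `2 * (2 * √M) + 2 ≤ 6 * √M` since `√M ≥ 1`; and `552 * 6 = 3312`.
  have : (M : ℝ) * (2 * (Nat.sqrt (2 * M) : ℝ) + 2) ≤ M * (6 * √M) :=
    mul_le_mul_of_nonneg_left (by linarith) (by linarith)
  linarith

end DSM

theorem mainTheorem9 :
    ∃ (A : DSM.FlowProgram) (C : ℝ),
      ∀ (n m : ℕ) (_ : 0 < m) (G : DSM.Hypergraph n m) (L : DSM.Listing G) (k δ : ℕ),
        ∃ t s : ℕ, A.Runs L k δ t s ∧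
          ((∀ u, ∃ e, u ∈ G.edge e) →
            (t : ℝ) ≤ C * ((m : ℝ) ^ (3 / 2 : ℝ) * G.avgSize ^ (3 / 2 : ℝ))) ∧
          (t : ℝ) ≤ C * (n + (m : ℝ) ^ (3 / 2 : ℝ) * G.avgSize ^ (3 / 2 : ℝ)) ∧
          (s : ℝ) ≤ C * (n + m * G.avgSize) := by
  refine ⟨DSM.flowProg, 4000, fun n m hm G L k δ => ?_⟩
  obtain ⟨t, s, hruns, ht, hs⟩ := DSM.flowProg_runs hm L k δ (D := Nat.sqrt (2 * L.offset m) + 1)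
    (Nat.succ_pos _)
  have hmM := L.le_offset le_rfl
  have hM : 0 < L.offset m := by omega
  have hsteps := DSM.steps_le hM
  have havg := L.mul_avgSize hm
  have hnonneg : 0 ≤ G.avgSize := by
    unfold DSM.Hypergraph.avgSize
    positivity
  have hpow : (L.offset m : ℝ) ≤ (L.offset m : ℝ) ^ (3 / 2 : ℝ) :=
    Real.self_le_rpow_of_one_le (by exact_mod_cast hM) (by norm_num)
  rw [← Real.mul_rpow (Nat.cast_nonneg m) hnonneg, havg]
  have hmM' : (m : ℝ) ≤ L.offset m := by exact_mod_cast hmM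
  have hM' : (1 : ℝ) ≤ L.offset m := by exact_mod_cast hM
  have hn : (0 : ℝ) ≤ n := Nat.cast_nonneg n
  -- `3570 = 3312 + 211 + 4 + 43`: as `1 ≤ M` and `m ≤ M`, all terms without `n` are at most
  -- multiples of the power of `M`. Under the covering hypothesis `32 * n` is absorbed as well, and
  -- `4000` leaves room.
  have ht' : (t : ℝ) ≤ 3570 * (L.offset m : ℝ) ^ (3 / 2 : ℝ) + 32 * n := by
    generalize (534 * L.offset m + 18) * _ = X at ht hsteps
    have h1 : (t : ℝ) ≤ X + 211 * L.offset m + 32 * n + 4 * m + 43 := by exact_mod_cast ht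
    linarith
  refine ⟨t, s, hruns, fun hcov => ?_, ?_, ?_⟩
  · have h1 : (n : ℝ) ≤ L.offset m := by exact_mod_cast L.card_le_offset hcov
    linarith
  · linarith
  · have h1 : (s : ℝ) ≤ 32 * (2 * L.offset m + n + m + 2) := by exact_mod_cast hs
    linarith
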